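/- Let $d\ge 2$, $m\ge 1$, and let $\Omega\subset\mathbb{R}^d$ be a bounded Lipschitz domain with surface measure $dS$ on $\partial\Omega$. Equip $L^\infty(\Omega;\mathbb{C}^{d\times d})$ with the norm $\|B\|=\operatorname{ess\,sup}_{x\in\Omega}\|B(x)\|_2$ (spectral norm), and let $L^\infty_+(\Omega)$ be the set of those $A\in L^\infty(\Omega;\mathbb{C}^{d\times d})$ for which there is a constant $c_A>0$ such that, for every $\xi\in\mathbb{C}^d$, $\operatorname{Re}[(A(x)\xi)\cdot\overline{\xi}]\ge c_A|\xi|^2$ for almost every $x\in\Omega$. Let $E_1,\dots,E_m\subset\partial\Omega$ be nonempty, connected and relatively open with mutually disjoint closures, and put $E=\bigcup_j E_j$. Let $\zeta\in L^\infty(\partial\Omega)$ satisfy $\operatorname{Re}\zeta\ge 0$ a.e. and $\zeta=0$ a.e. on $\partial\Omega\setminus E$, and suppose that there are $c_\zeta>0$ and nonempty relatively open sets $\mathcal{E}_j\subset E_j$ such that $\operatorname{Re}\zeta\ge c_\zeta$ a.e. on $\mathcal{E}=\bigcup_j\mathcal{E}_j$. Write $\mathbb{C}^m_\diamond=\{W\in\mathbb{C}^m: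 \sum_j W_j=0\}$ and $\mathbf{1}=(1,\dots,1)\in\mathbb{C}^m$; identify $V\in\mathbb{C}^m$ with the function $\sum_j V_j\chi_{E_j}$ on $\partial\Omega$; and let $\widetilde{T}:H^1(\Omega)\to L^2(\partial\Omega)$ be the Dirichlet trace operator, i.e. the unique bounded linear operator that maps the restriction to $\Omega$ of each smooth function on $\mathbb{R}^d$ to its restriction to $\partial\Omega$. Let $\mathcal{H}=(H^1(\Omega)\oplus\mathbb{C}^m)/\mathbb{C}$ be the quotient by the pairs $(c,c\mathbf{1})$, $c\in\mathbb{C}$. On it $$\|(v,V)\|_{\mathcal{H}}^2=\int_\Omega|\nabla v|^2\,dx+\|\widetilde{T}v-V\|_{L^2(\mathcal{E})}^2$$ is a norm, equivalent to the quotient norm $\inf_{c\in\mathbb{C}}(\|v-c\|_{H^1(\Omega)}^2+|V-c\mathbf{1}|^2)^{1/2}$. Let $T_1:\mathcal{H}\to H^1(\Omega)$ and $T_2:\mathcal{H}\to\mathbb{C}^m_\diamond$ be the bounded operators that send a class to the two components of its unique representative $(\tilde v,\widetilde V)$ with $\widetilde V\in\mathbb{C}^m_\diamond$. For $B\in L^\infty(\Omega;\mathbb{C}^{d\times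 d})$ put $\langle w,v\rangle_B=\int_\Omega(B\nabla w)\cdot\overline{\nabla v}\,dx$, and $$a_A[(w,W),(v,V)]=\langle w,v\rangle_A+\int_{\partial\Omega}\zeta\,(\widetilde{T}w-W)\,\overline{(\widetilde{T}v-V)}\,dS .$$ For every $A\in L^\infty_+(\Omega)$, each of the following problems has a unique solution in $\mathcal{H}$, and these solutions define bounded linear operators $N_E(A)\in\mathscr{L}(\mathbb{C}^m_\diamond,\mathcal{H})$ and $P_{E,A}\in\mathscr{L}(L^\infty(\Omega;\mathbb{C}^{d\times d}),\mathscr{L}(\mathcal{H}))$: $$a_A[N_E(A)I,(v,V)]=I\cdot\overline{V},\qquad a_A[P_{E,A}(B)(y,Y),(v,V)]=-\langle y,v\rangle_B\qquad\forall (v,V)\in\mathcal{H}.$$ Put $F_E(A)=T_1N_E(A)\in\mathscr{L}(\mathbb{C}^m_\diamond,H^1(\Omega))$ and $\Lambda_E(A)=T_2N_E(A)\in\mathscr{L}(\mathbb{C}^m_\diamond)$. Then $N_E$, $F_E$ and $\Lambda_E$ are infinitely many times continuously (complex) Fréchet differentiable and analytic on the open set $L^\infty_+(\Omega)$. For all $A\in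 L^\infty_+(\Omega)$, $k\in\mathbb{N}_0$ and $B_1,\dots,B_k\in L^\infty(\Omega;\mathbb{C}^{d\times d})$, $$D^kN_E(A;B_1,\dots,B_k)=\Bigl[\sum_{\alpha}P_{E,A}(B_{\alpha_1})\cdots P_{E,A}(B_{\alpha_k})\Bigr]N_E(A),$$ where $\alpha$ runs over all permutations of $\{1,\dots,k\}$, and $D^kF_E(A)=T_1D^kN_E(A)$, $D^k\Lambda_E(A)=T_2D^kN_E(A)$. Moreover, whenever $A\in L^\infty_+(\Omega)$ with ellipticity constant $c_A$ and $\|B\|<\min\{c_A,c_\zeta\}$, one has $A+B\in L^\infty_+(\Omega)$ and, with convergence in operator norm, \begin{align*} N_E(A+B)&=\sum_{k=0}^\infty\frac{1}{k!}D^kN_E(A;B,\dots,B)=\sum_{k=0}^\infty P_{E,A}(B)^kN_E(A),\\ F_E(A+B)&=\sum_{k=0}^\infty\frac{1}{k!}D^kF_E(A;B,\dots,B)=T_1\sum_{k=0}^\infty P_{E,A}(B)^kN_E(A),\\ \Lambda_E(A+B)&=\sum_{k=0}^\infty\frac{1}{k!}D^k\Lambda_E(A;B,\dots,B)=T_2\sum_{k=0}^\infty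 P_{E,A}(B)^kN_E(A). \end{align*} -/

import Mathlib

open MeasureTheory Set
open scoped ENNReal ContDiff

namespace SCEM

noncomputable section

/-- `ℝ^d` with the Euclidean norm. -/
abbrev RSpace (d : ℕ) : Type := EuclideanSpace ℝ (Fin d)

/-- `ℂ^n` with the Euclidean norm. -/
abbrev CSpace (n : ℕ) : Type := EuclideanSpace ℂ (Fin n)

/-- `ℂ^{d×d}`, realised as linear maps of `ℂ^d`, so that the norm is the spectral norm. -/
abbrev CMat (d : ℕ) : Type := CSpace d →L[ℂ] CSpace d

/-- A bounded Lipschitz domain in `ℝ^d`: a bounded, nonempty, connected open set that near every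
boundary point is, in suitable orthonormal coordinates with last axis `e`, the strict epigraph of
a Lipschitz function of the remaining coordinates. -/
structure LipschitzDomain (d : ℕ) where
  carrier : Set (RSpace d)
  isOpen : IsOpen carrier
  isConnected : IsConnected carrier
  isBounded : Bornology.IsBounded carrier
  lipschitz : ∀ x ∈ frontier carrier, ∃ U : Set (RSpace d), IsOpen U ∧ x ∈ U ∧
    ∃ e : RSpace d, ‖e‖ = 1 ∧
      ∃ γ : (ℝ ∙ e)ᗮ → ℝ, (∃ K : NNReal, LipschitzWith K γ) ∧
        carrier ∩ U = {y | γ ((ℝ ∙ e)ᗮ.orthogonalProjectionOnto y) < inner ℝ e y} ∩ U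

variable {d : ℕ}

namespace LipschitzDomain

/-- Lebesgue measure on `Ω`. -/
abbrev vol (Ω : LipschitzDomain d) : Measure (RSpace d) := volume.restrict Ω.carrier

/-- The surface measure `dS` on `∂Ω`: the `(d-1)`-dimensional Hausdorff measure, normalised to agree
with Lebesgue measure on hyperplanes. -/
abbrev surface (Ω : LipschitzDomain d) : Measure (RSpace d) := μHE[d - 1].restrict (frontier Ω.carrier)

end LipschitzDomain

instance (Ω : LipschitzDomain d) : IsFiniteMeasure Ω.vol :=
  ⟨by simpa using Ω.isBounded.measure_lt_top⟩

/-- `g` is the weak gradient of `u` in `Ω`. -/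
def IsWeakGradient (Ω : LipschitzDomain d) (u : Lp ℂ 2 Ω.vol) (g : Lp (CSpace d) 2 Ω.vol) : Prop :=
  ∀ φ : RSpace d → ℝ, ContDiff ℝ ∞ φ → HasCompactSupport φ → tsupport φ ⊆ Ω.carrier →
    ∀ i : Fin d, ∫ x, (fderiv ℝ φ x (EuclideanSpace.single i 1) : ℂ) * u x ∂Ω.vol
      = - ∫ x, (φ x : ℂ) * g x i ∂Ω.vol

lemma memLp_test (Ω : LipschitzDomain d) {φ : RSpace d → ℝ} (h : Continuous φ)
    (hc : HasCompactSupport φ) : MemLp (fun x => (φ x : ℂ)) 2 Ω.vol :=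
  (Complex.continuous_ofReal.comp h).memLp_of_hasCompactSupport
    (hc.comp_left (g := fun r : ℝ => (r : ℂ)) Complex.ofReal_zero)

lemma memLp_test_deriv (Ω : LipschitzDomain d) {φ : RSpace d → ℝ} (h : ContDiff ℝ ∞ φ)
    (hc : HasCompactSupport φ) (e : RSpace d) :
    MemLp (fun x => (fderiv ℝ φ x e : ℂ)) 2 Ω.vol :=
  memLp_test Ω ((h.continuous_fderiv (by simp)).clm_apply continuous_const)
    ((hc.fderiv ℝ).comp_left (g := fun L : RSpace d →L[ℝ] ℝ => L e) (by simp))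

lemma memLp_coord (Ω : LipschitzDomain d) (g : Lp (CSpace d) 2 Ω.vol) (i : Fin d) :
    MemLp (fun x => g x i) 2 Ω.vol :=
  (EuclideanSpace.proj (𝕜 := ℂ) i).comp_memLp' (Lp.memLp g)

/-- The pairs `(u, ∇u)` in `L² × L²`. -/
def H1Sub (Ω : LipschitzDomain d) :
    Submodule ℂ (WithLp 2 (Lp ℂ 2 Ω.vol × Lp (CSpace d) 2 Ω.vol)) where
  carrier := {p | IsWeakGradient Ω p.fst p.snd}
  zero_mem' := by
    intro φ _ _ _ i
    have h1 : (fun x => (fderiv ℝ φ x (EuclideanSpace.single i 1) : ℂ) *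
        (0 : Lp ℂ 2 Ω.vol) x) =ᵐ[Ω.vol] 0 := by
      filter_upwards [Lp.coeFn_zero ℂ 2 Ω.vol] with x hx
      rw [hx]
      simp
    have h2 : (fun x => (φ x : ℂ) * (0 : Lp (CSpace d) 2 Ω.vol) x i) =ᵐ[Ω.vol] 0 := by
      filter_upwards [Lp.coeFn_zero (CSpace d) 2 Ω.vol] with x hx
      rw [hx]
      simp
    simp only [WithLp.zero_fst, WithLp.zero_snd]
    rw [integral_congr_ae h1, integral_congr_ae h2]
    simp
  add_mem' := by
    intro p q hp hq φ h1 h2 h3 i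
    have hd := memLp_test_deriv Ω h1 h2 (EuclideanSpace.single i 1)
    have hφ := memLp_test Ω h1.continuous h2
    have e1 : (fun x => (fderiv ℝ φ x (EuclideanSpace.single i 1) : ℂ) * (p.fst + q.fst) x)
        =ᵐ[Ω.vol] fun x => (fderiv ℝ φ x (EuclideanSpace.single i 1) : ℂ) * p.fst x
          + (fderiv ℝ φ x (EuclideanSpace.single i 1) : ℂ) * q.fst x := by
      filter_upwards [Lp.coeFn_add p.fst q.fst] with x hx
      rw [hx]
      simp [mul_add]
    have e2 : (fun x => (φ x : ℂ) * (p.snd + q.snd) x i)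
        =ᵐ[Ω.vol] fun x => (φ x : ℂ) * p.snd x i + (φ x : ℂ) * q.snd x i := by
      filter_upwards [Lp.coeFn_add p.snd q.snd] with x hx
      rw [hx]
      simp [mul_add]
    simp only [WithLp.add_fst, WithLp.add_snd]
    have s1 := integral_add (hd.integrable_mul (Lp.memLp p.fst))
      (hd.integrable_mul (Lp.memLp q.fst))
    have s2 := integral_add (hφ.integrable_mul (memLp_coord Ω p.snd i))
      (hφ.integrable_mul (memLp_coord Ω q.snd i))
    simp only [Pi.mul_apply] at s1 s2
    rw [integral_congr_ae e1, integral_congr_ae e2, s1, s2, hp φ h1 h2 h3 i, hq φ h1 h2 h3 i]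
    ring
  smul_mem' := by
    intro c p hp φ h1 h2 h3 i
    have e1 : (fun x => (fderiv ℝ φ x (EuclideanSpace.single i 1) : ℂ) * (c • p.fst) x)
        =ᵐ[Ω.vol] fun x => c * ((fderiv ℝ φ x (EuclideanSpace.single i 1) : ℂ) * p.fst x) := by
      filter_upwards [Lp.coeFn_smul c p.fst] with x hx
      rw [hx]
      simp [mul_left_comm]
    have e2 : (fun x => (φ x : ℂ) * (c • p.snd) x i)
        =ᵐ[Ω.vol] fun x => c * ((φ x : ℂ) * p.snd x i) := by
      filter_upwards [Lp.coeFn_smul c p.snd] with x hx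
      rw [hx]
      simp [mul_left_comm]
    simp only [WithLp.smul_fst, WithLp.smul_snd]
    rw [integral_congr_ae e1, integral_congr_ae e2, integral_const_mul, integral_const_mul,
      hp φ h1 h2 h3 i]
    ring

/-- The Sobolev space `H¹(Ω)` of complex functions, an element being stored together with its weak
gradient; the norm is `(‖u‖² + ‖∇u‖²)^{1/2}`. -/
def H1 (Ω : LipschitzDomain d) : Type := H1Sub Ω

instance (Ω : LipschitzDomain d) : NormedAddCommGroup (H1 Ω) :=
  inferInstanceAs (NormedAddCommGroup (H1Sub Ω))

instance (Ω : LipschitzDomain d) : InnerProductSpace ℂ (H1 Ω) :=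
  inferInstanceAs (InnerProductSpace ℂ (H1Sub Ω))

/-- The function underlying an element of `H¹(Ω)`. -/
def H1.val {Ω : LipschitzDomain d} (v : H1 Ω) : Lp ℂ 2 Ω.vol := (Subtype.val v).fst

/-- The weak gradient of an element of `H¹(Ω)`. -/
def H1.grad {Ω : LipschitzDomain d} (v : H1 Ω) : Lp (CSpace d) 2 Ω.vol := (Subtype.val v).snd

/-- The constant function `1` in `H¹(Ω)`. -/
def H1.one (Ω : LipschitzDomain d) : H1 Ω :=
  ⟨WithLp.toLp 2 (Lp.const 2 Ω.vol (1 : ℂ), 0), by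
    intro φ h1 h2 h3 i
    have e1 : (fun x => (fderiv ℝ φ x (EuclideanSpace.single i 1) : ℂ) *
        (Lp.const 2 Ω.vol (1 : ℂ)) x) =ᵐ[Ω.vol]
        fun x => ((fderiv ℝ φ x (EuclideanSpace.single i 1) : ℝ) : ℂ) := by
      filter_upwards [Lp.coeFn_const (p := 2) (μ := Ω.vol) (1 : ℂ)] with x hx
      rw [hx]
      simp
    have e2 : (fun x => (φ x : ℂ) * (0 : Lp (CSpace d) 2 Ω.vol) x i) =ᵐ[Ω.vol] 0 := by
      filter_upwards [Lp.coeFn_zero (CSpace d) 2 Ω.vol] with x hx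
      rw [hx]
      simp
    have hint : Integrable (fun x => fderiv ℝ φ x (EuclideanSpace.single i (1 : ℝ))) volume :=
      ((h1.continuous_fderiv (by simp)).clm_apply continuous_const).integrable_of_hasCompactSupport
        ((h2.fderiv ℝ).comp_left (g := fun L : RSpace d →L[ℝ] ℝ => L _) (by simp))
    have hz : ∫ x, fderiv ℝ φ x (EuclideanSpace.single i (1 : ℝ)) = 0 := by
      have := integral_mul_fderiv_eq_neg_fderiv_mul_of_integrable (μ := volume)
        (f := fun _ : RSpace d => (1 : ℝ)) (g := φ) (v := EuclideanSpace.single i (1 : ℝ))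
        (by simp) (by simpa using hint)
        (by simpa using h1.continuous.integrable_of_hasCompactSupport h2)
        (by fun_prop) (fun x _ => h1.differentiable (by simp) x)
      simpa using this
    change ∫ x, (fderiv ℝ φ x (EuclideanSpace.single i 1) : ℂ) *
        (Lp.const 2 Ω.vol (1 : ℂ)) x ∂Ω.vol
      = - ∫ x, (φ x : ℂ) * (0 : Lp (CSpace d) 2 Ω.vol) x i ∂Ω.vol
    rw [integral_congr_ae e1, integral_congr_ae e2, integral_complex_ofReal,
      setIntegral_eq_integral_of_forall_compl_eq_zero, hz]
    · simp
    · intro x hx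
      rw [image_eq_zero_of_notMem_tsupport
        (fun h => hx (h3 (tsupport_fderiv_subset ℝ h)))]
      simp⟩

/-- `T` is the Dirichlet trace operator `H¹(Ω) → L²(∂Ω)`: the bounded linear operator that restricts
functions smooth up to the boundary to `∂Ω`. -/
def IsTraceOp (Ω : LipschitzDomain d) (T : H1 Ω →L[ℂ] Lp ℂ 2 Ω.surface) : Prop :=
  ∀ φ : RSpace d → ℂ, ContDiff ℝ ∞ φ → ∀ v : H1 Ω, H1.val v =ᵐ[Ω.vol] φ → T v =ᵐ[Ω.surface] φ

open Classical in
/-- The Dirichlet trace operator (existence and uniqueness are part of the theorem below). -/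
def trace (Ω : LipschitzDomain d) : H1 Ω →L[ℂ] Lp ℂ 2 Ω.surface :=
  if h : ∃ T, IsTraceOp Ω T then h.choose else 0

/-- `L^∞(Ω; ℂ^{d×d})` with the essential supremum of the spectral norm. -/
abbrev LInf (Ω : LipschitzDomain d) : Type := Lp (CMat d) ∞ Ω.vol

/-- `c` is an admissible ellipticity constant `c_A` of the coefficient `A`. -/
def IsEllipticConst (Ω : LipschitzDomain d) (A : LInf Ω) (c : ℝ) : Prop :=
  0 < c ∧ ∀ ξ : CSpace d, ∀ᵐ x ∂Ω.vol, c * ‖ξ‖ ^ 2 ≤ (inner ℂ ξ (A x ξ)).re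

/-- `L^∞_+(Ω)`. -/
def LInfPos (Ω : LipschitzDomain d) : Set (LInf Ω) := {A | ∃ c, IsEllipticConst Ω A c}

/-- `⟨w, v⟩_B = ∫_Ω (B∇w)·conj(∇v) dx`. -/
def gradForm {Ω : LipschitzDomain d} (B : LInf Ω) (w v : H1 Ω) : ℂ :=
  ∫ x, inner ℂ (H1.grad v x) (B x (H1.grad w x)) ∂Ω.vol

/-- Electrodes `E_j ⊆ ∂Ω`, a contact admittance `ζ ∈ L^∞(∂Ω)` and nonempty relatively open patches
`𝓔_j ⊆ E_j` (here `core j`) on which `Re ζ ≥ c_ζ > 0`. -/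
structure ElectrodeModel (Ω : LipschitzDomain d) (m : ℕ) where
  E : Fin m → Set (RSpace d)
  core : Fin m → Set (RSpace d)
  ζ : Lp ℂ ∞ Ω.surface
  cζ : ℝ
  E_relOpen : ∀ j, ∃ U, IsOpen U ∧ E j = U ∩ frontier Ω.carrier
  E_connected : ∀ j, IsConnected (E j)
  E_disjoint : ∀ i j, i ≠ j → Disjoint (closure (E i)) (closure (E j))
  core_subset : ∀ j, core j ⊆ E j
  core_nonempty : ∀ j, (core j).Nonempty
  core_relOpen : ∀ j, ∃ U, IsOpen U ∧ core j = U ∩ frontier Ω.carrier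
  ζ_re_nonneg : ∀ᵐ x ∂Ω.surface, 0 ≤ (ζ x).re
  ζ_eq_zero : ∀ᵐ x ∂Ω.surface, x ∉ (⋃ j, E j) → ζ x = 0
  cζ_pos : 0 < cζ
  cζ_le : ∀ᵐ x ∂Ω.surface, x ∈ (⋃ j, core j) → cζ ≤ (ζ x).re

/-- `ℂ^m_⋄`, the mean free vectors in `ℂ^m`. -/
def CDiamond (m : ℕ) : Submodule ℂ (CSpace m) where
  carrier := {W | ∑ j, W j = 0}
  zero_mem' := by simp
  add_mem' := by
    intro a b ha hb
    simp only [mem_ofPred_eq, PiLp.add_apply, Finset.sum_add_distrib] at *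
    rw [ha, hb, add_zero]
  smul_mem' := by
    intro c a ha
    simp only [mem_ofPred_eq, PiLp.smul_apply, ← Finset.smul_sum] at *
    rw [ha, smul_zero]

/-- The vector `𝟏 ∈ ℂ^m`. -/
def allOnes (m : ℕ) : CSpace m := WithLp.toLp 2 fun _ => 1

/-- `H¹(Ω) ⊕ ℂ^m`. -/
abbrev Pair (Ω : LipschitzDomain d) (m : ℕ) : Type := WithLp 2 (H1 Ω × CSpace m)

/-- The pairs `(c, c𝟏)`, `c ∈ ℂ`. -/
def constants (Ω : LipschitzDomain d) (m : ℕ) : Submodule ℂ (Pair Ω m) :=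
  ℂ ∙ (WithLp.toLp 2 (H1.one Ω, allOnes m) : Pair Ω m)

instance (Ω : LipschitzDomain d) (m : ℕ) : IsClosed (constants Ω m : Set (Pair Ω m)) :=
  Submodule.closed_of_finiteDimensional (ℂ ∙ (WithLp.toLp 2 (H1.one Ω, allOnes m) : Pair Ω m))

/-- `𝓗 = (H¹(Ω) ⊕ ℂ^m)/ℂ`. As a normed space it carries the quotient norm
`inf_c (‖v - c‖²_{H¹} + |V - c𝟏|²)^{1/2}`; its equivalence with the norm `energyNorm` below is part
of the theorem, and Fréchet derivatives, analyticity and sums depend only on the topology. -/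
abbrev HSpace (Ω : LipschitzDomain d) (m : ℕ) : Type := Pair Ω m ⧸ constants Ω m

instance (Ω : LipschitzDomain d) (m : ℕ) : NormedAddCommGroup (HSpace Ω m) :=
  Submodule.Quotient.normedAddCommGroup (constants Ω m)

instance (Ω : LipschitzDomain d) (m : ℕ) : NormedSpace ℂ (HSpace Ω m) :=
  Submodule.Quotient.normedSpace (constants Ω m) ℂ

/-- The equivalence class in `𝓗` of a pair `(v, V)`. -/
abbrev toH {Ω : LipschitzDomain d} {m : ℕ} (w : Pair Ω m) : HSpace Ω m := Submodule.Quotient.mk w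

/-- The average of the entries of `V ∈ ℂ^m`. -/
def mean (m : ℕ) : CSpace m →L[ℂ] ℂ :=
  (m : ℂ)⁻¹ • ∑ j, EuclideanSpace.proj (𝕜 := ℂ) j

lemma mean_apply (m : ℕ) (V : CSpace m) : mean m V = (m : ℂ)⁻¹ * ∑ j, V j := by
  simp [mean]

lemma mean_allOnes (m : ℕ) [NeZero m] : mean m (allOnes m) = 1 := by
  simp [mean_apply, allOnes, NeZero.ne m]

/-- `(v, V) ↦ v - mean V`, on representatives. -/
def T1pre (Ω : LipschitzDomain d) (m : ℕ) : Pair Ω m →L[ℂ] H1 Ω :=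
  WithLp.fstL 2 ℂ (H1 Ω) (CSpace m)
    - ((mean m).comp (WithLp.sndL 2 ℂ (H1 Ω) (CSpace m))).smulRight (H1.one Ω)

/-- `(v, V) ↦ V - (mean V) 𝟏`, on representatives. -/
def T2pre (Ω : LipschitzDomain d) (m : ℕ) [NeZero m] : Pair Ω m →L[ℂ] CDiamond m :=
  (WithLp.sndL 2 ℂ (H1 Ω) (CSpace m)
    - ((mean m).comp (WithLp.sndL 2 ℂ (H1 Ω) (CSpace m))).smulRight (allOnes m)).codRestrict
    (CDiamond m) (by
      intro p
      change ∑ j, (p.snd - mean m p.snd • allOnes m) j = 0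
      have : (m : ℂ) ≠ 0 := by exact_mod_cast NeZero.ne m
      simp [mean_apply, allOnes, this])

/-- `T₁ : 𝓗 → H¹(Ω)`, the first component of the representative with mean free second component. -/
def T1 (Ω : LipschitzDomain d) (m : ℕ) [NeZero m] : HSpace Ω m →L[ℂ] H1 Ω :=
  (constants Ω m).liftQL (T1pre Ω m) (by
    rw [constants, Submodule.span_singleton_le_iff_mem]
    change H1.one Ω - mean m (allOnes m) • H1.one Ω = 0
    simp [mean_allOnes])

/-- `T₂ : 𝓗 → ℂ^m_⋄`, the second component of that representative. -/
def T2 (Ω : LipschitzDomain d) (m : ℕ) [NeZero m] : HSpace Ω m →L[ℂ] CDiamond m :=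
  (constants Ω m).liftQL (T2pre Ω m) (by
    rw [constants, Submodule.span_singleton_le_iff_mem]
    apply Subtype.ext
    change allOnes m - mean m (allOnes m) • allOnes m = 0
    simp [mean_allOnes])

namespace ElectrodeModel

variable {Ω : LipschitzDomain d} {m : ℕ} (M : ElectrodeModel Ω m)

/-- The piecewise constant function `∑ V_j χ_{E_j}` on `∂Ω`. -/
def piecewise (V : CSpace m) (x : RSpace d) : ℂ := ∑ j, (M.E j).indicator (fun _ => V j) x

/-- The function `T̃v - V` on `∂Ω`. -/
def jump (w : Pair Ω m) (x : RSpace d) : ℂ := trace Ω w.fst x - M.piecewise w.snd x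

/-- `‖(v, V)‖_𝓗 = (‖∇v‖²_{L²(Ω)} + ‖T̃v - V‖²_{L²(𝓔)})^{1/2}`, on representatives. -/
def energyNorm (w : Pair Ω m) : ℝ :=
  √(∫ x, ‖H1.grad w.fst x‖ ^ 2 ∂Ω.vol + ∫ x in ⋃ j, M.core j, ‖M.jump w x‖ ^ 2 ∂Ω.surface)

/-- The sesquilinear form `a_A[(w, W), (v, V)]`, on representatives. -/
def form (A : LInf Ω) (w v : Pair Ω m) : ℂ :=
  gradForm A w.fst v.fst
    + ∫ x, M.ζ x * M.jump w x * (starRingEnd ℂ) (M.jump v x) ∂Ω.surface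

/-- The class `x ∈ 𝓗` solves the weak problem `a_A[x, (v, V)] = I·conj V` for all `(v, V)`. -/
def IsSolution (A : LInf Ω) (I : CDiamond m) (x : HSpace Ω m) : Prop :=
  ∀ w : Pair Ω m, toH w = x → ∀ v : Pair Ω m,
    M.form A w v = ∑ j, (I : CSpace m) j * (starRingEnd ℂ) (v.snd j)

/-- The class `x ∈ 𝓗` solves `a_A[x, (v, V)] = -⟨y, v⟩_B` for all `(v, V)`. -/
def IsPerturbation (A B : LInf Ω) (y x : HSpace Ω m) : Prop :=
  ∀ w z : Pair Ω m, toH w = x → toH z = y → ∀ v : Pair Ω m,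
    M.form A w v = - gradForm B z.fst v.fst

open Classical in
/-- `N_E(A) : ℂ^m_⋄ → 𝓗`, the solution operator; for `A ∈ L^∞_+(Ω)` its defining property is part of
the theorem, elsewhere the value is irrelevant. -/
def N (A : LInf Ω) : CDiamond m →L[ℂ] HSpace Ω m :=
  if h : ∃ S : CDiamond m →L[ℂ] HSpace Ω m, ∀ I, M.IsSolution A I (S I) then h.choose else 0

open Classical in
/-- `P_{E,A} : L^∞(Ω; ℂ^{d×d}) → 𝓛(𝓗)`; for `A ∈ L^∞_+(Ω)` its defining property is part of the
theorem, elsewhere the value is irrelevant. -/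
def P (A : LInf Ω) : LInf Ω →L[ℂ] (HSpace Ω m →L[ℂ] HSpace Ω m) :=
  if h : ∃ S : LInf Ω →L[ℂ] (HSpace Ω m →L[ℂ] HSpace Ω m),
    ∀ B y, M.IsPerturbation A B y (S B y) then h.choose else 0

/-- `F_E(A) = T₁ N_E(A)`. -/
def F [NeZero m] (A : LInf Ω) : CDiamond m →L[ℂ] H1 Ω := (T1 Ω m).comp (M.N A)

/-- `Λ_E(A) = T₂ N_E(A)`. -/
def Lam [NeZero m] (A : LInf Ω) : CDiamond m →L[ℂ] CDiamond m := (T2 Ω m).comp (M.N A)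

end ElectrodeModel

end

end SCEM

/-!
Since `a_{A+B} = a_A + ⟨·, ·⟩_B`, the solution operator satisfies the resolvent identity
`N(A + B) = N(A) + P_A(B) N(A + B)`. Hence `N(A + B) = (1 - P_A(B))⁻¹ N(A)` for small `B`, and the
Neumann series is a power series in `B`: it gives analyticity, the derivatives, and, as `P_A(B)` is
bounded by `‖B‖ / min c_A c_ζ` in the energy norm, convergence for all `‖B‖ < min c_A c_ζ`.
Composition with `T₁` and `T₂` preserves all of this.

`N` and `P` exist because `𝓗` is a Hilbert space for the energy norm, on which `a_A` is coercive
with constant `min c_A c_ζ`. That the energy norm is equivalent to the quotient norm rests on the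
trace and Poincaré inequalities. For smooth functions, the first follows by integrating along the
axis of a chart; in the second, translation along the axis of an interior cone moves a
neighbourhood of a boundary point into a compact subset of `Ω`, which is covered by finitely many
balls. Smooth functions are dense in `H¹(Ω)`, since a localised function can be averaged over
small balls inside the interior cone.
-/

namespace SCEM

open Filter Topology
open scoped NNReal Convolution

noncomputable section

variable {d : ℕ}

/-! ### Smooth functions as elements of `H¹(Ω)` -/

/-- The gradient `∇φ` of a differentiable complex function, as a function into `ℂ^d`. -/
def classicalGrad (φ : RSpace d → ℂ) (x : RSpace d) : CSpace d :=
  WithLp.toLp 2 fun i => fderiv ℝ φ x (EuclideanSpace.single i 1)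

@[simp]
lemma classicalGrad_apply (φ : RSpace d → ℂ) (x : RSpace d) (i : Fin d) :
    classicalGrad φ x i = fderiv ℝ φ x (EuclideanSpace.single i 1) := rfl

lemma continuous_classicalGrad {φ : RSpace d → ℂ} (hφ : ContDiff ℝ 1 φ) :
    Continuous (classicalGrad φ) :=
  (PiLp.continuous_toLp 2 _).comp <| continuous_pi fun _ =>
    (hφ.continuous_fderiv one_ne_zero).clm_apply continuous_const

lemma fderiv_apply_eq_sum_classicalGrad (φ : RSpace d → ℂ) (x h : RSpace d) :
    fderiv ℝ φ x h = ∑ i, (h i : ℂ) * classicalGrad φ x i := by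
  have h_eq : h = ∑ i, h i • EuclideanSpace.single i (1 : ℝ) := by
    ext j
    simp [Finset.sum_apply, Pi.single_apply]
  conv_lhs => rw [h_eq]
  simp only [map_sum, map_smul, classicalGrad_apply, Complex.real_smul]

lemma norm_fderiv_apply_le (φ : RSpace d → ℂ) (x h : RSpace d) :
    ‖fderiv ℝ φ x h‖ ≤ ‖classicalGrad φ x‖ * ‖h‖ := by
  rw [fderiv_apply_eq_sum_classicalGrad]
  calc ‖∑ i, (h i : ℂ) * classicalGrad φ x i‖
      ≤ ∑ i, ‖classicalGrad φ x i‖ * ‖h i‖ :=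
        norm_sum_le_of_le _ fun i _ => by rw [norm_mul, Complex.norm_real, mul_comm]
    _ ≤ √(∑ i, ‖classicalGrad φ x i‖ ^ 2) * √(∑ i, ‖h i‖ ^ 2) :=
        Real.sum_mul_le_sqrt_mul_sqrt _ _ _
    _ = ‖classicalGrad φ x‖ * ‖h‖ := by
        rw [EuclideanSpace.norm_eq, EuclideanSpace.norm_eq]

lemma memLp_vol_of_continuous (Ω : LipschitzDomain d) {F : Type*} [NormedAddCommGroup F]
    {f : RSpace d → F} (hf : Continuous f) (p : ℝ≥0∞) : MemLp f p Ω.vol := by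
  obtain ⟨C, hC⟩ :=
    Ω.isBounded.isCompact_closure.exists_bound_of_continuousOn hf.continuousOn
  refine MemLp.of_bound hf.aestronglyMeasurable C ?_
  filter_upwards [ae_restrict_mem Ω.isOpen.measurableSet] with x hx
  exact hC x (subset_closure hx)

lemma setIntegral_eq_integral_of_tsupport_subset {X E F : Type*} [TopologicalSpace X]
    [MeasurableSpace X] {μ : Measure X} [Zero E] [NormedAddCommGroup F] [NormedSpace ℝ F]
    {s : Set X} {ψ : X → E} (hψ : tsupport ψ ⊆ s) {f : X → F} (hf : ∀ x, ψ x = 0 → f x = 0) :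
    ∫ x in s, f x ∂μ = ∫ x, f x ∂μ :=
  setIntegral_eq_integral_of_forall_compl_eq_zero fun x hx =>
    hf x (image_eq_zero_of_notMem_tsupport fun h => hx (hψ h))

lemma integral_fderiv_smul_eq_neg {E F : Type*} [NormedAddCommGroup E] [NormedSpace ℝ E]
    [FiniteDimensional ℝ E] [MeasurableSpace E] [BorelSpace E] {μ : Measure E}
    [μ.IsAddHaarMeasure] [NormedAddCommGroup F] [NormedSpace ℝ F] {ψ : E → ℝ} {f : E → F}
    (hψ : ContDiff ℝ 1 ψ) (hψc : HasCompactSupport ψ) (hf : ContDiff ℝ 1 f) (v : E) :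
    ∫ x, fderiv ℝ ψ x v • f x ∂μ = -∫ x, ψ x • fderiv ℝ f x v ∂μ := by
  have hψ' : Continuous fun x => fderiv ℝ ψ x v :=
    (hψ.continuous_fderiv one_ne_zero).clm_apply continuous_const
  have hf' : Continuous fun x => fderiv ℝ f x v :=
    (hf.continuous_fderiv one_ne_zero).clm_apply continuous_const
  have hψ'c : HasCompactSupport fun x => fderiv ℝ ψ x v := hψc.fderiv_apply ℝ v
  rw [integral_smul_fderiv_eq_neg_fderiv_smul_of_integrable
    ((hψ'.smul hf.continuous).integrable_of_hasCompactSupport hψ'c.smul_right)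
    ((hψ.continuous.smul hf').integrable_of_hasCompactSupport hψc.smul_right)
    ((hψ.continuous.smul hf.continuous).integrable_of_hasCompactSupport hψc.smul_right)
    (fun x _ => hψ.differentiable one_ne_zero x) (fun x _ => hf.differentiable one_ne_zero x),
    neg_neg]

lemma isWeakGradient_of_contDiff (Ω : LipschitzDomain d) {φ : RSpace d → ℂ} (hφ : ContDiff ℝ 1 φ)
    {u : Lp ℂ 2 Ω.vol} {g : Lp (CSpace d) 2 Ω.vol} (hu : u =ᵐ[Ω.vol] φ)
    (hg : g =ᵐ[Ω.vol] classicalGrad φ) : IsWeakGradient Ω u g := by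
  intro ψ hψ hψc hψΩ i
  set e : RSpace d := EuclideanSpace.single i 1
  calc ∫ x, (fderiv ℝ ψ x e : ℂ) * u x ∂Ω.vol
      = ∫ x, fderiv ℝ ψ x e • φ x ∂Ω.vol :=
        integral_congr_ae (hu.mono fun x hx => by simp only [hx, Complex.real_smul])
    _ = ∫ x, fderiv ℝ ψ x e • φ x :=
        setIntegral_eq_integral_of_tsupport_subset ((tsupport_fderiv_subset ℝ).trans hψΩ)
          fun x hx => by simp [hx]
    _ = -∫ x, ψ x • fderiv ℝ φ x e :=
        integral_fderiv_smul_eq_neg (hψ.of_le (by simp)) hψc hφ e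
    _ = -∫ x, ψ x • fderiv ℝ φ x e ∂Ω.vol := by
        rw [setIntegral_eq_integral_of_tsupport_subset hψΩ fun x hx => by simp [hx]]
    _ = -∫ x, (ψ x : ℂ) * g x i ∂Ω.vol := by
        congr 1
        exact integral_congr_ae (hg.mono fun x hx => by
          simp only [hx, classicalGrad_apply, Complex.real_smul, e])

lemma isWeakGradient_unique (Ω : LipschitzDomain d) {u : Lp ℂ 2 Ω.vol}
    {g g' : Lp (CSpace d) 2 Ω.vol} (hg : IsWeakGradient Ω u g) (hg' : IsWeakGradient Ω u g') :
    g = g' := by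
  suffices h_coord : ∀ i : Fin d, ∀ᵐ x ∂Ω.vol, g x i = g' x i by
    refine Lp.ext ?_
    filter_upwards [ae_all_iff.2 h_coord] with x hx using PiLp.ext hx
  intro i
  have h_int : Integrable (fun x => g x i - g' x i) Ω.vol :=
    ((memLp_coord Ω g i).sub (memLp_coord Ω g' i)).integrable (by norm_num)
  have h_ae : ∀ᵐ x, x ∈ Ω.carrier → g x i - g' x i = 0 := by
    refine Ω.isOpen.ae_eq_zero_of_integral_contDiff_smul_eq_zero
      (IntegrableOn.locallyIntegrableOn h_int) fun φ hφ hφc hφΩ => ?_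
    have hφL := memLp_test Ω hφ.continuous hφc
    have h_eq : ∫ x, (φ x : ℂ) * g x i ∂Ω.vol = ∫ x, (φ x : ℂ) * g' x i ∂Ω.vol :=
      neg_inj.1 ((hg φ hφ hφc hφΩ i).symm.trans (hg' φ hφ hφc hφΩ i))
    calc ∫ x, φ x • (g x i - g' x i)
        = ∫ x, ((φ x : ℂ) * g x i - (φ x : ℂ) * g' x i) ∂Ω.vol := by
          rw [← setIntegral_eq_integral_of_tsupport_subset hφΩ fun x hx => by simp [hx]]
          simp only [Complex.real_smul, mul_sub]
      _ = 0 := by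
          have h_sub := integral_sub (hφL.integrable_mul (memLp_coord Ω g i))
            (hφL.integrable_mul (memLp_coord Ω g' i))
          simp only [Pi.mul_apply] at h_sub
          rw [h_sub, h_eq, sub_self]
  rw [ae_restrict_iff' Ω.isOpen.measurableSet]
  filter_upwards [h_ae] with x hx hxΩ using sub_eq_zero.1 (hx hxΩ)

section H1

variable {Ω : LipschitzDomain d}

lemma H1.isWeakGradient (v : H1 Ω) : IsWeakGradient Ω (H1.val v) (H1.grad v) := v.2

lemma H1.ext_val {v w : H1 Ω} (h : H1.val v = H1.val w) : v = w := by
  have hg : H1.grad v = H1.grad w :=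
    isWeakGradient_unique Ω v.isWeakGradient (h ▸ w.isWeakGradient)
  exact Subtype.ext (WithLp.ofLp_injective 2 (Prod.ext h hg))

/-- The inclusion `H¹(Ω) → L²(Ω)` as a bounded operator. -/
def H1.valL (Ω : LipschitzDomain d) : H1 Ω →L[ℂ] Lp ℂ 2 Ω.vol :=
  (WithLp.fstL 2 ℂ (Lp ℂ 2 Ω.vol) (Lp (CSpace d) 2 Ω.vol)).comp (H1Sub Ω).subtypeL

/-- The weak gradient `H¹(Ω) → L²(Ω)` as a bounded operator. -/
def H1.gradL (Ω : LipschitzDomain d) : H1 Ω →L[ℂ] Lp (CSpace d) 2 Ω.vol :=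
  (WithLp.sndL 2 ℂ (Lp ℂ 2 Ω.vol) (Lp (CSpace d) 2 Ω.vol)).comp (H1Sub Ω).subtypeL

@[simp] lemma H1.valL_apply (v : H1 Ω) : H1.valL Ω v = H1.val v := rfl

@[simp] lemma H1.gradL_apply (v : H1 Ω) : H1.gradL Ω v = H1.grad v := rfl

lemma H1.norm_sq (v : H1 Ω) : ‖v‖ ^ 2 = ‖H1.val v‖ ^ 2 + ‖H1.grad v‖ ^ 2 :=
  WithLp.prod_norm_sq_eq_of_L2 (Subtype.val v)

lemma H1.grad_one : H1.grad (H1.one Ω) = 0 := rfl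

/-- The element of `H¹(Ω)` given by a function and its weak gradient. -/
def H1.mk (u : Lp ℂ 2 Ω.vol) (g : Lp (CSpace d) 2 Ω.vol) (h : IsWeakGradient Ω u g) : H1 Ω :=
  ⟨WithLp.toLp 2 (u, g), h⟩

end H1

/-- The smooth complex functions on `ℝ^d`. -/
def Smooth (d : ℕ) : Submodule ℂ (RSpace d → ℂ) where
  carrier := {φ | ContDiff ℝ ∞ φ}
  zero_mem' := (contDiff_const : ContDiff ℝ ∞ fun _ : RSpace d => (0 : ℂ))
  add_mem' hφ hψ := by
    rw [mem_ofPred_eq] at *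
    exact hφ.add hψ
  smul_mem' c _ hφ := by
    rw [mem_ofPred_eq] at *
    exact hφ.const_smul c

namespace Smooth

lemma contDiff (φ : Smooth d) : ContDiff ℝ ∞ (φ : RSpace d → ℂ) := φ.2

lemma contDiff_one (φ : Smooth d) : ContDiff ℝ 1 (φ : RSpace d → ℂ) :=
  (contDiff φ).of_le (by simp)

lemma memLp (Ω : LipschitzDomain d) (φ : Smooth d) : MemLp (φ : RSpace d → ℂ) 2 Ω.vol :=
  memLp_vol_of_continuous Ω (contDiff φ).continuous 2

lemma memLp_grad (Ω : LipschitzDomain d) (φ : Smooth d) :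
    MemLp (classicalGrad (φ : RSpace d → ℂ)) 2 Ω.vol :=
  memLp_vol_of_continuous Ω (continuous_classicalGrad (contDiff_one φ)) 2

/-- The constant function `1` as a smooth function. -/
def one (d : ℕ) : Smooth d :=
  ⟨fun _ => 1, (contDiff_const : ContDiff ℝ ∞ fun _ : RSpace d => (1 : ℂ))⟩

end Smooth

/-- The restriction to `Ω` of a smooth function, as an element of `H¹(Ω)`. -/
def ofSmooth (Ω : LipschitzDomain d) : Smooth d →ₗ[ℂ] H1 Ω where
  toFun φ := H1.mk ((Smooth.memLp Ω φ).toLp _) ((Smooth.memLp_grad Ω φ).toLp _)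
    (isWeakGradient_of_contDiff Ω (Smooth.contDiff_one φ) (MemLp.coeFn_toLp _) (MemLp.coeFn_toLp _))
  map_add' φ ψ := H1.ext_val (MemLp.toLp_add (Smooth.memLp Ω φ) (Smooth.memLp Ω ψ))
  map_smul' c φ := H1.ext_val (MemLp.toLp_const_smul c (Smooth.memLp Ω φ))

section ofSmooth

variable {Ω : LipschitzDomain d}

lemma val_ofSmooth (φ : Smooth d) : H1.val (ofSmooth Ω φ) =ᵐ[Ω.vol] φ :=
  MemLp.coeFn_toLp (Smooth.memLp Ω φ)

lemma grad_ofSmooth (φ : Smooth d) : H1.grad (ofSmooth Ω φ) =ᵐ[Ω.vol] classicalGrad φ :=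
  MemLp.coeFn_toLp (Smooth.memLp_grad Ω φ)

lemma eq_ofSmooth {v : H1 Ω} {φ : Smooth d} (h : H1.val v =ᵐ[Ω.vol] φ) : v = ofSmooth Ω φ :=
  H1.ext_val (Lp.ext (h.trans (val_ofSmooth φ).symm))

lemma ofSmooth_one : ofSmooth Ω (Smooth.one d) = H1.one Ω :=
  (eq_ofSmooth (Lp.coeFn_const (p := 2) (μ := Ω.vol) (1 : ℂ))).symm

end ofSmooth

lemma continuous_integral_mul_Lp {Ω : LipschitzDomain d} {f : RSpace d → ℂ}
    (hf : MemLp f 2 Ω.vol) : Continuous fun u : Lp ℂ 2 Ω.vol => ∫ x, f x * u x ∂Ω.vol := by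
  have h_inner (u : Lp ℂ 2 Ω.vol) : ∫ x, f x * u x ∂Ω.vol = inner ℂ (hf.star.toLp _) u := by
    rw [L2.inner_def]
    refine integral_congr_ae ?_
    filter_upwards [hf.star.coeFn_toLp] with x hx
    simp [hx, mul_comm]
  simp only [h_inner]
  exact continuous_const.inner continuous_id

lemma isClosed_H1Sub (Ω : LipschitzDomain d) :
    IsClosed (H1Sub Ω : Set (WithLp 2 (Lp ℂ 2 Ω.vol × Lp (CSpace d) 2 Ω.vol))) := by
  have h_def : (H1Sub Ω : Set (WithLp 2 (Lp ℂ 2 Ω.vol × Lp (CSpace d) 2 Ω.vol))) =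
      {p | IsWeakGradient Ω p.fst p.snd} := rfl
  rw [h_def]
  simp only [IsWeakGradient, ofPred_forall]
  refine isClosed_iInter fun φ => isClosed_iInter fun hφ => isClosed_iInter fun hφc =>
    isClosed_iInter fun _ => isClosed_iInter fun i => ?_
  let proj : CSpace d →L[ℂ] ℂ := EuclideanSpace.proj i
  have h_coord (p : WithLp 2 (Lp ℂ 2 Ω.vol × Lp (CSpace d) 2 Ω.vol)) :
      ∫ x, (φ x : ℂ) * p.snd x i ∂Ω.vol = ∫ x, (φ x : ℂ) * proj.compLp p.snd x ∂Ω.vol := by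
    refine integral_congr_ae ?_
    filter_upwards [proj.coeFn_compLp p.snd] with x hx
    rw [hx]
    rfl
  simp only [h_coord]
  refine isClosed_eq ?_ ?_
  · exact (continuous_integral_mul_Lp (memLp_test_deriv Ω hφ hφc _)).comp
      (WithLp.fstL 2 ℂ _ _).continuous
  · exact ((continuous_integral_mul_Lp (memLp_test Ω hφ.continuous hφc)).comp
      ((proj.compLpL 2 Ω.vol).continuous.comp (WithLp.sndL 2 ℂ _ _).continuous)).neg

instance (Ω : LipschitzDomain d) : CompleteSpace (H1 Ω) :=
  (isClosed_H1Sub Ω).completeSpace_coe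

/-! ### Mollification -/

lemma eLpNorm_integral_le_of_ae_eLpNorm_le {X T F : Type*} [MeasurableSpace X] [MeasurableSpace T]
    [NormedAddCommGroup F] [NormedSpace ℝ F] {μ : Measure X} [SFinite μ] {ν : Measure T}
    [IsProbabilityMeasure ν] {f : X → T → F}
    (hf : AEStronglyMeasurable (Function.uncurry f) (μ.prod ν)) {p : ℝ≥0∞} (hp1 : 1 ≤ p)
    (hp : p ≠ ⊤) {η : ℝ≥0∞} (h : ∀ᵐ t ∂ν, eLpNorm (f · t) p μ ≤ η) :
    eLpNorm (fun x => ∫ t, f x t ∂ν) p μ ≤ η := by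
  lift p to ℝ≥0 using hp
  have hp0 : p ≠ 0 := (zero_lt_one.trans_le (by exact_mod_cast hp1)).ne'
  have h_jensen : ∀ᵐ x ∂μ, ‖∫ t, f x t ∂ν‖ₑ ^ (p : ℝ) ≤ ∫⁻ t, ‖f x t‖ₑ ^ (p : ℝ) ∂ν := by
    filter_upwards [hf.prodMk_left] with x hx
    rw [← eLpNorm_nnreal_pow_eq_lintegral (f := f x) hp0]
    gcongr
    calc ‖∫ t, f x t ∂ν‖ₑ ≤ eLpNorm (f x) 1 ν := by
          rw [eLpNorm_one_eq_lintegral_enorm]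
          exact enorm_integral_le_lintegral_enorm _
      _ ≤ eLpNorm (f x) p ν := eLpNorm_le_eLpNorm_of_exponent_le hp1 hx
  rw [← ENNReal.rpow_le_rpow_iff (z := (p : ℝ)) (by positivity),
    eLpNorm_nnreal_pow_eq_lintegral hp0]
  calc ∫⁻ x, ‖∫ t, f x t ∂ν‖ₑ ^ (p : ℝ) ∂μ
      ≤ ∫⁻ x, ∫⁻ t, ‖f x t‖ₑ ^ (p : ℝ) ∂ν ∂μ := lintegral_mono_ae h_jensen
    _ = ∫⁻ t, eLpNorm (f · t) p μ ^ (p : ℝ) ∂ν := by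
        rw [lintegral_lintegral_swap (hf.enorm.pow_const _)]
        simp only [eLpNorm_nnreal_pow_eq_lintegral hp0]
    _ ≤ ∫⁻ _, η ^ (p : ℝ) ∂ν := lintegral_mono_ae (h.mono fun t ht => by gcongr)
    _ = η ^ (p : ℝ) := by simp

section Mollify

open ContinuousLinearMap (lsmul)

variable {E F : Type*} [NormedAddCommGroup E] [NormedSpace ℝ E] [FiniteDimensional ℝ E]
  [MeasurableSpace E] [BorelSpace E] {μ : Measure E} [μ.IsAddHaarMeasure] [NormedAddCommGroup F]
  {p : ℝ≥0∞} {f : E → F}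

lemma tendsto_eLpNorm_translate_sub (hp1 : 1 ≤ p) (hp : p ≠ ⊤) (hf : MemLp f p μ) :
    Tendsto (fun t => eLpNorm (fun x => f (x - t) - f x) p μ) (𝓝 0) (𝓝 0) := by
  have : Fact (1 ≤ p) := ⟨hp1⟩
  have : Fact (p ≠ ⊤) := ⟨hp⟩
  have h_cont : Continuous fun t : E => (DomAddAct.mk (-t) +ᵥ hf.toLp f : Lp F p μ) :=
    (DomAddAct.continuous_mk.comp continuous_neg).vadd continuous_const
  have h_edist (t : E) : edist (DomAddAct.mk (-t) +ᵥ hf.toLp f : Lp F p μ) (hf.toLp f) =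
      eLpNorm (fun x => f (x - t) - f x) p μ := by
    rw [DomAddAct.mk_vadd_toLp, Lp.edist_toLp_toLp]
    refine eLpNorm_congr_ae (ae_of_all _ fun x => ?_)
    simp [sub_eq_neg_add]
  simp only [← h_edist]
  rw [← tendsto_iff_edist_tendsto_0]
  simpa using h_cont.tendsto 0

variable [NormedSpace ℝ F] {ρ : E → ℝ}

lemma fderiv_convolution_apply (hρ : ContDiff ℝ 1 ρ) (hρc : HasCompactSupport ρ)
    (hf : LocallyIntegrable f μ) (x v : E) :
    fderiv ℝ (ρ ⋆[lsmul ℝ ℝ, μ] f) x v = -∫ y, fderiv ℝ (fun y => ρ (x - y)) y v • f y ∂μ := by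
  have h_int : Integrable (fun y => ((lsmul ℝ ℝ : ℝ →L[ℝ] F →L[ℝ] F).precompL E)
      (fderiv ℝ ρ (x - y)) (f y)) μ :=
    ((hρc.fderiv ℝ).convolutionExists_left _
      (hρ.continuous_fderiv one_ne_zero) hf x).integrable_swap
  rw [(hρc.hasFDerivAt_convolution_left (lsmul ℝ ℝ) hρ hf x).fderiv, convolution_eq_swap,
    ContinuousLinearMap.integral_apply h_int, ← integral_neg]
  refine integral_congr_ae (ae_of_all _ fun y => ?_)
  have h_fderiv : fderiv ℝ (fun y => ρ (x - y)) y = -fderiv ℝ ρ (x - y) := by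
    have h := (hρ.differentiable one_ne_zero (x - y)).hasFDerivAt.comp y
      ((hasFDerivAt_id y).const_sub x)
    simpa [Function.comp_def] using h.fderiv
  simp [h_fderiv]

variable [CompleteSpace F]

lemma convolution_sub_eq_integral_withDensity (hρ : Continuous ρ) (hρc : HasCompactSupport ρ)
    (hρ0 : ∀ t, 0 ≤ ρ t) (hρ1 : ∫ t, ρ t ∂μ = 1) (hf : LocallyIntegrable f μ) (x : E) :
    (ρ ⋆[lsmul ℝ ℝ, μ] f) x - f x =
      ∫ t, (f (x - t) - f x) ∂μ.withDensity fun t => ENNReal.ofReal (ρ t) := by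
  rw [integral_withDensity_eq_integral_toReal_smul hρ.measurable.ennreal_ofReal
    (ae_of_all _ fun t => ENNReal.ofReal_lt_top)]
  have hx : Integrable (fun t => ρ t • f (x - t)) μ :=
    hρc.convolutionExists_left (lsmul ℝ ℝ) hρ hf x
  simp only [ENNReal.toReal_ofReal (hρ0 _), smul_sub]
  rw [integral_sub hx ((hρ.integrable_of_hasCompactSupport hρc).smul_const _),
    integral_smul_const, hρ1, one_smul]
  rfl

lemma eLpNorm_convolution_sub_le (hp1 : 1 ≤ p) (hp : p ≠ ⊤) (hf : MemLp f p μ)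
    (hρ : Continuous ρ) (hρc : HasCompactSupport ρ) (hρ0 : ∀ t, 0 ≤ ρ t) (hρ1 : ∫ t, ρ t ∂μ = 1)
    {η : ℝ≥0∞} (h : ∀ t, ρ t ≠ 0 → eLpNorm (fun x => f (x - t) - f x) p μ ≤ η) :
    eLpNorm (fun x => (ρ ⋆[lsmul ℝ ℝ, μ] f) x - f x) p μ ≤ η := by
  set ν : Measure E := μ.withDensity fun t => ENNReal.ofReal (ρ t) with hν
  have hρm : Measurable fun t => ENNReal.ofReal (ρ t) := hρ.measurable.ennreal_ofReal
  have : IsProbabilityMeasure ν := ⟨by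
    rw [hν, withDensity_apply _ MeasurableSet.univ, setLIntegral_univ,
      ← ofReal_integral_eq_lintegral_ofReal (hρ.integrable_of_hasCompactSupport hρc)
        (ae_of_all _ hρ0), hρ1, ENNReal.ofReal_one]⟩
  have h_meas : AEStronglyMeasurable (fun q : E × E => f (q.1 - q.2) - f q.1) (μ.prod μ) :=
    (hf.1.comp_quasiMeasurePreserving (quasiMeasurePreserving_sub_of_right_invariant μ μ)).sub
      hf.1.comp_fst
  simp only [convolution_sub_eq_integral_withDensity hρ hρc hρ0 hρ1 (hf.locallyIntegrable hp1)]
  refine eLpNorm_integral_le_of_ae_eLpNorm_le (h_meas.mono_ac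
    (Measure.AbsolutelyContinuous.rfl.prod (withDensity_absolutelyContinuous μ _))) hp1 hp ?_
  rw [ae_withDensity_iff hρm]
  exact ae_of_all _ fun t ht => h t fun h0 => ht (by simp [h0])

lemma tendsto_eLpNorm_convolution_sub {ι : Type*} {l : Filter ι} {ρ : ι → E → ℝ} (hp1 : 1 ≤ p)
    (hp : p ≠ ⊤) (hf : MemLp f p μ) (hρ : ∀ i, Continuous (ρ i))
    (hρc : ∀ i, HasCompactSupport (ρ i)) (hρ0 : ∀ i t, 0 ≤ ρ i t) (hρ1 : ∀ i, ∫ t, ρ i t ∂μ = 1)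
    (hρl : Tendsto (fun i => Function.support (ρ i)) l (𝓝 0).smallSets) :
    Tendsto (fun i => eLpNorm (fun x => (ρ i ⋆[lsmul ℝ ℝ, μ] f) x - f x) p μ) l (𝓝 0) := by
  rw [ENNReal.tendsto_nhds_zero]
  intro η hη
  have h_translate :=
    ENNReal.tendsto_nhds_zero.1 (tendsto_eLpNorm_translate_sub hp1 hp hf) η hη
  filter_upwards [tendsto_smallSets_iff.1 hρl _ h_translate] with i hi
  exact eLpNorm_convolution_sub_le hp1 hp hf (hρ i) (hρc i) (hρ0 i) (hρ1 i) fun t ht => hi ht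

end Mollify

/-! ### Lipschitz epigraphs -/

section Graph

variable {E : Type*} [NormedAddCommGroup E] [InnerProductSpace ℝ E] {e : E} {γ : (ℝ ∙ e)ᗮ → ℝ}
  {K : ℝ≥0}

lemma norm_orthogonalProjectionOnto_add_smul_le (y : E) (t : ℝ) :
    ‖(ℝ ∙ e)ᗮ.orthogonalProjectionOnto (y + t • e)‖ ≤ ‖y‖ := by
  rw [map_add, map_smul, Submodule.orthogonalProjectionOnto_orthogonal_apply_eq_zero
    (Submodule.mem_span_singleton_self e), smul_zero, add_zero]
  exact Submodule.norm_orthogonalProjectionOnto_apply_le _ y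

/-- The points lying strictly above the graph of `γ` in the direction `e`. -/
def strictEpigraph (e : E) (γ : (ℝ ∙ e)ᗮ → ℝ) : Set E :=
  {x | γ ((ℝ ∙ e)ᗮ.orthogonalProjectionOnto x) < inner ℝ e x}

lemma mem_strictEpigraph {x : E} :
    x ∈ strictEpigraph e γ ↔ γ ((ℝ ∙ e)ᗮ.orthogonalProjectionOnto x) < inner ℝ e x := Iff.rfl

lemma closedBall_subset_strictEpigraph (he : ‖e‖ = 1) (hγ : LipschitzWith K γ) {x : E}
    (hx : x ∈ strictEpigraph e γ) (ε : ℝ) :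
    Metric.closedBall (x + ε • e) (ε * (K + 1 : ℝ)⁻¹) ⊆ strictEpigraph e γ := by
  intro y hy
  set h : E := y - (x + ε • e) with hh
  have h_norm : ‖h‖ * (K + 1) ≤ ε := by
    rwa [mem_closedBall_iff_norm, ← div_eq_mul_inv, le_div_iff₀ (by positivity)] at hy
  have h_slope : γ ((ℝ ∙ e)ᗮ.orthogonalProjectionOnto y) ≤
      γ ((ℝ ∙ e)ᗮ.orthogonalProjectionOnto x) + K * ‖h‖ := by
    have h_sub : y - x = h + ε • e := by rw [hh]; abel
    rw [← sub_le_iff_le_add']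
    calc γ ((ℝ ∙ e)ᗮ.orthogonalProjectionOnto y) - γ ((ℝ ∙ e)ᗮ.orthogonalProjectionOnto x)
        ≤ K * ‖(ℝ ∙ e)ᗮ.orthogonalProjectionOnto (y - x)‖ := by
          rw [map_sub, ← dist_eq_norm]
          exact (Real.le_norm_self _).trans (hγ.dist_le_mul _ _)
      _ ≤ K * ‖h‖ := by
          rw [h_sub]
          gcongr
          exact norm_orthogonalProjectionOnto_add_smul_le h ε
  have h_inner : inner ℝ e x + ε - ‖h‖ ≤ inner ℝ e y := by
    have h_eq : y = x + ε • e + h := by rw [hh]; abel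
    have h_cs : -‖h‖ ≤ inner ℝ e h := by
      simpa [he] using (neg_le_neg (abs_real_inner_le_norm e h)).trans (neg_abs_le _)
    rw [h_eq, inner_add_right, inner_add_right, inner_smul_right, real_inner_self_eq_norm_sq, he]
    linarith
  rw [mem_strictEpigraph] at hx ⊢
  linarith

/-- The interior cone condition for `s` along `U`: at every point of `s ∩ U`, the cone in the
direction `e` with opening `δ` and height `ε₀` lies in `s`. The direction is not normalised, so that
`e = 0` covers balls. -/
def HasInteriorCone (s U : Set E) (e : E) (δ ε₀ : ℝ) : Prop :=
  ∀ x ∈ s ∩ U, ∀ ε ∈ Ioc 0 ε₀, Metric.closedBall (x + ε • e) (ε * δ) ⊆ s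

lemma hasInteriorCone_of_ball_subset {s : Set E} {p : E} {R : ℝ} (h : Metric.ball p R ⊆ s) :
    HasInteriorCone s (Metric.ball p (R / 2)) 0 1 (R / 2) := by
  rintro x ⟨-, hx⟩ ε ⟨-, hε⟩ y hy
  apply h
  simp only [smul_zero, add_zero, mul_one, Metric.mem_closedBall, Metric.mem_ball] at *
  linarith [dist_triangle y x p]

lemma hasInteriorCone_of_eq_strictEpigraph {s : Set E} {p : E} {R : ℝ} (he : ‖e‖ = 1)
    (hγ : LipschitzWith K γ)
    (h : ∀ x ∈ Metric.ball p R, x ∈ s ↔ x ∈ strictEpigraph e γ) :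
    HasInteriorCone s (Metric.ball p (R / 2)) e (K + 1 : ℝ)⁻¹ (R / 4) := by
  rintro x ⟨hxs, hx⟩ ε ⟨hε0, hε⟩ y hy
  have h_opening : (K + 1 : ℝ)⁻¹ ≤ 1 := inv_le_one_of_one_le₀ (by simp)
  have h_dist : dist y x ≤ 2 * ε :=
    calc dist y x ≤ dist y (x + ε • e) + dist (x + ε • e) x := dist_triangle _ _ _
      _ ≤ ε * 1 + ε := by
          refine add_le_add ((Metric.mem_closedBall.1 hy).trans (by gcongr)) (le_of_eq ?_)
          rw [dist_self_add_left, norm_smul, he, mul_one, Real.norm_of_nonneg hε0.le]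
      _ = 2 * ε := by ring
  rw [Metric.mem_ball] at hx
  have hxR : x ∈ Metric.ball p R := Metric.mem_ball.2 (by linarith)
  have hyR : y ∈ Metric.ball p R := Metric.mem_ball.2 (by linarith [dist_triangle y x p])
  exact (h y hyR).2 (closedBall_subset_strictEpigraph he hγ ((h x hxR).1 hxs) ε hy)

end Graph

lemma exists_chart (Ω : LipschitzDomain d) {p : RSpace d} (hp : p ∈ frontier Ω.carrier) :
    ∃ R > 0, ∃ e : RSpace d, ‖e‖ = 1 ∧ ∃ (γ : (ℝ ∙ e)ᗮ → ℝ) (K : ℝ≥0), LipschitzWith K γ ∧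
      ∀ x ∈ Metric.ball p R, x ∈ Ω.carrier ↔ x ∈ strictEpigraph e γ := by
  obtain ⟨U, hU, hpU, e, he, γ, ⟨K, hK⟩, hγ⟩ := Ω.lipschitz p hp
  obtain ⟨R, hR, hball⟩ := Metric.isOpen_iff.1 hU p hpU
  refine ⟨R, hR, e, he, γ, K, hK, fun x hx => ?_⟩
  simpa [hball hx, strictEpigraph] using Set.ext_iff.1 hγ x

lemma exists_hasInteriorCone (Ω : LipschitzDomain d) {p : RSpace d} (hp : p ∈ closure Ω.carrier) :
    ∃ r > 0, ∃ (e : RSpace d), ∃ δ > 0, ∃ ε₀ > 0,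
      HasInteriorCone Ω.carrier (Metric.ball p r) e δ ε₀ := by
  by_cases hpΩ : p ∈ Ω.carrier
  · obtain ⟨R, hR, hball⟩ := Metric.isOpen_iff.1 Ω.isOpen p hpΩ
    exact ⟨R / 2, half_pos hR, 0, 1, one_pos, R / 2, half_pos hR,
      hasInteriorCone_of_ball_subset hball⟩
  · have hpf : p ∈ frontier Ω.carrier := by
      rw [frontier, Ω.isOpen.interior_eq]
      exact ⟨hp, hpΩ⟩
    obtain ⟨R, hR, e, he, γ, K, hγ, h⟩ := exists_chart Ω hpf
    exact ⟨R / 2, half_pos hR, e, _, by positivity, R / 4, by positivity,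
      hasInteriorCone_of_eq_strictEpigraph he hγ h⟩

/-! ### Cutoffs and density of the smooth functions -/

/-- The gradient of the product `χ u` prescribed by the Leibniz rule, where `g` is the gradient
of `u`. -/
def productGrad (χ : RSpace d → ℝ) (u : RSpace d → ℂ) (g : RSpace d → CSpace d) (x : RSpace d) :
    CSpace d :=
  (χ x : ℂ) • g x + u x • classicalGrad (fun y => (χ y : ℂ)) x

lemma productGrad_apply {χ : RSpace d → ℝ} (hχ : Differentiable ℝ χ) (u : RSpace d → ℂ)
    (g : RSpace d → CSpace d) (x : RSpace d) (i : Fin d) :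
    productGrad χ u g x i =
      (χ x : ℂ) * g x i + u x * (fderiv ℝ χ x (EuclideanSpace.single i 1) : ℂ) := by
  have h_fderiv : fderiv ℝ (fun y => (χ y : ℂ)) x = Complex.ofRealCLM.comp (fderiv ℝ χ x) :=
    (Complex.ofRealCLM.hasFDerivAt.comp x (hχ x).hasFDerivAt).fderiv
  simp [productGrad, h_fderiv]

lemma memLp_ofReal_smul (Ω : LipschitzDomain d) {F : Type*} [NormedAddCommGroup F] [NormedSpace ℂ F]
    {p : ℝ≥0∞} {χ : RSpace d → ℝ} (hχ : Continuous χ) {f : RSpace d → F} (hf : MemLp f p Ω.vol) :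
    MemLp (fun x => (χ x : ℂ) • f x) p Ω.vol :=
  hf.smul (memLp_vol_of_continuous Ω (Complex.continuous_ofReal.comp hχ) ⊤)

lemma memLp_productGrad (Ω : LipschitzDomain d) {p : ℝ≥0∞} {χ : RSpace d → ℝ} (hχ : ContDiff ℝ 1 χ)
    {u : RSpace d → ℂ} {g : RSpace d → CSpace d} (hu : MemLp u p Ω.vol) (hg : MemLp g p Ω.vol) :
    MemLp (productGrad χ u g) p Ω.vol := by
  have h_grad : MemLp (classicalGrad fun y => (χ y : ℂ)) ⊤ Ω.vol :=
    memLp_vol_of_continuous Ω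
      (continuous_classicalGrad (Complex.ofRealCLM.contDiff.comp hχ)) ⊤
  exact (memLp_ofReal_smul Ω hχ.continuous hg).add (h_grad.smul hu)

lemma isWeakGradient_productGrad {Ω : LipschitzDomain d} {χ : RSpace d → ℝ} (hχ : ContDiff ℝ ∞ χ)
    {u w : Lp ℂ 2 Ω.vol} {g h : Lp (CSpace d) 2 Ω.vol} (hug : IsWeakGradient Ω u g)
    (hw : w =ᵐ[Ω.vol] fun x => (χ x : ℂ) • u x) (hh : h =ᵐ[Ω.vol] productGrad χ u g) :
    IsWeakGradient Ω w h := by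
  intro φ hφ hφc hφΩ i
  set e : RSpace d := EuclideanSpace.single i 1
  have hφχ : ContDiff ℝ ∞ fun x => φ x * χ x := hφ.mul hχ
  have hφχc : HasCompactSupport fun x => φ x * χ x := hφc.mul_right
  have h_leibniz (x : RSpace d) :
      fderiv ℝ (fun x => φ x * χ x) x e = φ x * fderiv ℝ χ x e + χ x * fderiv ℝ φ x e := by
    rw [fderiv_fun_mul (hφ.differentiable (by simp) x) (hχ.differentiable (by simp) x)]
    simp
  have h_test : MemLp (fun x => ((φ x * fderiv ℝ χ x e : ℝ) : ℂ)) 2 Ω.vol :=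
    memLp_test Ω (hφ.continuous.mul
      ((hχ.continuous_fderiv (by simp)).clm_apply continuous_const)) hφc.mul_right
  have h_int_test := h_test.integrable_mul (Lp.memLp u)
  have h_int_deriv := (memLp_test_deriv Ω hφχ hφχc e).integrable_mul (Lp.memLp u)
  have h_int_grad := (memLp_test Ω hφχ.continuous hφχc).integrable_mul (memLp_coord Ω g i)
  simp only [Pi.mul_def] at h_int_test h_int_deriv h_int_grad
  calc ∫ x, (fderiv ℝ φ x e : ℂ) * w x ∂Ω.vol
      = ∫ x, (fderiv ℝ (fun x => φ x * χ x) x e : ℂ) * u x ∂Ω.vol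
          - ∫ x, ((φ x * fderiv ℝ χ x e : ℝ) : ℂ) * u x ∂Ω.vol := by
        rw [← integral_sub h_int_deriv h_int_test]
        refine integral_congr_ae (hw.mono fun x hx => ?_)
        simp only [hx, h_leibniz, smul_eq_mul]
        push_cast
        ring
    _ = -(∫ x, ((φ x * χ x : ℝ) : ℂ) * g x i ∂Ω.vol
          + ∫ x, ((φ x * fderiv ℝ χ x e : ℝ) : ℂ) * u x ∂Ω.vol) := by
        rw [hug _ hφχ hφχc (tsupport_mul_subset_left.trans hφΩ) i]
        ring
    _ = -∫ x, (φ x : ℂ) * h x i ∂Ω.vol := by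
        rw [← integral_add h_int_grad h_int_test]
        refine congrArg _ (integral_congr_ae (hh.mono fun x hx => ?_))
        simp only [hx, productGrad_apply (hχ.differentiable (by simp))]
        push_cast
        ring

section Density

open ContinuousLinearMap (lsmul)

variable {Ω : LipschitzDomain d}

/-- The product of a smooth real function with an element of `H¹(Ω)`. -/
def H1.cutoff (χ : RSpace d → ℝ) (hχ : ContDiff ℝ ∞ χ) (v : H1 Ω) : H1 Ω :=
  H1.mk ((memLp_ofReal_smul Ω hχ.continuous (Lp.memLp (H1.val v))).toLp _)
    ((memLp_productGrad Ω (hχ.of_le (by simp)) (Lp.memLp (H1.val v)) (Lp.memLp (H1.grad v))).toLp _)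
    (isWeakGradient_productGrad hχ v.isWeakGradient (MemLp.coeFn_toLp _) (MemLp.coeFn_toLp _))

lemma H1.val_cutoff {χ : RSpace d → ℝ} (hχ : ContDiff ℝ ∞ χ) (v : H1 Ω) :
    H1.val (H1.cutoff χ hχ v) =ᵐ[Ω.vol] fun x => (χ x : ℂ) • H1.val v x :=
  (memLp_ofReal_smul Ω hχ.continuous (Lp.memLp (H1.val v))).coeFn_toLp

lemma H1.grad_cutoff {χ : RSpace d → ℝ} (hχ : ContDiff ℝ ∞ χ) (v : H1 Ω) :
    H1.grad (H1.cutoff χ hχ v) =ᵐ[Ω.vol] productGrad χ (H1.val v) (H1.grad v) :=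
  (memLp_productGrad Ω (hχ.of_le (by simp)) (Lp.memLp (H1.val v))
    (Lp.memLp (H1.grad v))).coeFn_toLp

lemma H1.sum_cutoff_eq {ι : Type*} [Fintype ι] {χ : ι → RSpace d → ℝ}
    (hχ : ∀ i, ContDiff ℝ ∞ (χ i)) (h_sum : ∀ x ∈ Ω.carrier, ∑ i, χ i x = 1) (v : H1 Ω) :
    ∑ i, H1.cutoff (χ i) (hχ i) v = v := by
  apply H1.ext_val
  have h_val : H1.val (∑ i, H1.cutoff (χ i) (hχ i) v) = ∑ i, H1.val (H1.cutoff (χ i) (hχ i) v) := by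
    simp only [← H1.valL_apply, map_sum]
  rw [h_val]
  refine Lp.ext ?_
  filter_upwards [ae_all_iff.2 fun i => H1.val_cutoff (hχ i) v,
    ae_restrict_mem Ω.isOpen.measurableSet,
    Lp.coeFn_finsetSum Finset.univ fun i => H1.val (H1.cutoff (χ i) (hχ i) v)] with x hx hxΩ hs
  rw [hs, Finset.sum_apply]
  simp only [hx, ← Finset.sum_smul]
  rw [← Complex.ofReal_sum, h_sum x hxΩ, Complex.ofReal_one, one_smul]

/-- The element `w` of `H¹(Ω)` and its weak gradient vanish almost everywhere off `S`. -/
def H1.IsSupportedIn (w : H1 Ω) (S : Set (RSpace d)) : Prop :=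
  ∀ᵐ x ∂Ω.vol, x ∉ S → H1.val w x = 0 ∧ H1.grad w x = 0

lemma H1.isSupportedIn_cutoff {χ : RSpace d → ℝ} (hχ : ContDiff ℝ ∞ χ) (v : H1 Ω) :
    (H1.cutoff χ hχ v).IsSupportedIn (tsupport χ) := by
  filter_upwards [H1.val_cutoff hχ v, H1.grad_cutoff hχ v] with x h_val h_grad hx
  have hχx : χ x = 0 := image_eq_zero_of_notMem_tsupport hx
  have hχx' : fderiv ℝ χ x = 0 :=
    image_eq_zero_of_notMem_tsupport fun h => hx (tsupport_fderiv_subset ℝ h)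
  rw [h_val, h_grad]
  refine ⟨by simp [hχx], PiLp.ext fun i => ?_⟩
  simp [productGrad_apply (hχ.differentiable (by simp)), hχx, hχx']

namespace H1.IsSupportedIn

variable {w : H1 Ω} {S : Set (RSpace d)}

lemma integral_fderiv_mul_val_eq_neg (hw : w.IsSupportedIn S) {ψ : RSpace d → ℝ}
    (hψ : ContDiff ℝ ∞ ψ) (hψc : HasCompactSupport ψ)
    (h : tsupport ψ ⊆ Ω.carrier ∨ Disjoint (tsupport ψ) S) (i : Fin d) :
    ∫ x, (fderiv ℝ ψ x (EuclideanSpace.single i 1) : ℂ) * H1.val w x ∂Ω.vol =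
      -∫ x, (ψ x : ℂ) * H1.grad w x i ∂Ω.vol := by
  rcases h with h_sub | h_disj
  · exact w.isWeakGradient ψ hψ hψc h_sub i
  · rw [integral_eq_zero_of_ae, integral_eq_zero_of_ae, neg_zero]
    · filter_upwards [hw] with x hx
      by_cases hxS : x ∈ S
      · simp [image_eq_zero_of_notMem_tsupport (h_disj.notMem_of_mem_right hxS)]
      · simp [hx hxS]
    · filter_upwards [hw] with x hx
      by_cases hxS : x ∈ S
      · have hx' : x ∉ tsupport (fderiv ℝ ψ) := fun hx =>
          h_disj.notMem_of_mem_right hxS (tsupport_fderiv_subset ℝ hx)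
        simp [image_eq_zero_of_notMem_tsupport hx']
      · simp [hx hxS]

lemma classicalGrad_convolution_indicator (hw : w.IsSupportedIn S) {ρ : RSpace d → ℝ}
    (hρ : ContDiff ℝ ∞ ρ) (hρc : HasCompactSupport ρ) {x : RSpace d}
    (hx : (∀ t ∈ tsupport ρ, x - t ∈ Ω.carrier) ∨ ∀ t ∈ tsupport ρ, x - t ∉ S) :
    classicalGrad (ρ ⋆[lsmul ℝ ℝ] Ω.carrier.indicator (H1.val w)) x =
      (ρ ⋆[lsmul ℝ ℝ] Ω.carrier.indicator (H1.grad w)) x := by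
  have hΩ := Ω.isOpen.measurableSet
  have h_val : LocallyIntegrable (Ω.carrier.indicator (H1.val w)) :=
    ((memLp_indicator_iff_restrict hΩ).2 (Lp.memLp (H1.val w))).locallyIntegrable (by norm_num)
  have h_grad : LocallyIntegrable (Ω.carrier.indicator (H1.grad w)) :=
    ((memLp_indicator_iff_restrict hΩ).2 (Lp.memLp (H1.grad w))).locallyIntegrable (by norm_num)
  set ψ : RSpace d → ℝ := fun y => ρ (x - y)
  have hψ_tsupport {y : RSpace d} (hy : y ∈ tsupport ψ) : x - y ∈ tsupport ρ := by
    have h_eq : tsupport ψ = Homeomorph.subLeft x ⁻¹' tsupport ρ :=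
      tsupport_comp_eq_preimage ρ (Homeomorph.subLeft x)
    rwa [h_eq] at hy
  ext i
  calc classicalGrad (ρ ⋆[lsmul ℝ ℝ] Ω.carrier.indicator (H1.val w)) x i
      = -∫ y, (fderiv ℝ ψ y (EuclideanSpace.single i 1) : ℂ) * H1.val w y ∂Ω.vol := by
        rw [classicalGrad_apply, fderiv_convolution_apply (hρ.of_le (by simp)) hρc h_val,
          ← integral_indicator hΩ]
        simp only [← Complex.real_smul, indicator_smul_apply, ψ]
    _ = ∫ y, (ψ y : ℂ) * H1.grad w y i ∂Ω.vol := by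
        rw [neg_eq_iff_eq_neg]
        refine hw.integral_fderiv_mul_val_eq_neg (hρ.comp (contDiff_const.sub contDiff_id))
          (hρc.comp_homeomorph (Homeomorph.subLeft x)) ?_ i
        refine hx.imp (fun h y hy => ?_) fun h => Set.disjoint_left.2 fun y hy => ?_
        · simpa using h _ (hψ_tsupport hy)
        · simpa using h _ (hψ_tsupport hy)
    _ = (ρ ⋆[lsmul ℝ ℝ] Ω.carrier.indicator (H1.grad w)) x i := by
        have h_int := (hρc.convolutionExists_left (lsmul ℝ ℝ) hρ.continuous h_grad
          x).integrable_swap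
        have h_proj := (EuclideanSpace.proj (𝕜 := ℂ) i : CSpace d →L[ℂ] ℂ).integral_comp_comm h_int
        rw [convolution_eq_swap]
        refine Eq.trans ?_ h_proj
        rw [← integral_indicator hΩ]
        refine integral_congr_ae (ae_of_all _ fun y => ?_)
        by_cases hy : y ∈ Ω.carrier <;> simp [hy, ψ]

end H1.IsSupportedIn

lemma tendsto_of_tendsto_eLpNorm_sub_indicator {F ι : Type*} [NormedAddCommGroup F] {l : Filter ι}
    {a : Lp F 2 Ω.vol} {b : ι → Lp F 2 Ω.vol} {f : ι → RSpace d → F}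
    (hb : ∀ᶠ i in l, b i =ᵐ[Ω.vol] f i)
    (h : Tendsto (fun i => eLpNorm (fun x => f i x - Ω.carrier.indicator a x) 2 volume) l (𝓝 0)) :
    Tendsto b l (𝓝 a) := by
  rw [tendsto_iff_edist_tendsto_0]
  refine tendsto_of_tendsto_of_tendsto_of_le_of_le' tendsto_const_nhds h
    (Eventually.of_forall fun _ => zero_le) (hb.mono fun i hi => ?_)
  rw [Lp.edist_def]
  refine (eLpNorm_congr_ae (g := fun x => f i x - Ω.carrier.indicator a x) ?_).trans_le
    (eLpNorm_mono_measure _ Measure.restrict_le_self)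
  filter_upwards [hi, ae_restrict_mem Ω.isOpen.measurableSet] with x hx hxΩ
  simp [hx, hxΩ]

lemma H1.tendsto_of_tendsto_val_grad {ι : Type*} {l : Filter ι} {v : ι → H1 Ω} {w : H1 Ω}
    (h_val : Tendsto (fun i => H1.val (v i)) l (𝓝 (H1.val w)))
    (h_grad : Tendsto (fun i => H1.grad (v i)) l (𝓝 (H1.grad w))) : Tendsto v l (𝓝 w) := by
  rw [tendsto_iff_norm_sub_tendsto_zero] at *
  have h_norm (i : ι) : ‖v i - w‖ =
      √(‖H1.val (v i) - H1.val w‖ ^ 2 + ‖H1.grad (v i) - H1.grad w‖ ^ 2) := by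
    rw [← Real.sqrt_sq (norm_nonneg (v i - w)), H1.norm_sq, ← H1.valL_apply, ← H1.gradL_apply,
      map_sub, map_sub]
    rfl
  simpa [h_norm] using ((h_val.pow 2).add (h_grad.pow 2)).sqrt

lemma mem_closure_range_ofSmooth_of_mollifier {w : H1 Ω} {ι : Type*} {l : Filter ι} [l.NeBot]
    {ρ : ι → RSpace d → ℝ} (hρ : ∀ i, ContDiff ℝ ∞ (ρ i)) (hρc : ∀ i, HasCompactSupport (ρ i))
    (hρ0 : ∀ i t, 0 ≤ ρ i t) (hρ1 : ∀ i, ∫ t, ρ i t = 1)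
    (hρl : Tendsto (fun i => Function.support (ρ i)) l (𝓝 0).smallSets)
    (h_grad : ∀ᶠ i in l, ∀ x ∈ Ω.carrier,
      classicalGrad (ρ i ⋆[lsmul ℝ ℝ] Ω.carrier.indicator (H1.val w)) x =
        (ρ i ⋆[lsmul ℝ ℝ] Ω.carrier.indicator (H1.grad w)) x) :
    w ∈ closure (range (ofSmooth Ω)) := by
  have hΩ := Ω.isOpen.measurableSet
  have h_val_memLp : MemLp (Ω.carrier.indicator (H1.val w)) 2 volume :=
    (memLp_indicator_iff_restrict hΩ).2 (Lp.memLp _)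
  have h_grad_memLp : MemLp (Ω.carrier.indicator (H1.grad w)) 2 volume :=
    (memLp_indicator_iff_restrict hΩ).2 (Lp.memLp _)
  let φ (i : ι) : Smooth d := ⟨ρ i ⋆[lsmul ℝ ℝ] Ω.carrier.indicator (H1.val w),
    (hρc i).contDiff_convolution_left _ (hρ i) (h_val_memLp.locallyIntegrable (by norm_num))⟩
  refine mem_closure_of_tendsto (b := l) (f := fun i => ofSmooth Ω (φ i)) ?_
    (Eventually.of_forall fun i => mem_range_self _)
  refine H1.tendsto_of_tendsto_val_grad ?_ ?_
  · exact tendsto_of_tendsto_eLpNorm_sub_indicator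
      (Eventually.of_forall fun i => val_ofSmooth (φ i))
      (tendsto_eLpNorm_convolution_sub (by norm_num) (by norm_num) h_val_memLp
        (fun i => (hρ i).continuous) hρc hρ0 hρ1 hρl)
  · refine tendsto_of_tendsto_eLpNorm_sub_indicator (h_grad.mono fun i hi => ?_)
      (tendsto_eLpNorm_convolution_sub (by norm_num) (by norm_num) h_grad_memLp
        (fun i => (hρ i).continuous) hρc hρ0 hρ1 hρl)
    filter_upwards [grad_ofSmooth (φ i), ae_restrict_mem hΩ] with x hx hxΩ
    exact hx.trans (hi x hxΩ)

/-- A bump function supported in the ball of radius `ε δ` about `-ε e`. Convolution with it averages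
over the translate `x + B(ε e, ε δ)`, which stays in `Ω` under the interior cone condition. -/
def coneBump (e : RSpace d) {ε δ : ℝ} (hε : 0 < ε) (hδ : 0 < δ) : ContDiffBump (-(ε • e)) where
  rIn := ε * δ / 2
  rOut := ε * δ
  rIn_pos := by positivity
  rIn_lt_rOut := half_lt_self (by positivity)

lemma closedBall_neg_smul_subset (e : RSpace d) {ε : ℝ} (hε : 0 ≤ ε) (δ : ℝ) :
    Metric.closedBall (-(ε • e)) (ε * δ) ⊆ Metric.closedBall 0 (ε * (‖e‖ + δ)) := by
  refine Metric.closedBall_subset_closedBall' ?_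
  rw [dist_zero_right, norm_neg, norm_smul, Real.norm_of_nonneg hε]
  exact le_of_eq (by ring)

lemma mem_closure_range_ofSmooth_of_hasInteriorCone {w : H1 Ω} {S U : Set (RSpace d)}
    (hw : w.IsSupportedIn S) (hS : IsCompact S) (hU : IsOpen U) (hSU : S ⊆ U) {e : RSpace d}
    {δ ε₀ : ℝ} (hδ : 0 < δ) (hε₀ : 0 < ε₀) (hcone : HasInteriorCone Ω.carrier U e δ ε₀) :
    w ∈ closure (range (ofSmooth Ω)) := by
  obtain ⟨r, hr, h_thick⟩ := hS.exists_thickening_subset_open hU hSU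
  have hε (n : ℕ) : 0 < ε₀ / (n + 1) := by positivity
  let ρ (n : ℕ) : RSpace d → ℝ := (coneBump e (hε n) hδ).normed volume
  have h_tsupport (n : ℕ) :
      tsupport (ρ n) = Metric.closedBall (-((ε₀ / (n + 1)) • e)) (ε₀ / (n + 1) * δ) :=
    ContDiffBump.tsupport_normed_eq _
  have h_small : ∀ R > 0, ∀ᶠ n in atTop, tsupport (ρ n) ⊆ Metric.ball 0 R := by
    intro R hR
    have h_lim : Tendsto (fun n : ℕ => ε₀ / (n + 1) * (‖e‖ + δ)) atTop (𝓝 0) := by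
      simpa [div_eq_mul_one_div ε₀] using
        (tendsto_one_div_add_atTop_nhds_zero_nat.const_mul ε₀).mul_const (‖e‖ + δ)
    filter_upwards [h_lim.eventually_lt_const hR] with n hn
    rw [h_tsupport]
    exact (closedBall_neg_smul_subset e (hε n).le δ).trans (Metric.closedBall_subset_ball hn)
  refine mem_closure_range_ofSmooth_of_mollifier (l := atTop) (ρ := ρ)
    (fun n => ContDiffBump.contDiff_normed _) (fun n => ContDiffBump.hasCompactSupport_normed _)
    (fun n t => ContDiffBump.nonneg_normed _ t) (fun n => ContDiffBump.integral_normed _) ?_ ?_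
  · refine tendsto_smallSets_iff.2 fun V hV => ?_
    obtain ⟨R, hR, hRV⟩ := Metric.mem_nhds_iff.1 hV
    filter_upwards [h_small R hR] with n hn using (subset_tsupport _).trans (hn.trans hRV)
  · filter_upwards [h_small r hr] with n hn x hxΩ
    refine hw.classicalGrad_convolution_indicator (ContDiffBump.contDiff_normed _)
      (ContDiffBump.hasCompactSupport_normed _) ?_
    by_cases hxU : x ∈ U
    · refine Or.inl fun t ht => hcone x ⟨hxΩ, hxU⟩ _
        ⟨hε n, div_le_self hε₀.le (by simp)⟩ ?_
      rw [h_tsupport, mem_closedBall_iff_norm'] at ht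
      rw [mem_closedBall_iff_norm]
      convert ht using 2
      abel
    · refine Or.inr fun t ht hxt => hxU (h_thick (Metric.mem_thickening_iff.2 ⟨x - t, hxt, ?_⟩))
      simpa using hn ht

theorem denseRange_ofSmooth (Ω : LipschitzDomain d) : DenseRange (ofSmooth Ω) := by
  intro v
  choose! r hr e δ hδ ε₀ hε₀ hcone using fun (p : RSpace d) (hp : p ∈ closure Ω.carrier) =>
    exists_hasInteriorCone Ω hp
  obtain ⟨t, ht, h_cover⟩ := Ω.isBounded.isCompact_closure.elim_nhds_subcover
    (fun p => Metric.ball p (r p)) fun p hp => Metric.ball_mem_nhds p (hr p hp)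
  obtain ⟨χ, hχ⟩ := SmoothPartitionOfUnity.exists_isSubordinate
    (modelWithCornersSelf ℝ (RSpace d)) (isClosed_closure (s := Ω.carrier))
    (fun p : t => Metric.ball (p : RSpace d) (r p)) (fun _ => Metric.isOpen_ball)
    (by rwa [iUnion_subtype])
  have hχ_smooth (p : t) : ContDiff ℝ ∞ (χ p) := (χ p).contMDiff.contDiff
  have hχ_sum : ∀ x ∈ Ω.carrier, ∑ p, χ p x = 1 := fun x hx => by
    rw [← finsum_eq_sum_of_fintype, χ.sum_eq_one (subset_closure hx)]
  rw [← H1.sum_cutoff_eq hχ_smooth hχ_sum v]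
  refine (LinearMap.range (ofSmooth Ω)).topologicalClosure.sum_mem fun p _ => ?_
  have hχc : IsCompact (tsupport (χ p)) := Metric.isCompact_of_isClosed_isBounded
    (isClosed_tsupport _) (Metric.isBounded_ball.subset (hχ p))
  exact mem_closure_range_ofSmooth_of_hasInteriorCone (H1.isSupportedIn_cutoff (hχ_smooth p) v) hχc
    Metric.isOpen_ball (hχ p) (hδ p (ht p p.2)) (hε₀ p (ht p p.2)) (hcone p (ht p p.2))

end Density

/-! ### Squared norms as lower integrals -/

lemma sq_lintegral_le {α : Type*} {mα : MeasurableSpace α} (μ : Measure α) {g : α → ℝ≥0∞}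
    (hg : AEMeasurable g μ) : (∫⁻ x, g x ∂μ) ^ 2 ≤ μ univ * ∫⁻ x, g x ^ 2 ∂μ := by
  have h_holder := ENNReal.lintegral_mul_le_Lp_mul_Lq μ Real.HolderConjugate.two_two
    (f := fun _ => 1) (g := g) aemeasurable_const hg
  simp only [Pi.mul_apply, one_mul, ENNReal.one_rpow, lintegral_const] at h_holder
  refine (pow_le_pow_left' h_holder 2).trans (le_of_eq ?_)
  rw [mul_pow, ← ENNReal.rpow_mul_natCast, ← ENNReal.rpow_mul_natCast]
  norm_num

lemma enorm_sq_eq_lintegral {α F : Type*} {mα : MeasurableSpace α} [NormedAddCommGroup F]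
    {μ : Measure α} (f : Lp F 2 μ) : ‖f‖ₑ ^ 2 = ∫⁻ x, ‖f x‖ₑ ^ 2 ∂μ := by
  rw [Lp.enorm_def, eLpNorm_eq_lintegral_rpow_enorm_toReal two_ne_zero ENNReal.ofNat_ne_top,
    ← ENNReal.rpow_mul_natCast]
  norm_num

lemma enorm_add_sq_le {F : Type*} [NormedAddCommGroup F] (a b : F) :
    ‖a + b‖ₑ ^ 2 ≤ 2 * ‖a‖ₑ ^ 2 + 2 * ‖b‖ₑ ^ 2 := by
  have h_nnnorm : ‖a + b‖₊ ^ 2 ≤ 2 * ‖a‖₊ ^ 2 + 2 * ‖b‖₊ ^ 2 := by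
    rw [← mul_add]
    exact (pow_le_pow_left' (nnnorm_add_le a b) 2).trans (add_sq_le (a := ‖a‖₊))
  simp only [enorm_eq_nnnorm]
  exact_mod_cast h_nnnorm

lemma H1.enorm_sq {Ω : LipschitzDomain d} (v : H1 Ω) :
    ‖v‖ₑ ^ 2 = ‖H1.val v‖ₑ ^ 2 + ‖H1.grad v‖ₑ ^ 2 := by
  have h_nnnorm : ‖v‖₊ ^ 2 = ‖H1.val v‖₊ ^ 2 + ‖H1.grad v‖₊ ^ 2 := NNReal.coe_injective v.norm_sq
  simp only [enorm_eq_nnnorm]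
  exact_mod_cast h_nnnorm

lemma enorm_sub_sq_le_lintegral_classicalGrad {φ : RSpace d → ℂ} (hφ : ContDiff ℝ 1 φ)
    (x h : RSpace d) {t : ℝ} (ht : 0 ≤ t) : ‖φ (x + t • h) - φ x‖ₑ ^ 2 ≤
      ENNReal.ofReal t * ‖h‖ₑ ^ 2 * ∫⁻ s in Ioc 0 t, ‖classicalGrad φ (x + s • h)‖ₑ ^ 2 := by
  have h_line : Continuous fun s : ℝ => x + s • h := by fun_prop
  have h_deriv (s : ℝ) :
      HasDerivAt (fun s : ℝ => φ (x + s • h)) (fderiv ℝ φ (x + s • h) h) s := by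
    have h_line_deriv : HasDerivAt (fun s : ℝ => x + s • h) h s := by
      simpa using ((hasDerivAt_id s).smul_const h).const_add x
    exact (hφ.differentiable one_ne_zero _).hasFDerivAt.comp_hasDerivAt s h_line_deriv
  have h_cont : Continuous fun s : ℝ => fderiv ℝ φ (x + s • h) h :=
    ((hφ.continuous_fderiv one_ne_zero).comp h_line).clm_apply continuous_const
  have h_ftc := intervalIntegral.integral_eq_sub_of_hasDerivAt (a := 0) (b := t)
    (fun s _ => h_deriv s) (h_cont.intervalIntegrable _ _)
  simp only [zero_smul, add_zero, intervalIntegral.integral_of_le ht] at h_ftc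
  have h_meas : Measurable fun s : ℝ => ‖classicalGrad φ (x + s • h)‖ₑ :=
    ((continuous_classicalGrad hφ).comp h_line).measurable.enorm
  have h_pointwise (s : ℝ) :
      ‖fderiv ℝ φ (x + s • h) h‖ₑ ≤ ‖classicalGrad φ (x + s • h)‖ₑ * ‖h‖ₑ := by
    rw [← ofReal_norm, ← ofReal_norm, ← ofReal_norm, ← ENNReal.ofReal_mul (norm_nonneg _)]
    exact ENNReal.ofReal_le_ofReal (norm_fderiv_apply_le φ (x + s • h) h)
  calc ‖φ (x + t • h) - φ x‖ₑ ^ 2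
      ≤ (∫⁻ s in Ioc 0 t, ‖classicalGrad φ (x + s • h)‖ₑ * ‖h‖ₑ) ^ 2 := by
        rw [← h_ftc]
        gcongr
        exact (enorm_integral_le_lintegral_enorm _).trans (lintegral_mono h_pointwise)
    _ ≤ (volume.restrict (Ioc 0 t)) univ *
        ∫⁻ s in Ioc 0 t, (‖classicalGrad φ (x + s • h)‖ₑ * ‖h‖ₑ) ^ 2 :=
        sq_lintegral_le _ (h_meas.mul_const _).aemeasurable
    _ = ENNReal.ofReal t * ‖h‖ₑ ^ 2 *
        ∫⁻ s in Ioc 0 t, ‖classicalGrad φ (x + s • h)‖ₑ ^ 2 := by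
        simp only [mul_pow]
        rw [lintegral_mul_const _ (h_meas.pow_const 2), Measure.restrict_apply_univ,
          Real.volume_Ioc, sub_zero]
        ring

/-! ### Lipschitz graphs -/

section Graph

variable {E : Type*} [NormedAddCommGroup E] [InnerProductSpace ℝ E] {e : E} {γ : (ℝ ∙ e)ᗮ → ℝ}
  {K : ℝ≥0}

/-- The parametrisation of the graph of `γ` over the hyperplane orthogonal to `e`. -/
def graphMap (e : E) (γ : (ℝ ∙ e)ᗮ → ℝ) (y : (ℝ ∙ e)ᗮ) : E := y + γ y • e

lemma orthogonalProjectionOnto_graphMap_add (y : (ℝ ∙ e)ᗮ) (t : ℝ) :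
    (ℝ ∙ e)ᗮ.orthogonalProjectionOnto (graphMap e γ y + t • e) = y := by
  rw [graphMap, add_assoc, ← add_smul, map_add, map_smul,
    Submodule.orthogonalProjectionOnto_orthogonal_apply_eq_zero
      (Submodule.mem_span_singleton_self e), smul_zero, add_zero,
    Submodule.orthogonalProjectionOnto_mem_subspace_eq_self]

lemma orthogonalProjectionOnto_graphMap (y : (ℝ ∙ e)ᗮ) :
    (ℝ ∙ e)ᗮ.orthogonalProjectionOnto (graphMap e γ y) = y := by
  simpa using orthogonalProjectionOnto_graphMap_add (γ := γ) y 0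

lemma inner_graphMap_add (he : ‖e‖ = 1) (y : (ℝ ∙ e)ᗮ) (t : ℝ) :
    inner ℝ e (graphMap e γ y + t • e) = γ y + t := by
  rw [graphMap, add_assoc, ← add_smul, inner_add_right, inner_smul_right,
    Submodule.mem_orthogonal_singleton_iff_inner_right.1 y.2, real_inner_self_eq_norm_sq, he]
  ring

lemma graphMap_add_mem_strictEpigraph (he : ‖e‖ = 1) (y : (ℝ ∙ e)ᗮ) {t : ℝ} (ht : 0 < t) :
    graphMap e γ y + t • e ∈ strictEpigraph e γ := by
  rw [mem_strictEpigraph, orthogonalProjectionOnto_graphMap_add, inner_graphMap_add he]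
  exact lt_add_of_pos_right _ ht

lemma graphMap_orthogonalProjectionOnto (he : ‖e‖ = 1) {x : E}
    (hx : inner ℝ e x = γ ((ℝ ∙ e)ᗮ.orthogonalProjectionOnto x)) :
    graphMap e γ ((ℝ ∙ e)ᗮ.orthogonalProjectionOnto x) = x := by
  have h_split := Submodule.starProjection_add_starProjection_orthogonal (K := ℝ ∙ e) x
  rw [Submodule.starProjection_unit_singleton ℝ he] at h_split
  rw [graphMap, ← hx, add_comm]
  exact h_split

lemma mem_frontier_iff_of_eq_strictEpigraph {s U : Set E} (hs : IsOpen s) (hU : IsOpen U)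
    (he : ‖e‖ = 1) (hγ : Continuous γ) (h : ∀ x ∈ U, x ∈ s ↔ x ∈ strictEpigraph e γ) {x : E}
    (hx : x ∈ U) :
    x ∈ frontier s ↔ inner ℝ e x = γ ((ℝ ∙ e)ᗮ.orthogonalProjectionOnto x) := by
  have h_height : Continuous fun y : E => inner ℝ e y := continuous_const.inner continuous_id
  have h_graph : Continuous fun y : E => γ ((ℝ ∙ e)ᗮ.orthogonalProjectionOnto y) :=
    hγ.comp (ContinuousLinearMap.continuous _)
  rw [frontier, hs.interior_eq, Set.mem_sdiff, h x hx, mem_strictEpigraph, not_lt]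
  constructor
  · rintro ⟨h_closure, h_le⟩
    refine le_antisymm h_le (not_lt.1 fun h_lt => ?_)
    have h_below : IsOpen (U ∩ {y | inner ℝ e y < γ ((ℝ ∙ e)ᗮ.orthogonalProjectionOnto y)}) :=
      hU.inter (isOpen_lt h_height h_graph)
    obtain ⟨y, ⟨hyU, hy⟩, hys⟩ := mem_closure_iff.1 h_closure _ h_below ⟨hx, h_lt⟩
    exact lt_asymm ((h y hyU).1 hys) (mem_ofPred.1 hy)
  · intro h_eq
    refine ⟨?_, h_eq.le⟩
    have h_lim : Tendsto (fun t : ℝ => x + t • e) (𝓝[>] 0) (𝓝 x) := by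
      have h_cont : Continuous fun t : ℝ => x + t • e := by fun_prop
      simpa using (h_cont.tendsto 0).mono_left nhdsWithin_le_nhds
    refine mem_closure_of_tendsto h_lim ?_
    filter_upwards [h_lim (hU.mem_nhds hx), self_mem_nhdsWithin] with t htU ht
    rw [h _ htU, ← graphMap_orthogonalProjectionOnto he h_eq]
    exact graphMap_add_mem_strictEpigraph he _ ht

lemma lipschitzWith_graphMap (he : ‖e‖ = 1) (hγ : LipschitzWith K γ) :
    LipschitzWith (1 + K) (graphMap e γ) := by
  refine (LipschitzWith.subtype_val _).add (LipschitzWith.of_dist_le_mul fun x y => ?_)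
  rw [dist_eq_norm, ← sub_smul, norm_smul, he, mul_one, ← dist_eq_norm]
  exact hγ.dist_le_mul x y

lemma euclideanHausdorffMeasure_image_le_of_lipschitzWith {X Y : Type*} [EMetricSpace X]
    [EMetricSpace Y] [MeasurableSpace X] [BorelSpace X] [MeasurableSpace Y] [BorelSpace Y]
    {f : X → Y} (hf : LipschitzWith K f) (n : ℕ) (s : Set X) :
    μHE[n] (f '' s) ≤ (K : ℝ≥0∞) ^ n * μHE[n] s := by
  rw [Measure.euclideanHausdorffMeasure_def, Measure.euclideanHausdorffMeasure_def,
    Measure.smul_apply, Measure.smul_apply, mul_smul_comm]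
  gcongr
  simpa using hf.hausdorffMeasure_image_le (d := n) (Nat.cast_nonneg n) s

variable [FiniteDimensional ℝ E]

lemma finrank_orthogonal_span_of_norm_eq_one (he : ‖e‖ = 1) :
    Module.finrank ℝ (ℝ ∙ e)ᗮ = Module.finrank ℝ E - 1 := by
  have h_sum := Submodule.finrank_add_finrank_orthogonal (ℝ ∙ e)
  rw [finrank_span_singleton (norm_ne_zero_iff.1 (he ▸ one_ne_zero))] at h_sum
  omega

variable [MeasurableSpace E] [BorelSpace E]

lemma euclideanHausdorffMeasure_image_graphMap_le (he : ‖e‖ = 1) (hγ : LipschitzWith K γ)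
    (s : Set (ℝ ∙ e)ᗮ) : μHE[Module.finrank ℝ E - 1] (graphMap e γ '' s) ≤
      ((1 + K : ℝ≥0) : ℝ≥0∞) ^ (Module.finrank ℝ E - 1) * volume s := by
  rw [← InnerProductSpace.euclideanHausdorffMeasure_eq_volume,
    finrank_orthogonal_span_of_norm_eq_one he]
  exact euclideanHausdorffMeasure_image_le_of_lipschitzWith (lipschitzWith_graphMap he hγ) _ s

lemma volume_le_euclideanHausdorffMeasure_image_graphMap (he : ‖e‖ = 1) (s : Set (ℝ ∙ e)ᗮ) :
    volume s ≤ μHE[Module.finrank ℝ E - 1] (graphMap e γ '' s) := by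
  have h := euclideanHausdorffMeasure_image_le_of_lipschitzWith
    (Submodule.lipschitzWith_orthogonalProjectionOnto (ℝ ∙ e)ᗮ) (Module.finrank ℝ E - 1)
    (graphMap e γ '' s)
  rw [← InnerProductSpace.euclideanHausdorffMeasure_eq_volume,
    finrank_orthogonal_span_of_norm_eq_one he]
  simpa only [image_image, orthogonalProjectionOnto_graphMap, image_id', ENNReal.coe_one, one_pow,
    one_mul] using h

lemma measurePreserving_add_smul (he : ‖e‖ = 1) :
    MeasurePreserving (fun q : (ℝ ∙ e)ᗮ × ℝ => (q.1 : E) + q.2 • e) (volume.prod volume)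
      volume := by
  have h_line : MeasurePreserving
      (Prod.map id (LinearIsometryEquiv.toSpanUnitSingleton (𝕜 := ℝ) e he))
      ((volume : Measure (ℝ ∙ e)ᗮ).prod volume) (volume.prod volume) :=
    (MeasurePreserving.id _).prod (LinearIsometryEquiv.measurePreserving _)
  have h_sum := (Submodule.measurePreserving_measurableEquivProd (ℝ ∙ e) (0 : E)).symm
  rw [InnerProductSpace.euclideanHausdorffMeasure_eq_volume] at h_sum
  have h_comp : (fun q : (ℝ ∙ e)ᗮ × ℝ => (q.1 : E) + q.2 • e) =
      ((ℝ ∙ e).measurableEquivProd (0 : E)).symm ∘ Prod.swap ∘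
        Prod.map id (LinearIsometryEquiv.toSpanUnitSingleton (𝕜 := ℝ) e he) := by
    funext ⟨y, t⟩
    simp only [Function.comp_apply, Prod.map_apply, id_eq, Prod.swap_prod_mk,
      Submodule.measurableEquivProd_symm_apply, LinearIsometryEquiv.toSpanUnitSingleton_apply,
      vadd_eq_add, add_zero]
    exact add_comm _ _
  rw [h_comp]
  exact h_sum.comp (Measure.measurePreserving_swap.comp h_line)

lemma measurePreserving_graphMap_add (he : ‖e‖ = 1) (hγ : Measurable γ) :
    MeasurePreserving (fun q : (ℝ ∙ e)ᗮ × ℝ => graphMap e γ q.1 + q.2 • e)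
      (volume.prod volume) volume := by
  have h_shear : MeasurePreserving (fun q : (ℝ ∙ e)ᗮ × ℝ => (q.1, γ q.1 + q.2))
      (volume.prod volume) (volume.prod volume) :=
    (MeasurePreserving.id (volume : Measure (ℝ ∙ e)ᗮ)).skew_product (g := fun y t => γ y + t)
      ((hγ.comp measurable_fst).add measurable_snd)
      (ae_of_all _ fun y => (measurePreserving_add_left volume (γ y)).map_eq)
  have h_comp : (fun q : (ℝ ∙ e)ᗮ × ℝ => graphMap e γ q.1 + q.2 • e) =
      (fun q => (q.1 : E) + q.2 • e) ∘ fun q => (q.1, γ q.1 + q.2) := by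
    funext q
    simp only [Function.comp_apply, graphMap, add_smul, add_assoc]
  rw [h_comp]
  exact (measurePreserving_add_smul he).comp h_shear

end Graph

/-! ### The trace inequality -/

section Graph

variable {E : Type*} [NormedAddCommGroup E] [InnerProductSpace ℝ E] {e : E} {γ : (ℝ ∙ e)ᗮ → ℝ}
  {K : ℝ≥0} {s : Set E}

lemma graphMap_add_mem_of_eq_strictEpigraph {p : E} {R : ℝ} (he : ‖e‖ = 1)
    (h : ∀ x ∈ Metric.ball p R, x ∈ s ↔ x ∈ strictEpigraph e γ) {y : (ℝ ∙ e)ᗮ}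
    (hy : graphMap e γ y ∈ Metric.ball p (R / 2)) {t : ℝ} (ht : t ∈ Ioc 0 (R / 2)) :
    graphMap e γ y + t • e ∈ s := by
  refine (h _ ?_).2 (graphMap_add_mem_strictEpigraph he y ht.1)
  have h_dist : dist (graphMap e γ y + t • e) (graphMap e γ y) = t := by
    rw [dist_self_add_left, norm_smul, he, mul_one, Real.norm_of_nonneg ht.1.le]
  rw [Metric.mem_ball] at hy ⊢
  linarith [ht.2, dist_triangle (graphMap e γ y + t • e) (graphMap e γ y) p]

variable [FiniteDimensional ℝ E] [MeasurableSpace E] [BorelSpace E]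

lemma euclideanHausdorffMeasure_restrict_frontier_le {U : Set E} (hs : IsOpen s) (hU : IsOpen U)
    (he : ‖e‖ = 1) (hγ : LipschitzWith K γ) (h : ∀ x ∈ U, x ∈ s ↔ x ∈ strictEpigraph e γ) :
    μHE[Module.finrank ℝ E - 1].restrict (U ∩ frontier s) ≤
      ((1 + K : ℝ≥0) : ℝ≥0∞) ^ (Module.finrank ℝ E - 1) •
        (volume.restrict (graphMap e γ ⁻¹' U)).map (graphMap e γ) := by
  have h_meas : Measurable (graphMap e γ) := (lipschitzWith_graphMap he hγ).continuous.measurable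
  refine Measure.le_iff.2 fun A hA => ?_
  rw [Measure.restrict_apply hA, Measure.smul_apply, Measure.map_apply h_meas hA,
    Measure.restrict_apply (h_meas hA), smul_eq_mul]
  refine (measure_mono ?_).trans (euclideanHausdorffMeasure_image_graphMap_le he hγ _)
  rintro x ⟨hxA, hxU, hx⟩
  have h_eq := graphMap_orthogonalProjectionOnto he
    ((mem_frontier_iff_of_eq_strictEpigraph hs hU he hγ.continuous h hxU).1 hx)
  exact ⟨_, ⟨by rwa [mem_preimage, h_eq], by rwa [mem_preimage, h_eq]⟩, h_eq⟩

lemma lintegral_lintegral_graphMap_add_le (he : ‖e‖ = 1) (hγ : Measurable γ) (hs : MeasurableSet s)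
    {D : Set (ℝ ∙ e)ᗮ} {r : ℝ} (hD : ∀ y ∈ D, ∀ t ∈ Ioc 0 r, graphMap e γ y + t • e ∈ s)
    {f : E → ℝ≥0∞} (hf : Measurable f) :
    ∫⁻ y in D, ∫⁻ t in Ioc 0 r, f (graphMap e γ y + t • e) ≤ ∫⁻ x in s, f x := by
  have h_pres := measurePreserving_graphMap_add he hγ
  rw [← lintegral_prod (μ := volume.restrict D) (ν := volume.restrict (Ioc 0 r))
    (fun q : (ℝ ∙ e)ᗮ × ℝ => f (graphMap e γ q.1 + q.2 • e))
    (hf.comp h_pres.measurable).aemeasurable, Measure.prod_restrict,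
    ← h_pres.setLIntegral_comp_preimage hs hf]
  exact lintegral_mono_set fun q hq => hD q.1 hq.1 q.2 hq.2

end Graph

lemma ofReal_mul_enorm_sq_le_lintegral {φ : RSpace d → ℂ} (hφ : ContDiff ℝ 1 φ) (x h : RSpace d)
    (r : ℝ) : ENNReal.ofReal r * ‖φ x‖ₑ ^ 2 ≤ ∫⁻ t in Ioc 0 r,
      (2 * ‖φ (x + t • h)‖ₑ ^ 2 +
        2 * ENNReal.ofReal r ^ 2 * ‖h‖ₑ ^ 2 * ‖classicalGrad φ (x + t • h)‖ₑ ^ 2) := by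
  have h_line : Measurable fun t : ℝ => x + t • h := Continuous.measurable (by fun_prop)
  have h_meas_grad : Measurable fun t : ℝ => ‖classicalGrad φ (x + t • h)‖ₑ ^ 2 :=
    ((continuous_classicalGrad hφ).measurable.comp h_line).enorm.pow_const 2
  set G := ∫⁻ t in Ioc 0 r, ‖classicalGrad φ (x + t • h)‖ₑ ^ 2
  have h_pointwise : ∀ t ∈ Ioc 0 r, ‖φ x‖ₑ ^ 2 ≤
      2 * ‖φ (x + t • h)‖ₑ ^ 2 + 2 * (ENNReal.ofReal r * ‖h‖ₑ ^ 2 * G) := by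
    intro t ht
    have h_add := enorm_add_sq_le (φ (x + t • h)) (-(φ (x + t • h) - φ x))
    rw [enorm_neg, neg_sub, add_sub_cancel] at h_add
    refine h_add.trans ?_
    gcongr
    refine (enorm_sub_sq_le_lintegral_classicalGrad hφ x h ht.1.le).trans ?_
    gcongr
    exacts [ht.2, lintegral_mono_set (Ioc_subset_Ioc_right ht.2)]
  calc ENNReal.ofReal r * ‖φ x‖ₑ ^ 2
      = ∫⁻ _ in Ioc 0 r, ‖φ x‖ₑ ^ 2 := by
        rw [setLIntegral_const, Real.volume_Ioc, sub_zero, mul_comm]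
    _ ≤ ∫⁻ t in Ioc 0 r,
          (2 * ‖φ (x + t • h)‖ₑ ^ 2 + 2 * (ENNReal.ofReal r * ‖h‖ₑ ^ 2 * G)) :=
        setLIntegral_mono' measurableSet_Ioc h_pointwise
    _ = _ := by
        rw [lintegral_add_right _ measurable_const, setLIntegral_const, Real.volume_Ioc, sub_zero,
          lintegral_add_right _ (h_meas_grad.const_mul _), lintegral_const_mul _ h_meas_grad]
        ring

lemma ofReal_mul_lintegral_graphMap_le {φ : RSpace d → ℂ} (hφ : ContDiff ℝ 1 φ) {e : RSpace d}
    (he : ‖e‖ = 1) {γ : (ℝ ∙ e)ᗮ → ℝ} (hγ : Measurable γ) {s : Set (RSpace d)}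
    (hs : MeasurableSet s) {D : Set (ℝ ∙ e)ᗮ} {r : ℝ}
    (hD : ∀ y ∈ D, ∀ t ∈ Ioc 0 r, graphMap e γ y + t • e ∈ s) :
    ENNReal.ofReal r * ∫⁻ y in D, ‖φ (graphMap e γ y)‖ₑ ^ 2 ≤
      (2 + 2 * ENNReal.ofReal r ^ 2) * ∫⁻ x in s, (‖φ x‖ₑ ^ 2 + ‖classicalGrad φ x‖ₑ ^ 2) := by
  have h_meas : Measurable fun x => ‖φ x‖ₑ ^ 2 := hφ.continuous.measurable.enorm.pow_const 2
  have h_meas_grad : Measurable fun x => ‖classicalGrad φ x‖ₑ ^ 2 :=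
    (continuous_classicalGrad hφ).measurable.enorm.pow_const 2
  have he' : ‖e‖ₑ = 1 := by rw [← ofReal_norm, he, ENNReal.ofReal_one]
  calc ENNReal.ofReal r * ∫⁻ y in D, ‖φ (graphMap e γ y)‖ₑ ^ 2
      ≤ ∫⁻ y in D, ∫⁻ t in Ioc 0 r, (2 * ‖φ (graphMap e γ y + t • e)‖ₑ ^ 2 +
          2 * ENNReal.ofReal r ^ 2 * ‖classicalGrad φ (graphMap e γ y + t • e)‖ₑ ^ 2) := by
        rw [← lintegral_const_mul' _ _ ENNReal.ofReal_ne_top]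
        refine lintegral_mono fun y => ?_
        simpa only [he', one_pow, mul_one] using
          ofReal_mul_enorm_sq_le_lintegral hφ (graphMap e γ y) e r
    _ ≤ ∫⁻ x in s, (2 * ‖φ x‖ₑ ^ 2 + 2 * ENNReal.ofReal r ^ 2 * ‖classicalGrad φ x‖ₑ ^ 2) :=
        lintegral_lintegral_graphMap_add_le he hγ hs hD
          ((h_meas.const_mul 2).add (h_meas_grad.const_mul _))
    _ ≤ ∫⁻ x in s, (2 + 2 * ENNReal.ofReal r ^ 2) *
          (‖φ x‖ₑ ^ 2 + ‖classicalGrad φ x‖ₑ ^ 2) := by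
        refine lintegral_mono fun x => ?_
        rw [mul_add]
        gcongr
        exacts [le_self_add, le_add_self]
    _ = _ := lintegral_const_mul _ (h_meas.add h_meas_grad)

/-- The trace inequality on the part of the boundary in `S`, with constant independent of `φ`. -/
def HasTraceBound (Ω : LipschitzDomain d) (S : Set (RSpace d)) : Prop :=
  ∃ C : ℝ≥0∞, C ≠ ⊤ ∧ ∀ φ : RSpace d → ℂ, ContDiff ℝ 1 φ →
    ∫⁻ x in S, ‖φ x‖ₑ ^ 2 ∂Ω.surface ≤
      C * ∫⁻ x, (‖φ x‖ₑ ^ 2 + ‖classicalGrad φ x‖ₑ ^ 2) ∂Ω.vol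

lemma exists_hasTraceBound_ball (Ω : LipschitzDomain d) {p : RSpace d}
    (hp : p ∈ frontier Ω.carrier) : ∃ r > 0, HasTraceBound Ω (Metric.ball p r) := by
  obtain ⟨R, hR, e, he, γ, K, hγ, h⟩ := exists_chart Ω hp
  have hr : 0 < R / 2 := half_pos hR
  have h_half : ∀ x ∈ Metric.ball p (R / 2), x ∈ Ω.carrier ↔ x ∈ strictEpigraph e γ :=
    fun x hx => h x (Metric.ball_subset_ball (half_le_self hR.le) hx)
  have h_surface := euclideanHausdorffMeasure_restrict_frontier_le Ω.isOpen Metric.isOpen_ball he hγ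
    h_half
  rw [finrank_euclideanSpace_fin, ← Measure.restrict_restrict Metric.isOpen_ball.measurableSet]
    at h_surface
  set Λ : ℝ≥0∞ := ((1 + K : ℝ≥0) : ℝ≥0∞) ^ (d - 1)
  set ρ : ℝ≥0∞ := ENNReal.ofReal (R / 2)
  have hρ : ρ ≠ 0 := (ENNReal.ofReal_pos.2 hr).ne'
  refine ⟨R / 2, hr, Λ * (ρ⁻¹ * (2 + 2 * ρ ^ 2)), by finiteness, fun φ hφ => ?_⟩
  set X := ∫⁻ x, (‖φ x‖ₑ ^ 2 + ‖classicalGrad φ x‖ₑ ^ 2) ∂Ω.vol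
  calc ∫⁻ x in Metric.ball p (R / 2), ‖φ x‖ₑ ^ 2 ∂Ω.surface
      ≤ Λ * ∫⁻ y in graphMap e γ ⁻¹' Metric.ball p (R / 2), ‖φ (graphMap e γ y)‖ₑ ^ 2 := by
        refine (lintegral_mono' h_surface le_rfl).trans (le_of_eq ?_)
        rw [lintegral_smul_measure, smul_eq_mul, lintegral_map
          (hφ.continuous.measurable.enorm.pow_const 2)
          (lipschitzWith_graphMap he hγ).continuous.measurable]
    _ ≤ Λ * (ρ⁻¹ * ((2 + 2 * ρ ^ 2) * X)) := by
        gcongr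
        rw [mul_comm ρ⁻¹, ← div_eq_mul_inv, ENNReal.le_div_iff_mul_le (Or.inl hρ)
          (Or.inl ENNReal.ofReal_ne_top), mul_comm]
        exact ofReal_mul_lintegral_graphMap_le hφ he hγ.continuous.measurable
          Ω.isOpen.measurableSet
          fun y hy t ht => graphMap_add_mem_of_eq_strictEpigraph he h hy ht
    _ = Λ * (ρ⁻¹ * (2 + 2 * ρ ^ 2)) * X := by ring

theorem hasTraceBound_frontier (Ω : LipschitzDomain d) : HasTraceBound Ω (frontier Ω.carrier) := by
  have h_compact : IsCompact (frontier Ω.carrier) :=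
    Ω.isBounded.isCompact_closure.of_isClosed_subset isClosed_frontier frontier_subset_closure
  refine h_compact.induction_on ⟨0, ENNReal.zero_ne_top, fun φ _ => by simp⟩ ?_ ?_ ?_
  · rintro S T hST ⟨C, hC, h⟩
    exact ⟨C, hC, fun φ hφ => (lintegral_mono_set hST).trans (h φ hφ)⟩
  · rintro S T ⟨C, hC, h⟩ ⟨C', hC', h'⟩
    refine ⟨C + C', ENNReal.add_ne_top.2 ⟨hC, hC'⟩, fun φ hφ => ?_⟩
    rw [add_mul]
    exact (lintegral_union_le _ _ _).trans (add_le_add (h φ hφ) (h' φ hφ))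
  · intro p hp
    obtain ⟨r, hr, h⟩ := exists_hasTraceBound_ball Ω hp
    exact ⟨_, mem_nhdsWithin_of_mem_nhds (Metric.ball_mem_nhds p hr), h⟩

theorem exists_lintegral_surface_le (Ω : LipschitzDomain d) :
    ∃ C : ℝ≥0∞, C ≠ ⊤ ∧ ∀ φ : RSpace d → ℂ, ContDiff ℝ 1 φ → ∫⁻ x, ‖φ x‖ₑ ^ 2 ∂Ω.surface ≤
      C * ∫⁻ x, (‖φ x‖ₑ ^ 2 + ‖classicalGrad φ x‖ₑ ^ 2) ∂Ω.vol := by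
  have h := hasTraceBound_frontier Ω
  rwa [HasTraceBound, Measure.restrict_restrict isClosed_frontier.measurableSet, inter_self] at h

instance (Ω : LipschitzDomain d) : IsFiniteMeasure Ω.surface := by
  obtain ⟨C, hC, h⟩ := exists_lintegral_surface_le Ω
  have h_one := h (fun _ => 1) contDiff_const
  have h_grad (x : RSpace d) : classicalGrad (fun _ : RSpace d => (1 : ℂ)) x = 0 := by
    ext i
    simp
  simp only [h_grad, enorm_one, one_pow, lintegral_const, one_mul, enorm_zero, ne_eq,
    OfNat.ofNat_ne_zero, not_false_eq_true, zero_pow, add_zero] at h_one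
  exact ⟨h_one.trans_lt (ENNReal.mul_lt_top hC.lt_top (measure_lt_top _ _))⟩

/-! ### The trace operator -/

section Trace

variable (Ω : LipschitzDomain d)

lemma memLp_surface_of_continuous {F : Type*} [NormedAddCommGroup F] {f : RSpace d → F}
    (hf : Continuous f) (p : ℝ≥0∞) : MemLp f p Ω.surface := by
  have h_compact : IsCompact (frontier Ω.carrier) :=
    Ω.isBounded.isCompact_closure.of_isClosed_subset isClosed_frontier frontier_subset_closure
  obtain ⟨C, hC⟩ := h_compact.exists_bound_of_continuousOn hf.continuousOn
  refine MemLp.of_bound hf.aestronglyMeasurable C ?_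
  filter_upwards [ae_restrict_mem isClosed_frontier.measurableSet] with x hx
  exact hC x hx

/-- The restriction of smooth functions to `∂Ω`, as a linear map into `L²(∂Ω)`; the trace operator
is its continuous extension to `H¹(Ω)`. -/
def smoothTrace : Smooth d →ₗ[ℂ] Lp ℂ 2 Ω.surface where
  toFun φ := (memLp_surface_of_continuous Ω (Smooth.contDiff φ).continuous 2).toLp _
  map_add' φ ψ := MemLp.toLp_add (memLp_surface_of_continuous Ω (Smooth.contDiff φ).continuous 2)
    (memLp_surface_of_continuous Ω (Smooth.contDiff ψ).continuous 2)
  map_smul' c φ := MemLp.toLp_const_smul c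
    (memLp_surface_of_continuous Ω (Smooth.contDiff φ).continuous 2)

lemma smoothTrace_ae_eq (φ : Smooth d) : smoothTrace Ω φ =ᵐ[Ω.surface] φ :=
  (memLp_surface_of_continuous Ω (Smooth.contDiff φ).continuous 2).coeFn_toLp

lemma enorm_ofSmooth_sq (φ : Smooth d) : ‖ofSmooth Ω φ‖ₑ ^ 2 =
    ∫⁻ x, (‖(φ : RSpace d → ℂ) x‖ₑ ^ 2 + ‖classicalGrad φ x‖ₑ ^ 2) ∂Ω.vol := by
  rw [H1.enorm_sq, enorm_sq_eq_lintegral, enorm_sq_eq_lintegral, lintegral_add_left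
    ((Smooth.contDiff φ).continuous.measurable.enorm.pow_const 2)]
  congr 1
  · exact lintegral_congr_ae ((val_ofSmooth φ).fun_comp fun z => ‖z‖ₑ ^ 2)
  · exact lintegral_congr_ae ((grad_ofSmooth φ).fun_comp fun z => ‖z‖ₑ ^ 2)

lemma norm_le_sqrt_mul_norm_of_enorm_sq_le {E F : Type*} [NormedAddCommGroup E]
    [NormedAddCommGroup F] {x : E} {y : F} {C : ℝ≥0∞} (hC : C ≠ ⊤)
    (h : ‖x‖ₑ ^ 2 ≤ C * ‖y‖ₑ ^ 2) : ‖x‖ ≤ √C.toReal * ‖y‖ := by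
  have h_real := ENNReal.toReal_mono (by finiteness) h
  simp only [ENNReal.toReal_pow, ENNReal.toReal_mul, toReal_enorm] at h_real
  refine Real.le_sqrt_of_sq_le h_real |>.trans_eq ?_
  rw [Real.sqrt_mul ENNReal.toReal_nonneg, Real.sqrt_sq (norm_nonneg y)]

lemma exists_norm_smoothTrace_le :
    ∃ C, ∀ φ : Smooth d, ‖smoothTrace Ω φ‖ ≤ C * ‖ofSmooth Ω φ‖ := by
  obtain ⟨C, hC, h⟩ := exists_lintegral_surface_le Ω
  refine ⟨√C.toReal, fun φ => norm_le_sqrt_mul_norm_of_enorm_sq_le hC ?_⟩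
  rw [enorm_ofSmooth_sq, enorm_sq_eq_lintegral]
  exact (lintegral_congr_ae ((smoothTrace_ae_eq Ω φ).fun_comp fun z => ‖z‖ₑ ^ 2)).trans_le
    (h φ (Smooth.contDiff_one φ))

lemma isTraceOp_iff {T : H1 Ω →L[ℂ] Lp ℂ 2 Ω.surface} :
    IsTraceOp Ω T ↔ T.toLinearMap ∘ₗ ofSmooth Ω = smoothTrace Ω := by
  refine ⟨fun h => LinearMap.ext fun φ => Lp.ext ?_, fun h φ hφ v hv => ?_⟩
  · exact (h φ (Smooth.contDiff φ) _ (val_ofSmooth φ)).trans (smoothTrace_ae_eq Ω φ).symm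
  · have h_smooth := LinearMap.congr_fun h (⟨φ, hφ⟩ : Smooth d)
    rw [LinearMap.comp_apply, ← eq_ofSmooth hv] at h_smooth
    change T v = smoothTrace Ω (⟨φ, hφ⟩ : Smooth d) at h_smooth
    rw [h_smooth]
    exact smoothTrace_ae_eq Ω ⟨φ, hφ⟩

theorem existsUnique_isTraceOp : ∃! T, IsTraceOp Ω T := by
  obtain ⟨C, hC⟩ := exists_norm_smoothTrace_le Ω
  refine ⟨(smoothTrace Ω).extendOfNorm (ofSmooth Ω), ?_, fun T hT => ?_⟩
  · exact (isTraceOp_iff Ω).2 <| LinearMap.ext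
      (LinearMap.extendOfNorm_eq (denseRange_ofSmooth Ω) ⟨C, hC⟩)
  · exact (LinearMap.extendOfNorm_unique (denseRange_ofSmooth Ω) C hC T
      ((isTraceOp_iff Ω).1 hT)).symm

lemma isTraceOp_trace : IsTraceOp Ω (trace Ω) := by
  have h_exists : ∃ T, IsTraceOp Ω T := (existsUnique_isTraceOp Ω).exists
  rw [trace, dif_pos h_exists]
  exact h_exists.choose_spec

lemma trace_one : trace Ω (H1.one Ω) =ᵐ[Ω.surface] fun _ => 1 :=
  isTraceOp_trace Ω (fun _ => 1) contDiff_const _ (Lp.coeFn_const (p := 2) (μ := Ω.vol) (1 : ℂ))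

end Trace

lemma surface_pos_of_isOpen (Ω : LipschitzDomain d) {V : Set (RSpace d)} (hV : IsOpen V)
    (hne : (V ∩ frontier Ω.carrier).Nonempty) : 0 < Ω.surface V := by
  obtain ⟨p, hpV, hp⟩ := hne
  obtain ⟨R, hR, e, he, γ, K, hγ, h⟩ := exists_chart Ω hp
  have h_frontier {x : RSpace d} (hx : x ∈ Metric.ball p R) :=
    mem_frontier_iff_of_eq_strictEpigraph Ω.isOpen Metric.isOpen_ball he hγ.continuous h hx
  have hpR : p ∈ Metric.ball p R := Metric.mem_ball_self hR
  have h_graph := graphMap_orthogonalProjectionOnto he ((h_frontier hpR).1 hp)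
  have h_open : IsOpen (graphMap e γ ⁻¹' (Metric.ball p R ∩ V)) :=
    (Metric.isOpen_ball.inter hV).preimage (lipschitzWith_graphMap he hγ).continuous
  have h_nonempty : (graphMap e γ ⁻¹' (Metric.ball p R ∩ V)).Nonempty :=
    ⟨_, by rw [mem_preimage, h_graph]; exact ⟨hpR, hpV⟩⟩
  have h_image := volume_le_euclideanHausdorffMeasure_image_graphMap (γ := γ) he
    (graphMap e γ ⁻¹' (Metric.ball p R ∩ V))
  rw [finrank_euclideanSpace_fin] at h_image
  rw [LipschitzDomain.surface, Measure.restrict_apply hV.measurableSet]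
  refine (h_open.measure_pos volume h_nonempty).trans_le (h_image.trans (measure_mono ?_))
  rintro _ ⟨y, ⟨hyR, hyV⟩, rfl⟩
  refine ⟨hyV, (h_frontier hyR).2 ?_⟩
  rw [orthogonalProjectionOnto_graphMap]
  simpa using inner_graphMap_add (γ := γ) he y 0

/-! ### The Poincaré inequality -/

section Translation

variable {G : Type*} [AddGroup G] [MeasurableSpace G] {μ : Measure G}

lemma setLIntegral_comp_add_right_le [MeasurableAdd G] [μ.IsAddRightInvariant] (f : G → ℝ≥0∞)
    {s t : Set G} {h : G} (hst : ∀ x ∈ s, x + h ∈ t) :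
    ∫⁻ x in s, f (x + h) ∂μ ≤ ∫⁻ x in t, f x ∂μ :=
  (lintegral_mono_set hst).trans_eq <|
    (measurePreserving_add_right μ h).setLIntegral_comp_preimage_emb
      (measurableEmbedding_addRight h) f t

lemma setLIntegral_setLIntegral_eq_lintegral_add [MeasurableAdd₂ G] [μ.IsAddLeftInvariant]
    [SFinite μ] {f : G × G → ℝ≥0∞} (hf : Measurable f) (s : Set G) {t : Set G}
    (ht : MeasurableSet t) : ∫⁻ x in s, ∫⁻ y in t, f (x, y) ∂μ ∂μ =
      ∫⁻ z, ∫⁻ x in (· + z) ⁻¹' t ∩ s, f (x, x + z) ∂μ ∂μ := by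
  have h_add : Measurable fun q : G × G => q.1 + q.2 := measurable_fst.add measurable_snd
  calc ∫⁻ x in s, ∫⁻ y in t, f (x, y) ∂μ ∂μ
      = ∫⁻ x in s, ∫⁻ z, t.indicator (fun y => f (x, y)) (x + z) ∂μ ∂μ := by
        refine lintegral_congr fun x => ?_
        rw [lintegral_add_left_eq_self, lintegral_indicator ht]
    _ = ∫⁻ z, ∫⁻ x in s, t.indicator (fun y => f (x, y)) (x + z) ∂μ ∂μ := by
        refine lintegral_lintegral_swap (Measurable.aemeasurable ?_)
        exact (hf.comp (measurable_fst.prodMk h_add)).indicator (h_add ht)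
    _ = _ := by
        refine lintegral_congr fun z => ?_
        rw [← Measure.restrict_restrict (measurable_add_const z ht),
          ← lintegral_indicator (measurable_add_const z ht)]
        rfl

end Translation

lemma enorm_sub_average_sq_le {α E : Type*} {mα : MeasurableSpace α} {μ : Measure α}
    [IsFiniteMeasure μ] [NeZero μ] [NormedAddCommGroup E] [NormedSpace ℝ E] [CompleteSpace E]
    {f : α → E} (hf : Integrable f μ) (a : E) :
    ‖a - ⨍ x, f x ∂μ‖ₑ ^ 2 ≤ ⨍⁻ x, ‖f x - a‖ₑ ^ 2 ∂μ := by
  set ν := (μ univ)⁻¹ • μ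
  have h_meas : AEMeasurable (fun x => ‖f x - a‖ₑ) ν :=
    (hf.to_average.aestronglyMeasurable.sub aestronglyMeasurable_const).enorm
  have h_average : ⨍ x, f x ∂μ - a = ∫ x, (f x - a) ∂ν := by
    rw [integral_sub hf.to_average (integrable_const a), integral_const, probReal_univ, one_smul]
    rfl
  rw [← enorm_neg, neg_sub, h_average]
  calc ‖∫ x, (f x - a) ∂ν‖ₑ ^ 2
      ≤ (∫⁻ x, ‖f x - a‖ₑ ∂ν) ^ 2 := pow_le_pow_left' (enorm_integral_le_lintegral_enorm _) 2
    _ ≤ ν univ * ∫⁻ x, ‖f x - a‖ₑ ^ 2 ∂ν := sq_lintegral_le ν h_meas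
    _ = ⨍⁻ x, ‖f x - a‖ₑ ^ 2 ∂μ := by rw [measure_univ, one_mul]; rfl

lemma lintegral_enorm_add_sub_sq_le (Ω : LipschitzDomain d) {φ : RSpace d → ℂ}
    (hφ : ContDiff ℝ 1 φ) {s : Set (RSpace d)} {h : RSpace d}
    (hs : ∀ x ∈ s, ∀ t ∈ Ioc (0 : ℝ) 1, x + t • h ∈ Ω.carrier) :
    ∫⁻ x in s, ‖φ (x + h) - φ x‖ₑ ^ 2 ≤ ‖h‖ₑ ^ 2 * ∫⁻ x, ‖classicalGrad φ x‖ₑ ^ 2 ∂Ω.vol := by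
  set f : RSpace d → ℝ≥0∞ := fun x => ‖classicalGrad φ x‖ₑ ^ 2
  have h_meas : Measurable fun q : RSpace d × ℝ => f (q.1 + q.2 • h) :=
    ((continuous_classicalGrad hφ).measurable.enorm.pow_const 2).comp
      (Continuous.measurable (by fun_prop))
  calc ∫⁻ x in s, ‖φ (x + h) - φ x‖ₑ ^ 2
      ≤ ∫⁻ x in s, ‖h‖ₑ ^ 2 * ∫⁻ t in Ioc (0 : ℝ) 1, f (x + t • h) := by
        refine lintegral_mono fun x => ?_
        simpa only [one_smul, ENNReal.ofReal_one, one_mul] using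
          enorm_sub_sq_le_lintegral_classicalGrad hφ x h zero_le_one
    _ = ‖h‖ₑ ^ 2 * ∫⁻ t in Ioc (0 : ℝ) 1, ∫⁻ x in s, f (x + t • h) := by
        rw [lintegral_const_mul _ h_meas.lintegral_prod_right', lintegral_lintegral_swap
          h_meas.aemeasurable]
    _ ≤ ‖h‖ₑ ^ 2 * ∫⁻ _ in Ioc (0 : ℝ) 1, ∫⁻ x, f x ∂Ω.vol := by
        gcongr ‖h‖ₑ ^ 2 * ?_
        exact setLIntegral_mono' measurableSet_Ioc fun t ht =>
          setLIntegral_comp_add_right_le f fun x hx => hs x hx t ht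
    _ = _ := by
        rw [setLIntegral_const, Real.volume_Ioc, sub_zero, ENNReal.ofReal_one, mul_one]

lemma lintegral_lintegral_enorm_sub_sq_le (Ω : LipschitzDomain d) {φ : RSpace d → ℂ}
    (hφ : ContDiff ℝ 1 φ) {s : Set (RSpace d)} (h_convex : Convex ℝ s) (hs : MeasurableSet s)
    (hsΩ : s ⊆ Ω.carrier) : ∫⁻ x in s, ∫⁻ y in s, ‖φ y - φ x‖ₑ ^ 2 ≤
      ENNReal.ofReal (Metric.diam s) ^ 2 * volume (Metric.closedBall (0 : RSpace d) (Metric.diam s))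
        * ∫⁻ x, ‖classicalGrad φ x‖ₑ ^ 2 ∂Ω.vol := by
  set D := ∫⁻ x, ‖classicalGrad φ x‖ₑ ^ 2 ∂Ω.vol
  set Z := Metric.closedBall (0 : RSpace d) (Metric.diam s)
  have h_meas : Measurable fun q : RSpace d × RSpace d => ‖φ q.2 - φ q.1‖ₑ ^ 2 :=
    ((hφ.continuous.comp continuous_snd).sub
      (hφ.continuous.comp continuous_fst)).measurable.enorm.pow_const 2
  have h_slice (z : RSpace d) : ∫⁻ x in (· + z) ⁻¹' s ∩ s, ‖φ (x + z) - φ x‖ₑ ^ 2 ≤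
      Z.indicator (fun _ => ENNReal.ofReal (Metric.diam s) ^ 2 * D) z := by
    by_cases hz : z ∈ Z
    · rw [indicator_of_mem hz]
      refine (lintegral_enorm_add_sub_sq_le Ω hφ ?_).trans ?_
      · rintro x ⟨hxz, hx⟩ t ht
        exact hsΩ (h_convex.add_smul_mem hx hxz ⟨ht.1.le, ht.2⟩)
      · gcongr
        rw [← ofReal_norm]
        exact ENNReal.ofReal_le_ofReal (mem_closedBall_zero_iff.1 hz)
    · suffices h_empty : (· + z) ⁻¹' s ∩ s = ∅ by simp [h_empty]
      refine eq_empty_of_forall_notMem fun x ⟨hxz, hx⟩ => hz ?_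
      simpa only [Z, mem_closedBall_zero_iff, dist_eq_norm, add_sub_cancel_left] using
        Metric.dist_le_diam_of_mem (Ω.isBounded.subset hsΩ) hxz hx
  calc ∫⁻ x in s, ∫⁻ y in s, ‖φ y - φ x‖ₑ ^ 2
      = ∫⁻ z, ∫⁻ x in (· + z) ⁻¹' s ∩ s, ‖φ (x + z) - φ x‖ₑ ^ 2 :=
        setLIntegral_setLIntegral_eq_lintegral_add h_meas s hs
    _ ≤ ∫⁻ z, Z.indicator (fun _ => ENNReal.ofReal (Metric.diam s) ^ 2 * D) z :=
        lintegral_mono h_slice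
    _ = _ := by
        rw [lintegral_indicator Metric.isClosed_closedBall.measurableSet, setLIntegral_const]
        ring

/-- On `s`, continuously differentiable functions `φ` differ in `L²` from the constants `c φ` by at
most a fixed multiple of the `L²` norm of their gradient on `Ω`. -/
def PoincareOn (Ω : LipschitzDomain d) (c : (RSpace d → ℂ) → ℂ) (s : Set (RSpace d)) : Prop :=
  ∃ C : ℝ≥0∞, C ≠ ⊤ ∧ ∀ φ : RSpace d → ℂ, ContDiff ℝ 1 φ →
    ∫⁻ x in s, ‖φ x - c φ‖ₑ ^ 2 ≤ C * ∫⁻ x, ‖classicalGrad φ x‖ₑ ^ 2 ∂Ω.vol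

namespace PoincareOn

variable {Ω : LipschitzDomain d} {c : (RSpace d → ℂ) → ℂ} {s t : Set (RSpace d)}

lemma empty : PoincareOn Ω c ∅ := ⟨0, ENNReal.zero_ne_top, fun φ _ => by simp⟩

lemma mono (h : PoincareOn Ω c t) (hst : s ⊆ t) : PoincareOn Ω c s := by
  obtain ⟨C, hC, h⟩ := h
  exact ⟨C, hC, fun φ hφ => (lintegral_mono_set hst).trans (h φ hφ)⟩

lemma union (hs : PoincareOn Ω c s) (ht : PoincareOn Ω c t) : PoincareOn Ω c (s ∪ t) := by
  obtain ⟨C, hC, h⟩ := hs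
  obtain ⟨C', hC', h'⟩ := ht
  refine ⟨C + C', ENNReal.add_ne_top.2 ⟨hC, hC'⟩, fun φ hφ => ?_⟩
  rw [add_mul]
  exact (lintegral_union_le _ _ _).trans (add_le_add (h φ hφ) (h' φ hφ))

lemma of_translate (ht : PoincareOn Ω c t) {h : RSpace d} (hst : ∀ x ∈ s, x + h ∈ t)
    (hsΩ : ∀ x ∈ s, ∀ τ ∈ Ioc (0 : ℝ) 1, x + τ • h ∈ Ω.carrier) : PoincareOn Ω c s := by
  obtain ⟨C, hC, h_le⟩ := ht
  refine ⟨2 * C + 2 * ‖h‖ₑ ^ 2, by finiteness, fun φ hφ => ?_⟩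
  set D := ∫⁻ x, ‖classicalGrad φ x‖ₑ ^ 2 ∂Ω.vol
  have h_shift : Measurable fun x => φ (x + h) :=
    hφ.continuous.measurable.comp (measurable_add_const h)
  have h_meas : Measurable fun x => ‖φ (x + h) - c φ‖ₑ ^ 2 :=
    (h_shift.sub_const _).enorm.pow_const 2
  have h_meas_sub : Measurable fun x => ‖φ (x + h) - φ x‖ₑ ^ 2 :=
    (h_shift.sub hφ.continuous.measurable).enorm.pow_const 2
  calc ∫⁻ x in s, ‖φ x - c φ‖ₑ ^ 2
      ≤ ∫⁻ x in s, (2 * ‖φ (x + h) - c φ‖ₑ ^ 2 + 2 * ‖φ (x + h) - φ x‖ₑ ^ 2) := by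
        refine lintegral_mono fun x => ?_
        have h_add := enorm_add_sq_le (φ (x + h) - c φ) (-(φ (x + h) - φ x))
        rwa [enorm_neg, neg_sub, sub_add_sub_comm, add_comm (φ (x + h)), add_sub_add_right_eq_sub]
          at h_add
    _ = 2 * (∫⁻ x in s, ‖φ (x + h) - c φ‖ₑ ^ 2) + 2 * ∫⁻ x in s, ‖φ (x + h) - φ x‖ₑ ^ 2 := by
        rw [lintegral_add_left (h_meas.const_mul 2), lintegral_const_mul _ h_meas,
          lintegral_const_mul _ h_meas_sub]
    _ ≤ 2 * (C * D) + 2 * (‖h‖ₑ ^ 2 * D) := by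
        gcongr
        · exact (setLIntegral_comp_add_right_le (fun x => ‖φ x - c φ‖ₑ ^ 2) hst).trans (h_le φ hφ)
        · exact lintegral_enorm_add_sub_sq_le Ω hφ hsΩ
    _ = _ := by ring

lemma setAverage (h_convex : Convex ℝ s) (hs : MeasurableSet s) (hs₀ : volume s ≠ 0)
    (hsΩ : s ⊆ Ω.carrier) : PoincareOn Ω (fun φ => ⨍ y in s, φ y) s := by
  have h_bounded := Ω.isBounded.subset hsΩ
  have h_top : volume s ≠ ⊤ := h_bounded.measure_lt_top.ne
  have h_top_diam : volume (Metric.closedBall (0 : RSpace d) (Metric.diam s)) ≠ ⊤ :=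
    measure_closedBall_lt_top.ne
  have : Fact (volume s < ⊤) := ⟨h_top.lt_top⟩
  have : NeZero (volume.restrict s) := ⟨mt Measure.restrict_eq_zero.1 hs₀⟩
  refine ⟨(volume s)⁻¹ * (ENNReal.ofReal (Metric.diam s) ^ 2 *
    volume (Metric.closedBall (0 : RSpace d) (Metric.diam s))), by finiteness, fun φ hφ => ?_⟩
  have h_int : IntegrableOn φ s := (hφ.continuous.locallyIntegrable.integrableOn_isCompact
    h_bounded.isCompact_closure).mono_set subset_closure
  calc ∫⁻ x in s, ‖φ x - ⨍ y in s, φ y‖ₑ ^ 2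
      ≤ ∫⁻ x in s, (volume s)⁻¹ * ∫⁻ y in s, ‖φ y - φ x‖ₑ ^ 2 := by
        refine lintegral_mono fun x => (enorm_sub_average_sq_le h_int (φ x)).trans_eq ?_
        rw [setLAverage_eq, mul_comm, div_eq_mul_inv]
    _ = (volume s)⁻¹ * ∫⁻ x in s, ∫⁻ y in s, ‖φ y - φ x‖ₑ ^ 2 :=
        lintegral_const_mul' _ _ (ENNReal.inv_ne_top.2 hs₀)
    _ ≤ _ := by
        rw [mul_assoc]
        gcongr
        exact lintegral_lintegral_enorm_sub_sq_le Ω hφ h_convex hs hsΩ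

lemma exists_ball_of_mem_closure {x : RSpace d} (hx : x ∈ Ω.carrier)
    (h : x ∈ closure {y | ∃ r > 0, PoincareOn Ω c (Metric.ball y r)}) :
    ∃ r > 0, PoincareOn Ω c (Metric.ball x r) := by
  obtain ⟨ρ, hρ, hρΩ⟩ := Metric.isOpen_iff.1 Ω.isOpen x hx
  obtain ⟨z, ⟨r, hr, hz⟩, hxz⟩ := Metric.mem_closure_iff.1 h (ρ / 2) (half_pos hρ)
  refine ⟨min r (ρ / 2), lt_min hr (half_pos hρ), hz.of_translate (h := z - x) ?_ ?_⟩
  · intro w hw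
    rw [Metric.mem_ball, dist_eq_norm] at hw ⊢
    rw [add_sub_assoc, sub_sub_cancel_left, ← sub_eq_add_neg]
    exact hw.trans_le (min_le_left _ _)
  · intro w hw t ht
    apply hρΩ
    rw [Metric.mem_ball, dist_eq_norm] at hw ⊢
    rw [dist_comm, dist_eq_norm] at hxz
    calc ‖w + t • (z - x) - x‖ = ‖(w - x) + t • (z - x)‖ := by rw [add_sub_right_comm]
      _ ≤ ‖w - x‖ + ‖t • (z - x)‖ := norm_add_le _ _
      _ ≤ ‖w - x‖ + ‖z - x‖ := by
        gcongr
        rw [norm_smul, Real.norm_of_nonneg ht.1.le]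
        exact mul_le_of_le_one_left (norm_nonneg _) ht.2
      _ < ρ := by linarith [hw.trans_le (min_le_right r (ρ / 2))]

lemma exists_ball {x₀ : RSpace d} (hx₀ : x₀ ∈ Ω.carrier) {R : ℝ} (hR : 0 < R)
    (h₀ : PoincareOn Ω c (Metric.ball x₀ R)) {x : RSpace d} (hx : x ∈ Ω.carrier) :
    ∃ r > 0, PoincareOn Ω c (Metric.ball x r) := by
  have h_open : IsOpen {y | ∃ r > 0, PoincareOn Ω c (Metric.ball y r)} := by
    rw [Metric.isOpen_iff]
    rintro y ⟨r, hr, h⟩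
    refine ⟨r, hr, fun z hz => ⟨r - dist z y, sub_pos.2 hz, h.mono ?_⟩⟩
    exact Metric.ball_subset_ball' (sub_add_cancel _ _).le
  exact Ω.isConnected.isPreconnected.subset_of_closure_inter_subset h_open ⟨x₀, hx₀, R, hR, h₀⟩
    (fun y ⟨hy, hyΩ⟩ => exists_ball_of_mem_closure hyΩ hy) hx

lemma of_isCompact (h : ∀ x ∈ Ω.carrier, ∃ r > 0, PoincareOn Ω c (Metric.ball x r))
    {K : Set (RSpace d)} (hK : IsCompact K) (hKΩ : K ⊆ Ω.carrier) : PoincareOn Ω c K := by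
  refine hK.induction_on empty (fun _ _ hst ht => ht.mono hst) (fun _ _ hs ht => hs.union ht) ?_
  intro x hx
  obtain ⟨r, hr, h_ball⟩ := h x (hKΩ hx)
  exact ⟨_, mem_nhdsWithin_of_mem_nhds (Metric.ball_mem_nhds x hr), h_ball⟩

-- Translation along the cone axis moves the set into a compact subset of `Ω`.
lemma of_hasInteriorCone (h : ∀ x ∈ Ω.carrier, ∃ r > 0, PoincareOn Ω c (Metric.ball x r))
    {U : Set (RSpace d)} {e : RSpace d} {δ ε₀ : ℝ} (hδ : 0 < δ) (hε₀ : 0 < ε₀)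
    (h_cone : HasInteriorCone Ω.carrier U e δ ε₀) : PoincareOn Ω c (Ω.carrier ∩ U) := by
  set K := (Metric.thickening (ε₀ * δ) Ω.carrierᶜ)ᶜ
  have hKΩ : K ⊆ Ω.carrier :=
    compl_subset_comm.1 (Metric.self_subset_thickening (mul_pos hε₀ hδ) _)
  have hK_compact : IsCompact K :=
    Metric.isCompact_of_isClosed_isBounded Metric.isOpen_thickening.isClosed_compl
      (Ω.isBounded.subset hKΩ)
  refine (of_isCompact h hK_compact hKΩ).of_translate (h := ε₀ • e) ?_ ?_
  · intro x hx h_mem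
    obtain ⟨y, hy, h_dist⟩ := Metric.mem_thickening_iff.1 h_mem
    exact hy (h_cone x hx ε₀ ⟨hε₀, le_rfl⟩ (Metric.mem_closedBall'.2 h_dist.le))
  · intro x hx t ht
    rw [smul_smul]
    exact h_cone x hx (t * ε₀) ⟨mul_pos ht.1 hε₀, mul_le_of_le_one_left hε₀.le ht.2⟩
      (Metric.mem_closedBall_self (mul_nonneg (mul_nonneg ht.1.le hε₀.le) hδ.le))

lemma of_forall_ball (h : ∀ x ∈ Ω.carrier, ∃ r > 0, PoincareOn Ω c (Metric.ball x r)) :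
    PoincareOn Ω c Ω.carrier := by
  suffices h_closure : PoincareOn Ω c (Ω.carrier ∩ closure Ω.carrier) by
    rwa [inter_eq_left.2 subset_closure] at h_closure
  refine Ω.isBounded.isCompact_closure.induction_on
    (p := fun s => PoincareOn Ω c (Ω.carrier ∩ s)) ?_ ?_ ?_ ?_
  · rw [inter_empty]
    exact empty
  · exact fun s t hst ht => ht.mono (inter_subset_inter_right _ hst)
  · intro s t hs ht
    rw [inter_union_distrib_left]
    exact hs.union ht
  · intro p hp
    obtain ⟨r, hr, e, δ, hδ, ε₀, hε₀, h_cone⟩ := exists_hasInteriorCone Ω hp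
    exact ⟨_, mem_nhdsWithin_of_mem_nhds (Metric.ball_mem_nhds p hr),
      of_hasInteriorCone h hδ hε₀ h_cone⟩

end PoincareOn

theorem exists_poincareOn (Ω : LipschitzDomain d) : ∃ c, PoincareOn Ω c Ω.carrier := by
  obtain ⟨x₀, hx₀⟩ := Ω.isConnected.nonempty
  obtain ⟨R, hR, hRΩ⟩ := Metric.isOpen_iff.1 Ω.isOpen x₀ hx₀
  have h_ball := PoincareOn.setAverage (convex_ball x₀ R) Metric.isOpen_ball.measurableSet
    (Metric.measure_ball_pos volume x₀ hR).ne' hRΩ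
  exact ⟨_, PoincareOn.of_forall_ball fun x hx => PoincareOn.exists_ball hx₀ hR h_ball hx⟩

theorem exists_norm_val_sub_const_le (Ω : LipschitzDomain d) :
    ∃ C : ℝ, ∀ φ : Smooth d, ∃ c : ℂ,
      ‖H1.val (ofSmooth Ω φ - c • H1.one Ω)‖ ≤ C * ‖H1.grad (ofSmooth Ω φ)‖ := by
  obtain ⟨c, C, hC, h⟩ := exists_poincareOn Ω
  refine ⟨√C.toReal, fun φ => ⟨c φ, norm_le_sqrt_mul_norm_of_enorm_sq_le hC ?_⟩⟩
  have h_val : H1.val (ofSmooth Ω φ - c φ • H1.one Ω) =ᵐ[Ω.vol]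
      fun x => (φ : RSpace d → ℂ) x - c φ := by
    rw [← ofSmooth_one, ← map_smul, ← map_sub]
    filter_upwards [val_ofSmooth (Ω := Ω) (φ - c φ • Smooth.one d)] with x hx
    rw [hx]
    simp [Smooth.one]
  have h_grad := grad_ofSmooth (Ω := Ω) φ
  rw [enorm_sq_eq_lintegral, enorm_sq_eq_lintegral]
  calc ∫⁻ x, ‖H1.val (ofSmooth Ω φ - c φ • H1.one Ω) x‖ₑ ^ 2 ∂Ω.vol
      = ∫⁻ x in Ω.carrier, ‖(φ : RSpace d → ℂ) x - c φ‖ₑ ^ 2 :=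
        lintegral_congr_ae (h_val.fun_comp fun z => ‖z‖ₑ ^ 2)
    _ ≤ C * ∫⁻ x, ‖classicalGrad φ x‖ₑ ^ 2 ∂Ω.vol := h φ (Smooth.contDiff_one φ)
    _ = C * ∫⁻ x, ‖H1.grad (ofSmooth Ω φ) x‖ₑ ^ 2 ∂Ω.vol :=
        congrArg (C * ·) (lintegral_congr_ae (h_grad.fun_comp fun z => ‖z‖ₑ ^ 2)).symm

/-! ### The energy norm on `𝓗` -/

lemma L2_norm_sq_eq_integral {α F : Type*} {mα : MeasurableSpace α} {μ : Measure α}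
    [NormedAddCommGroup F] (f : Lp F 2 μ) : ‖f‖ ^ 2 = ∫ x, ‖f x‖ ^ 2 ∂μ := by
  have hmeas : AEStronglyMeasurable (fun x => ‖f x‖ ^ 2) μ := (Lp.aestronglyMeasurable f).norm.pow 2
  rw [← toReal_enorm, ← ENNReal.toReal_pow, enorm_sq_eq_lintegral,
    integral_eq_lintegral_of_nonneg_ae (ae_of_all _ fun x => by positivity) hmeas]
  congr 1
  refine lintegral_congr fun x => ?_
  rw [ENNReal.ofReal_pow (norm_nonneg _), ofReal_norm]

/-- The pair `(1, 𝟏)`, which spans the kernel of the projection of `H¹(Ω) ⊕ ℂ^m` onto `𝓗`. -/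
def onePair (Ω : LipschitzDomain d) (m : ℕ) : Pair Ω m := WithLp.toLp 2 (H1.one Ω, allOnes m)

lemma toH_sub_smul_onePair {Ω : LipschitzDomain d} {m : ℕ} (w : Pair Ω m) (c : ℂ) :
    toH (w - c • onePair Ω m) = toH w :=
  (Submodule.Quotient.eq _).2 <| by
    rw [sub_sub_cancel_left]
    exact neg_mem (Submodule.mem_span_singleton.2 ⟨c, rfl⟩)

/-- The bounded linear section of the projection onto `𝓗` that picks the representative with mean
free second component. -/
def sectionL (Ω : LipschitzDomain d) (m : ℕ) [NeZero m] : HSpace Ω m →L[ℂ] Pair Ω m :=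
  (WithLp.prodContinuousLinearEquiv 2 ℂ (H1 Ω) (CSpace m)).symm.toContinuousLinearMap.comp
    ((T1 Ω m).prod ((CDiamond m).subtypeL.comp (T2 Ω m)))

lemma sectionL_toH {Ω : LipschitzDomain d} {m : ℕ} [NeZero m] (w : Pair Ω m) :
    sectionL Ω m (toH w) = w - mean m w.snd • onePair Ω m := rfl

lemma toH_sectionL {Ω : LipschitzDomain d} {m : ℕ} [NeZero m] (x : HSpace Ω m) :
    toH (sectionL Ω m x) = x := by
  obtain ⟨w, rfl⟩ := Submodule.Quotient.mk_surjective _ x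
  exact toH_sub_smul_onePair w _

/-- Multiplication of `L²` vector fields by matrix coefficients. -/
def mulMat (Ω : LipschitzDomain d) :
    LInf Ω →L[ℂ] Lp (CSpace d) 2 Ω.vol →L[ℂ] Lp (CSpace d) 2 Ω.vol :=
  (ContinuousLinearMap.id ℂ (CMat d)).holderL Ω.vol ∞ 2 2

section mulMat

variable {Ω : LipschitzDomain d}

lemma mulMat_ae_eq (A : LInf Ω) (u : Lp (CSpace d) 2 Ω.vol) :
    mulMat Ω A u =ᵐ[Ω.vol] fun x => A x (u x) :=
  (ContinuousLinearMap.id ℂ (CMat d)).coeFn_holder (r := 2) A u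

lemma norm_mulMat_le (A : LInf Ω) (u : Lp (CSpace d) 2 Ω.vol) : ‖mulMat Ω A u‖ ≤ ‖A‖ * ‖u‖ := by
  refine ((ContinuousLinearMap.id ℂ (CMat d)).norm_holder_apply_apply_le (r := 2) A u).trans ?_
  gcongr
  exact mul_le_of_le_one_left (norm_nonneg _) ContinuousLinearMap.norm_id_le

lemma gradForm_eq_inner (A : LInf Ω) (w v : H1 Ω) :
    gradForm A w v = inner ℂ (H1.grad v) (mulMat Ω A (H1.grad w)) := by
  rw [L2.inner_def, gradForm]
  refine integral_congr_ae ?_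
  filter_upwards [mulMat_ae_eq A (H1.grad w)] with x hx
  rw [hx]

end mulMat

/-- The gradient as an operator on `𝓗`. -/
def gradH (Ω : LipschitzDomain d) (m : ℕ) [NeZero m] : HSpace Ω m →L[ℂ] Lp (CSpace d) 2 Ω.vol :=
  (H1.gradL Ω).comp (T1 Ω m)

lemma gradH_toH {Ω : LipschitzDomain d} {m : ℕ} [NeZero m] (w : Pair Ω m) :
    gradH Ω m (toH w) = H1.grad w.fst := by
  change H1.gradL Ω (w.fst - mean m w.snd • H1.one Ω) = _
  rw [map_sub, map_smul, H1.gradL_apply, H1.gradL_apply, H1.grad_one, smul_zero, sub_zero]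

lemma exists_norm_sub_const_le (Ω : LipschitzDomain d) : ∃ C : ℝ, 0 ≤ C ∧ ∀ φ : Smooth d, ∃ c : ℂ,
    ‖ofSmooth Ω φ - c • H1.one Ω‖ ≤ C * ‖H1.grad (ofSmooth Ω φ)‖ := by
  obtain ⟨C, hC⟩ := exists_norm_val_sub_const_le Ω
  refine ⟨|C| + 1, by positivity, fun φ => ?_⟩
  obtain ⟨c, hc⟩ := hC φ
  refine ⟨c, ?_⟩
  have hgrad : H1.grad (ofSmooth Ω φ - c • H1.one Ω) = H1.grad (ofSmooth Ω φ) := by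
    rw [← H1.gradL_apply, map_sub, map_smul, H1.gradL_apply, H1.gradL_apply, H1.grad_one,
      smul_zero, sub_zero]
  calc ‖ofSmooth Ω φ - c • H1.one Ω‖
      ≤ ‖H1.val (ofSmooth Ω φ - c • H1.one Ω)‖ + ‖H1.grad (ofSmooth Ω φ)‖ := by
        refine le_of_sq_le_sq ?_ (by positivity)
        rw [H1.norm_sq, hgrad]
        nlinarith [norm_nonneg (H1.val (ofSmooth Ω φ - c • H1.one Ω)),
          norm_nonneg (H1.grad (ofSmooth Ω φ))]
    _ ≤ |C| * ‖H1.grad (ofSmooth Ω φ)‖ + ‖H1.grad (ofSmooth Ω φ)‖ := by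
        gcongr
        exact hc.trans (by gcongr; exact le_abs_self C)
    _ = (|C| + 1) * ‖H1.grad (ofSmooth Ω φ)‖ := by ring

lemma denseRange_toLp_ofSmooth (Ω : LipschitzDomain d) (m : ℕ) :
    DenseRange fun q : Smooth d × CSpace m =>
      (WithLp.toLp 2 (ofSmooth Ω q.1, q.2) : Pair Ω m) :=
  let e := (WithLp.prodContinuousLinearEquiv 2 ℂ (H1 Ω) (CSpace m)).symm
  e.surjective.denseRange.comp ((denseRange_ofSmooth Ω).prodMap denseRange_id) e.continuous

namespace ElectrodeModel

variable {Ω : LipschitzDomain d} {m : ℕ} (M : ElectrodeModel Ω m)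

lemma measurableSet_E (j : Fin m) : MeasurableSet (M.E j) := by
  obtain ⟨U, hU, h⟩ := M.E_relOpen j
  exact h ▸ hU.measurableSet.inter isClosed_frontier.measurableSet

lemma measurableSet_core (j : Fin m) : MeasurableSet (M.core j) := by
  obtain ⟨U, hU, h⟩ := M.core_relOpen j
  exact h ▸ hU.measurableSet.inter isClosed_frontier.measurableSet

lemma measurableSet_iUnion_core : MeasurableSet (⋃ j, M.core j) :=
  MeasurableSet.iUnion M.measurableSet_core

lemma surface_core_pos (j : Fin m) : 0 < Ω.surface (M.core j) := by
  obtain ⟨U, hU, h⟩ := M.core_relOpen j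
  have hpos := surface_pos_of_isOpen Ω hU (h ▸ M.core_nonempty j)
  rw [LipschitzDomain.surface, Measure.restrict_apply hU.measurableSet, ← h] at hpos
  rwa [LipschitzDomain.surface, Measure.restrict_eq_self _ (h.trans_subset inter_subset_right)]

lemma piecewise_of_mem (V : CSpace m) {j : Fin m} {x : RSpace d} (hx : x ∈ M.E j) :
    M.piecewise V x = V j := by
  rw [piecewise, Finset.sum_eq_single j, indicator_of_mem hx]
  · intro i _ hij
    refine indicator_of_notMem (fun hxi => ?_) _
    exact Set.disjoint_left.1 (M.E_disjoint i j hij) (subset_closure hxi) (subset_closure hx)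
  · simp

/-- `V ↦ ∑ V_j χ_{E_j}` as a bounded operator `ℂ^m → L²(∂Ω)`. -/
def piecewiseL : CSpace m →L[ℂ] Lp ℂ 2 Ω.surface :=
  ∑ j, (EuclideanSpace.proj (𝕜 := ℂ) j : CSpace m →L[ℂ] ℂ).smulRight
    (indicatorConstLp 2 (M.measurableSet_E j) (measure_ne_top Ω.surface _) (1 : ℂ))

lemma piecewiseL_ae_eq (V : CSpace m) : M.piecewiseL V =ᵐ[Ω.surface] M.piecewise V := by
  set χ : Fin m → Lp ℂ 2 Ω.surface := fun j =>
    indicatorConstLp 2 (M.measurableSet_E j) (measure_ne_top Ω.surface _) 1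
  have hsum : M.piecewiseL V = ∑ j, V j • χ j := by simp [piecewiseL, χ]
  have hsmul := ae_all_iff.2 fun j => Lp.coeFn_smul (V j) (χ j)
  have hχ := ae_all_iff.2 fun j : Fin m => indicatorConstLp_coeFn (p := 2) (c := (1 : ℂ))
    (hs := M.measurableSet_E j) (hμs := measure_ne_top Ω.surface _)
  rw [hsum]
  filter_upwards [hsmul, hχ, Lp.coeFn_finsetSum Finset.univ fun j => V j • χ j] with x h1 h2 h3
  rw [h3, Finset.sum_apply, piecewise]
  refine Finset.sum_congr rfl fun j _ => ?_
  rw [h1 j, Pi.smul_apply, h2 j]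
  by_cases hx : x ∈ M.E j <;> simp [hx]

/-- `(v, V) ↦ T̃v - V` as a bounded operator. -/
def jumpL : Pair Ω m →L[ℂ] Lp ℂ 2 Ω.surface :=
  (trace Ω).comp (WithLp.fstL 2 ℂ (H1 Ω) (CSpace m))
    - M.piecewiseL.comp (WithLp.sndL 2 ℂ (H1 Ω) (CSpace m))

lemma jumpL_apply (w : Pair Ω m) : M.jumpL w = trace Ω w.fst - M.piecewiseL w.snd := rfl

lemma jumpL_ae_eq (w : Pair Ω m) : M.jumpL w =ᵐ[Ω.surface] M.jump w := by
  rw [jumpL_apply]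
  filter_upwards [Lp.coeFn_sub (trace Ω w.fst) (M.piecewiseL w.snd), M.piecewiseL_ae_eq w.snd]
    with x h1 h2
  rw [h1, Pi.sub_apply, h2, jump]

lemma jumpL_onePair : ∀ᵐ x ∂Ω.surface, x ∈ (⋃ j, M.E j) → M.jumpL (onePair Ω m) x = 0 := by
  filter_upwards [M.jumpL_ae_eq (onePair Ω m), trace_one Ω] with x h1 h2 hx
  obtain ⟨j, hj⟩ := mem_iUnion.1 hx
  rw [h1, jump, M.piecewise_of_mem _ hj]
  change trace Ω (H1.one Ω) x - 1 = 0
  rw [h2, sub_self]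

/-- Multiplication by `ζ` on `L²(∂Ω)`. -/
def mulζ : Lp ℂ 2 Ω.surface →L[ℂ] Lp ℂ 2 Ω.surface :=
  (ContinuousLinearMap.mul ℂ ℂ).holderL Ω.surface ∞ 2 2 M.ζ

lemma mulζ_ae_eq (u : Lp ℂ 2 Ω.surface) : M.mulζ u =ᵐ[Ω.surface] fun x => M.ζ x * u x :=
  (ContinuousLinearMap.mul ℂ ℂ).coeFn_holder (r := 2) M.ζ u

lemma form_eq_inner (A : LInf Ω) (w v : Pair Ω m) : M.form A w v =
    inner ℂ (H1.grad v.fst) (mulMat Ω A (H1.grad w.fst))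
      + inner ℂ (M.jumpL v) (M.mulζ (M.jumpL w)) := by
  rw [form, gradForm_eq_inner, L2.inner_def]
  congr 1
  refine integral_congr_ae ?_
  filter_upwards [M.mulζ_ae_eq (M.jumpL w), M.jumpL_ae_eq w, M.jumpL_ae_eq v] with x h1 h2 h3
  rw [h1, h2, h3, RCLike.inner_apply]

lemma ζ_mul_jumpL_onePair : ∀ᵐ x ∂Ω.surface, M.ζ x * M.jumpL (onePair Ω m) x = 0 := by
  filter_upwards [M.jumpL_onePair, M.ζ_eq_zero] with x hjump hζ
  by_cases hx : x ∈ ⋃ j, M.E j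
  · rw [hjump hx, mul_zero]
  · rw [hζ hx, zero_mul]

lemma mulζ_jumpL_onePair : M.mulζ (M.jumpL (onePair Ω m)) = 0 := by
  refine Lp.ext ?_
  filter_upwards [M.mulζ_ae_eq (M.jumpL (onePair Ω m)), M.ζ_mul_jumpL_onePair,
    Lp.coeFn_zero ℂ 2 Ω.surface] with x h1 h2 h3
  rw [h1, h2, h3, Pi.zero_apply]

lemma inner_jumpL_onePair_mulζ (u : Lp ℂ 2 Ω.surface) :
    inner ℂ (M.jumpL (onePair Ω m)) (M.mulζ u) = 0 := by
  rw [L2.inner_def]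
  refine integral_eq_zero_of_ae ?_
  filter_upwards [M.mulζ_ae_eq u, M.ζ_mul_jumpL_onePair] with x h1 h2
  rw [h1, RCLike.inner_apply, Pi.zero_apply]
  rcases mul_eq_zero.1 h2 with h | h <;> simp [h]

/-- Restriction of functions on `∂Ω` to `𝓔`. -/
def restrictCore : Lp ℂ 2 Ω.surface →L[ℂ] Lp ℂ 2 (Ω.surface.restrict (⋃ j, M.core j)) :=
  LpToLpRestrictCLM (RSpace d) ℂ ℂ Ω.surface 2 (⋃ j, M.core j)

lemma restrictCore_ae_eq (u : Lp ℂ 2 Ω.surface) :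
    M.restrictCore u =ᵐ[Ω.surface.restrict (⋃ j, M.core j)] u :=
  LpToLpRestrictCLM_coeFn ℂ (⋃ j, M.core j) u

lemma restrictCore_jumpL_onePair : M.restrictCore (M.jumpL (onePair Ω m)) = 0 := by
  refine Lp.ext ?_
  filter_upwards [M.restrictCore_ae_eq (M.jumpL (onePair Ω m)), ae_restrict_of_ae M.jumpL_onePair,
    ae_restrict_mem M.measurableSet_iUnion_core, Lp.coeFn_zero ℂ 2 _] with x h1 h2 h3 h4
  rw [h1, h2 (iUnion_mono M.core_subset h3), h4, Pi.zero_apply]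

lemma restrictCore_piecewiseL_injective :
    Function.Injective (M.restrictCore.comp M.piecewiseL) := by
  refine (injective_iff_map_eq_zero _).2 fun V hV => ?_
  ext j
  have hcore : Ω.surface.restrict (M.core j) ≤ Ω.surface.restrict (⋃ i, M.core i) :=
    Measure.restrict_mono_set _ (subset_iUnion _ j)
  have hzero : ∀ᵐ x ∂Ω.surface.restrict (⋃ i, M.core i), M.piecewise V x = 0 := by
    filter_upwards [M.restrictCore_ae_eq (M.piecewiseL V),
      ae_restrict_of_ae (M.piecewiseL_ae_eq V), Lp.coeFn_zero ℂ 2 _,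
      (Lp.ext_iff.1 hV : M.restrictCore (M.piecewiseL V) =ᵐ[_] _)] with x h1 h2 h3 h4
    rw [← h2, ← h1, h4, h3, Pi.zero_apply]
  have : (ae (Ω.surface.restrict (M.core j))).NeBot := by
    rw [ae_neBot, Ne, Measure.restrict_eq_zero]
    exact (M.surface_core_pos j).ne'
  obtain ⟨x, hx, hxj⟩ := ((hzero.filter_mono (ae_mono hcore)).and
    (ae_restrict_mem (M.measurableSet_core j))).exists
  rw [← M.piecewise_of_mem V (M.core_subset j hxj), hx, PiLp.zero_apply]

variable [NeZero m]

/-- The jump `T̃v - V` of the representative with mean free second component. -/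
def jumpH : HSpace Ω m →L[ℂ] Lp ℂ 2 Ω.surface := M.jumpL.comp (sectionL Ω m)

lemma jumpH_toH (w : Pair Ω m) :
    M.jumpH (toH w) = M.jumpL w - mean m w.snd • M.jumpL (onePair Ω m) := by
  rw [jumpH, ContinuousLinearMap.comp_apply, sectionL_toH, map_sub, map_smul]

lemma form_eq_inner_toH (A : LInf Ω) (w v : Pair Ω m) : M.form A w v =
    inner ℂ (gradH Ω m (toH v)) (mulMat Ω A (gradH Ω m (toH w)))
      + inner ℂ (M.jumpH (toH v)) (M.mulζ (M.jumpH (toH w))) := by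
  rw [form_eq_inner, gradH_toH, gradH_toH, jumpH_toH, jumpH_toH, map_sub, map_smul,
    mulζ_jumpL_onePair, smul_zero, sub_zero, inner_sub_left, inner_smul_left,
    inner_jumpL_onePair_mulζ, mul_zero, sub_zero]

lemma restrictCore_jumpH_toH (w : Pair Ω m) :
    M.restrictCore (M.jumpH (toH w)) = M.restrictCore (M.jumpL w) := by
  rw [jumpH_toH, map_sub, map_smul, restrictCore_jumpL_onePair, smul_zero, sub_zero]

/-- `(v, V) ↦ (∇v, (T̃v - V)|_𝓔)`, which turns `energyNorm` into a Hilbert space norm. -/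
def energyMap : HSpace Ω m →L[ℂ]
    WithLp 2 (Lp (CSpace d) 2 Ω.vol × Lp ℂ 2 (Ω.surface.restrict (⋃ j, M.core j))) :=
  (WithLp.prodContinuousLinearEquiv 2 ℂ _ _).symm.toContinuousLinearMap.comp
    ((gradH Ω m).prod (M.restrictCore.comp M.jumpH))

lemma norm_energyMap_sq (x : HSpace Ω m) :
    ‖M.energyMap x‖ ^ 2 = ‖gradH Ω m x‖ ^ 2 + ‖M.restrictCore (M.jumpH x)‖ ^ 2 :=
  WithLp.prod_norm_sq_eq_of_L2 (M.energyMap x)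

lemma norm_energyMap_toH (w : Pair Ω m) : ‖M.energyMap (toH w)‖ = M.energyNorm w := by
  rw [energyNorm, ← Real.sqrt_sq (norm_nonneg (M.energyMap (toH w))), norm_energyMap_sq,
    L2_norm_sq_eq_integral, L2_norm_sq_eq_integral, gradH_toH, restrictCore_jumpH_toH]
  congr 2
  refine integral_congr_ae ?_
  filter_upwards [M.restrictCore_ae_eq (M.jumpL w), ae_restrict_of_ae (M.jumpL_ae_eq w)]
    with x h1 h2
  rw [h1, h2]

lemma exists_norm_snd_le : ∃ C : ℝ, 0 ≤ C ∧ ∀ w : Pair Ω m,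
    ‖w.snd‖ ≤ C * (‖w.fst‖ + ‖M.energyMap (toH w)‖) := by
  set R := M.restrictCore
  obtain ⟨K, -, hK⟩ := (R.comp M.piecewiseL).toLinearMap.exists_antilipschitzWith
    (LinearMap.ker_eq_bot.2 M.restrictCore_piecewiseL_injective)
  refine ⟨K * (‖R.comp (trace Ω)‖ + 1), by positivity, fun w => ?_⟩
  have hjump : ‖R (M.jumpL w)‖ ≤ ‖M.energyMap (toH w)‖ :=
    M.restrictCore_jumpH_toH w ▸ WithLp.norm_snd_le _ (M.energyMap (toH w))
  have htrace : ‖R (trace Ω w.fst)‖ ≤ ‖R.comp (trace Ω)‖ * ‖w.fst‖ :=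
    (R.comp (trace Ω)).le_opNorm w.fst
  have hpiece : R (M.piecewiseL w.snd) = R (trace Ω w.fst) - R (M.jumpL w) := by
    rw [jumpL_apply, map_sub, sub_sub_cancel]
  calc ‖w.snd‖ ≤ K * ‖R (M.piecewiseL w.snd)‖ :=
        hK.le_mul_norm (map_zero _) w.snd
    _ ≤ K * (‖R (trace Ω w.fst)‖ + ‖R (M.jumpL w)‖) := by
        rw [hpiece]
        gcongr
        exact norm_sub_le _ _
    _ ≤ K * (‖R.comp (trace Ω)‖ * ‖w.fst‖ + ‖M.energyMap (toH w)‖) := by gcongr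
    _ ≤ K * ((‖R.comp (trace Ω)‖ + 1) * (‖w.fst‖ + ‖M.energyMap (toH w)‖)) := by
        gcongr
        have := mul_nonneg (norm_nonneg (R.comp (trace Ω))) (norm_nonneg (M.energyMap (toH w)))
        linarith [norm_nonneg w.fst]
    _ = K * (‖R.comp (trace Ω)‖ + 1) * (‖w.fst‖ + ‖M.energyMap (toH w)‖) := by ring

lemma exists_norm_toH_le_of_mem_range : ∃ C : ℝ, 0 < C ∧ ∀ w : Pair Ω m,
    w.fst ∈ range (ofSmooth Ω) → ‖toH w‖ ≤ C * ‖M.energyMap (toH w)‖ := by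
  obtain ⟨C₁, hC₁0, hC₁⟩ := exists_norm_sub_const_le Ω
  obtain ⟨C₂, hC₂0, hC₂⟩ := M.exists_norm_snd_le
  refine ⟨C₁ + C₂ * (C₁ + 1) + 1, by positivity, fun w ⟨φ, hφ⟩ => ?_⟩
  obtain ⟨c, hc⟩ := hC₁ φ
  rw [hφ] at hc
  set e := ‖M.energyMap (toH w)‖
  set w' : Pair Ω m := w - c • onePair Ω m
  have hw' : toH w' = toH w := toH_sub_smul_onePair w c
  have hfst : ‖w'.fst‖ ≤ C₁ * e := by
    refine hc.trans ?_
    gcongr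
    exact gradH_toH w ▸ WithLp.norm_fst_le _ (M.energyMap (toH w))
  have hsnd : ‖w'.snd‖ ≤ C₂ * (C₁ * e + e) :=
    (hC₂ w').trans (by rw [hw']; gcongr)
  calc ‖toH w‖ = ‖toH w'‖ := by rw [hw']
    _ ≤ ‖w'‖ := Submodule.Quotient.norm_mk_le _ _
    _ ≤ ‖w'.fst‖ + ‖w'.snd‖ := by
        refine le_of_sq_le_sq ?_ (by positivity)
        rw [WithLp.prod_norm_sq_eq_of_L2]
        nlinarith [norm_nonneg w'.fst, norm_nonneg w'.snd]
    _ ≤ C₁ * e + C₂ * (C₁ * e + e) := add_le_add hfst hsnd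
    _ ≤ (C₁ + C₂ * (C₁ + 1) + 1) * e := by linarith [norm_nonneg (M.energyMap (toH w))]

theorem exists_norm_le_energyMap :
    ∃ C : ℝ, 0 < C ∧ ∀ x : HSpace Ω m, ‖x‖ ≤ C * ‖M.energyMap x‖ := by
  obtain ⟨C, hC0, hC⟩ := M.exists_norm_toH_le_of_mem_range
  refine ⟨C, hC0, fun x => ?_⟩
  obtain ⟨w, rfl⟩ := Submodule.Quotient.mk_surjective _ x
  have hcont : Continuous fun w : Pair Ω m => toH w := continuous_quotient_mk'
  exact (denseRange_toLp_ofSmooth Ω m).induction_on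
    (p := fun w => ‖toH w‖ ≤ C * ‖M.energyMap (toH w)‖) w
    (isClosed_le hcont.norm (continuous_const.mul (M.energyMap.continuous.comp hcont).norm))
    fun q => hC _ (mem_range_self q.1)

theorem energyNorm_equiv : ∃ C : ℝ, 0 < C ∧ ∀ w : Pair Ω m,
    M.energyNorm w ≤ C * ‖toH w‖ ∧ ‖toH w‖ ≤ C * M.energyNorm w := by
  obtain ⟨C, hC0, hC⟩ := M.exists_norm_le_energyMap
  refine ⟨max C ‖M.energyMap‖, lt_max_of_lt_left hC0, fun w => ?_⟩
  rw [← M.norm_energyMap_toH]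
  exact ⟨M.energyMap.le_of_opNorm_le (le_max_right _ _) _, (hC _).trans (by gcongr; simp)⟩

end ElectrodeModel

/-! ### Families of operators satisfying a resolvent identity -/

section Resolvent

variable {𝕜 B W X R : Type*} [NontriviallyNormedField 𝕜] [NormedAddCommGroup B] [NormedSpace 𝕜 B]
  [NormedAddCommGroup W] [NormedSpace 𝕜 W] [NormedAddCommGroup X] [NormedSpace 𝕜 X]
  [NormedAddCommGroup R] [NormedSpace 𝕜 R]

lemma eq_comp_of_mul_one_sub_eq_one {S Q : X →L[𝕜] X} {n n' : W →L[𝕜] X}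
    (hS : S * (1 - Q) = 1) (h : n' = n + Q.comp n') : n' = S.comp n :=
  calc n' = (S * (1 - Q)).comp n' := by rw [hS]; rfl
    _ = S.comp (n' - Q.comp n') := rfl
    _ = S.comp n := by rw [sub_eq_iff_eq_add.2 h]

/-- The power series `b ↦ ∑ P(b)^k n`, the expansion of `(1 - P(b))⁻¹ n`. -/
def resolventSeries (P : B →L[𝕜] X →L[𝕜] X) (n : W →L[𝕜] X) :
    FormalMultilinearSeries 𝕜 B (W →L[𝕜] X) :=
  ((ContinuousLinearMap.compL 𝕜 W X X).flip n).compFormalMultilinearSeries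
    ((formalMultilinearSeries_geometric 𝕜 (X →L[𝕜] X)).compContinuousLinearMap P)

lemma resolventSeries_apply (P : B →L[𝕜] X →L[𝕜] X) (n : W →L[𝕜] X) (k : ℕ) (b : Fin k → B) :
    resolventSeries P n k b = ((List.ofFn fun i => P (b i)).prod).comp n := by
  simp [resolventSeries, formalMultilinearSeries_geometric, Function.comp_def]

lemma hasFPowerSeriesAt_inverse_one_sub_comp [CompleteSpace X] (P : B →L[𝕜] X →L[𝕜] X)
    (n : W →L[𝕜] X) (a : B) :
    HasFPowerSeriesAt (fun a' => (Ring.inverse (1 - P (a' - a))).comp n)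
      (resolventSeries P n) a := by
  have hgeom : HasFPowerSeriesAt (fun x : X →L[𝕜] X => Ring.inverse (1 - x))
      (formalMultilinearSeries_geometric 𝕜 (X →L[𝕜] X)) (P 0) := by
    rw [map_zero]
    exact ⟨1, hasFPowerSeriesOnBall_inverse_one_sub 𝕜 (X →L[𝕜] X)⟩
  obtain ⟨r, hr⟩ := hgeom.compContinuousLinearMap
  have hcomp :=
    (((ContinuousLinearMap.compL 𝕜 W X X).flip n).comp_hasFPowerSeriesOnBall hr).comp_sub a
  rw [zero_add] at hcomp
  exact ⟨r, hcomp⟩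

lemma hasFPowerSeriesAt_of_resolvent_identity [CompleteSpace X]
    {N : B → W →L[𝕜] X} {P : B →L[𝕜] X →L[𝕜] X} {a : B}
    (h : ∀ᶠ a' in 𝓝 a, N a' = N a + (P (a' - a)).comp (N a')) :
    HasFPowerSeriesAt N (resolventSeries P (N a)) a := by
  refine (hasFPowerSeriesAt_inverse_one_sub_comp P (N a) a).congr ?_
  have hcont : Continuous fun a' => ‖P (a' - a)‖ := by fun_prop
  have hsmall : ∀ᶠ a' in 𝓝 a, ‖P (a' - a)‖ < 1 :=
    hcont.continuousAt.eventually_lt continuousAt_const (by simp)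
  filter_upwards [h, hsmall] with a' ha' hlt
  exact (eq_comp_of_mul_one_sub_eq_one
    (Ring.inverse_mul_cancel _ (Units.oneSub _ hlt).isUnit) ha').symm

lemma summable_pow_of_conj_contraction [CompleteSpace R] {Q : X →L[𝕜] X} (Φ : X ≃L[𝕜] R) {q : ℝ}
    (hq0 : 0 ≤ q) (hq : q < 1) (hQ : ∀ x, ‖Φ (Q x)‖ ≤ q * ‖Φ x‖) :
    Summable fun k : ℕ => Q ^ k := by
  have hnorm : ‖Φ.conjContinuousAlgEquiv Q‖ < 1 := by
    refine (ContinuousLinearMap.opNorm_le_bound _ hq0 fun r => ?_).trans_lt hq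
    simpa using hQ (Φ.symm r)
  have hsum := (summable_geometric_of_norm_lt_one hnorm).map Φ.conjContinuousAlgEquiv.symm
    Φ.conjContinuousAlgEquiv.symm.continuous
  simpa only [Function.comp_def, map_pow, ContinuousAlgEquiv.symm_apply_apply] using hsum

lemma hasSum_pow_comp_of_resolvent_identity {Q : X →L[𝕜] X} {n n' : W →L[𝕜] X}
    (h : n' = n + Q.comp n') (hQ : Summable fun k : ℕ => Q ^ k) :
    HasSum (fun k : ℕ => (Q ^ k).comp n) n' := by
  rw [eq_comp_of_mul_one_sub_eq_one hQ.tsum_pow_mul_one_sub h]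
  exact ((ContinuousLinearMap.compL 𝕜 W X X).flip n).hasSum hQ.hasSum

lemma eq_tsum_pow_comp_of_resolvent_identity {Q : X →L[𝕜] X} {n n' : W →L[𝕜] X}
    (h : n' = n + Q.comp n') (hQ : Summable fun k : ℕ => Q ^ k) :
    n' = ∑' k : ℕ, (Q ^ k).comp n :=
  (hasSum_pow_comp_of_resolvent_identity h hQ).tsum_eq.symm

lemma analyticAt_clm_comp {N : B → W →L[𝕜] X} {a : B} (T : X →L[𝕜] R) (h : AnalyticAt 𝕜 N a) :
    AnalyticAt 𝕜 (fun a => T.comp (N a)) a :=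
  ((ContinuousLinearMap.compL 𝕜 W X R T).analyticAt _).comp h

section Derivatives

variable [CompleteSpace X] {N : B → W →L[𝕜] X} {P : B →L[𝕜] X →L[𝕜] X} {a : B}

lemma iteratedFDeriv_of_resolvent_identity
    (h : ∀ᶠ a' in 𝓝 a, N a' = N a + (P (a' - a)).comp (N a')) (k : ℕ) (b : Fin k → B) :
    iteratedFDeriv 𝕜 k N a b =
      (∑ α : Equiv.Perm (Fin k), (List.ofFn fun i => P (b (α i))).prod).comp (N a) := by
  obtain ⟨r, hr⟩ := hasFPowerSeriesAt_of_resolvent_identity h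
  rw [hr.iteratedFDeriv_eq_sum_of_completeSpace]
  simp only [resolventSeries_apply]
  ext I
  simp

lemma inv_factorial_smul_iteratedFDeriv_of_resolvent_identity [CharZero 𝕜]
    (h : ∀ᶠ a' in 𝓝 a, N a' = N a + (P (a' - a)).comp (N a')) (k : ℕ) (b : B) :
    ((k.factorial : 𝕜)⁻¹ • iteratedFDeriv 𝕜 k N a fun _ => b) = (P b ^ k).comp (N a) := by
  rw [iteratedFDeriv_of_resolvent_identity h]
  simp only [List.ofFn_const, List.prod_replicate, Finset.sum_const, Finset.card_univ,
    Fintype.card_perm, Fintype.card_fin]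
  rw [← Nat.cast_smul_eq_nsmul 𝕜, ContinuousLinearMap.smul_comp, smul_smul,
    inv_mul_cancel₀ (Nat.cast_ne_zero.2 k.factorial_ne_zero), one_smul]

lemma iteratedFDeriv_clm_comp (T : X →L[𝕜] R) (h : AnalyticAt 𝕜 N a) (k : ℕ) (b : Fin k → B) :
    iteratedFDeriv 𝕜 k (fun a => T.comp (N a)) a b = T.comp (iteratedFDeriv 𝕜 k N a b) :=
  congrArg (fun D => D b) <| (ContinuousLinearMap.compL 𝕜 W X R T).iteratedFDeriv_comp_left
    (h.contDiffAt (n := k)) le_rfl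

lemma hasSum_taylor_clm_comp (T : X →L[𝕜] R) (h : AnalyticAt 𝕜 N a) {b : B} {n : W →L[𝕜] X}
    (hs : HasSum (fun k : ℕ => (k.factorial : 𝕜)⁻¹ • iteratedFDeriv 𝕜 k N a fun _ => b) n) :
    HasSum (fun k : ℕ => (k.factorial : 𝕜)⁻¹ •
      iteratedFDeriv 𝕜 k (fun a => T.comp (N a)) a fun _ => b) (T.comp n) := by
  simpa only [iteratedFDeriv_clm_comp T h, ← ContinuousLinearMap.comp_smul] using!
    (ContinuousLinearMap.compL 𝕜 W X R T).hasSum hs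

end Derivatives

end Resolvent

/-! ### Coercivity -/

section Coercive

variable {𝕜 E F : Type*} [RCLike 𝕜] [NormedAddCommGroup E] [InnerProductSpace 𝕜 E]
  [NormedAddCommGroup F] [InnerProductSpace 𝕜 F]

lemma isUnit_of_coercive [CompleteSpace E] {S : E →L[𝕜] E} {c : ℝ} (hc : 0 < c)
    (h : ∀ x, c * ‖x‖ ^ 2 ≤ RCLike.re (inner 𝕜 x (S x))) : IsUnit S := by
  refine S.isUnit_of_forall_le_norm_inner_map (c := ⟨c, hc.le⟩) hc fun x => ?_
  rw [mul_comm, norm_inner_symm]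
  exact (h x).trans (RCLike.re_le_norm _)

lemma mul_norm_le_norm_of_coercive {S : E →L[𝕜] E} {c : ℝ}
    (h : ∀ x, c * ‖x‖ ^ 2 ≤ RCLike.re (inner 𝕜 x (S x))) (x : E) : c * ‖x‖ ≤ ‖S x‖ := by
  rcases eq_or_lt_of_le (norm_nonneg x) with hx | hx
  · simp [← hx]
  · refine le_of_mul_le_mul_left ?_ hx
    calc ‖x‖ * (c * ‖x‖) = c * ‖x‖ ^ 2 := by ring
      _ ≤ RCLike.re (inner 𝕜 x (S x)) := h x
      _ ≤ ‖x‖ * ‖S x‖ := re_inner_le_norm _ _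

lemma norm_adjoint_apply_le_of_contraction [CompleteSpace E] [CompleteSpace F] {G : E →L[𝕜] F}
    (h : ∀ x, ‖G x‖ ≤ ‖x‖) (y : F) : ‖ContinuousLinearMap.adjoint G y‖ ≤ ‖y‖ := by
  have hG : ‖G‖ ≤ 1 := G.opNorm_le_bound zero_le_one fun x => (h x).trans_eq (one_mul _).symm
  have hadj : ‖ContinuousLinearMap.adjoint G‖ ≤ 1 := by rwa [LinearIsometryEquiv.norm_map]
  exact (ContinuousLinearMap.adjoint G).le_of_opNorm_le_of_le hadj le_rfl |>.trans_eq (one_mul _)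

lemma integral_le_re_inner {α : Type*} {mα : MeasurableSpace α} {μ : Measure α}
    {u v : Lp E 2 μ} {g : α → ℝ} (hg : Integrable g μ)
    (h : ∀ᵐ x ∂μ, g x ≤ RCLike.re (inner 𝕜 (u x) (v x))) :
    ∫ x, g x ∂μ ≤ RCLike.re (inner 𝕜 u v) := by
  have hint : Integrable (fun x => inner 𝕜 (u x) (v x)) μ := L2.integrable_inner u v
  rw [L2.inner_def, ← integral_re hint]
  exact integral_mono_ae hg hint.re h

end Coercive

lemma re_inner_mul_self (a z : ℂ) : (inner ℂ z (a * z)).re = a.re * ‖z‖ ^ 2 := by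
  rw [← smul_eq_mul, inner_smul_right, inner_self_eq_norm_sq_to_K]
  simp [← Complex.ofReal_pow]

section Ellipticity

variable {Ω : LipschitzDomain d} {A B : LInf Ω} {c : ℝ}

lemma ae_norm_le_norm (B : LInf Ω) : ∀ᵐ x ∂Ω.vol, ‖B x‖ ≤ ‖B‖ := by
  rw [Lp.norm_def, toReal_eLpNorm (Lp.aestronglyMeasurable B)]
  exact ae_le_lpNorm_exponent_top (Lp.memLp B)

lemma IsEllipticConst.ae_forall (h : IsEllipticConst Ω A c) :
    ∀ᵐ x ∂Ω.vol, ∀ ξ : CSpace d, c * ‖ξ‖ ^ 2 ≤ (inner ℂ ξ (A x ξ)).re := by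
  have hdense := ae_all_iff.2 fun n : ℕ => h.2 (TopologicalSpace.denseSeq (CSpace d) n)
  filter_upwards [hdense] with x hx ξ
  refine (TopologicalSpace.denseRange_denseSeq (CSpace d)).induction_on
    (p := fun ξ => c * ‖ξ‖ ^ 2 ≤ (inner ℂ ξ (A x ξ)).re) ξ (isClosed_le ?_ ?_) hx
  · fun_prop
  · exact Complex.continuous_re.comp (continuous_id.inner (A x).continuous)

lemma IsEllipticConst.add (h : IsEllipticConst Ω A c) (hB : ‖B‖ < c) :
    IsEllipticConst Ω (A + B) (c - ‖B‖) := by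
  refine ⟨sub_pos.2 hB, fun ξ => ?_⟩
  filter_upwards [h.2 ξ, ae_norm_le_norm B, Lp.coeFn_add A B] with x hA hBx hadd
  have hlower : -(‖B‖ * ‖ξ‖ ^ 2) ≤ (inner ℂ ξ (B x ξ)).re := by
    refine neg_le_of_abs_le ((Complex.abs_re_le_norm _).trans ?_)
    calc ‖inner ℂ ξ (B x ξ)‖ ≤ ‖ξ‖ * ‖B x ξ‖ := norm_inner_le_norm _ _
      _ ≤ ‖ξ‖ * (‖B‖ * ‖ξ‖) := by gcongr; exact (B x).le_of_opNorm_le hBx ξ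
      _ = ‖B‖ * ‖ξ‖ ^ 2 := by ring
  rw [hadd, Pi.add_apply, add_apply, inner_add_right, Complex.add_re]
  linarith

lemma isOpen_LInfPos (Ω : LipschitzDomain d) : IsOpen (LInfPos Ω) := by
  refine Metric.isOpen_iff.2 ?_
  rintro A ⟨c, hc⟩
  refine ⟨c, hc.1, fun A' hA' => ?_⟩
  rw [Metric.mem_ball, dist_eq_norm] at hA'
  exact ⟨_, add_sub_cancel A A' ▸ hc.add hA'⟩

lemma mul_norm_sq_le_re_inner_mulMat (h : IsEllipticConst Ω A c) (u : Lp (CSpace d) 2 Ω.vol) :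
    c * ‖u‖ ^ 2 ≤ (inner ℂ u (mulMat Ω A u)).re := by
  rw [L2_norm_sq_eq_integral, ← integral_const_mul]
  refine integral_le_re_inner (𝕜 := ℂ) ((Lp.memLp u).norm.integrable_sq.const_mul c) ?_
  filter_upwards [h.ae_forall, mulMat_ae_eq A u] with x hell hx
  rw [hx]
  exact hell (u x)

end Ellipticity

lemma ElectrodeModel.mul_norm_sq_le_re_inner_mulζ {Ω : LipschitzDomain d} {m : ℕ}
    (M : ElectrodeModel Ω m) (u : Lp ℂ 2 Ω.surface) :
    M.cζ * ‖M.restrictCore u‖ ^ 2 ≤ (inner ℂ u (M.mulζ u)).re := by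
  have hnorm : M.cζ * ‖M.restrictCore u‖ ^ 2 =
      ∫ x, (⋃ j, M.core j).indicator (fun x => M.cζ * ‖u x‖ ^ 2) x ∂Ω.surface := by
    rw [L2_norm_sq_eq_integral, ← integral_const_mul,
      integral_indicator M.measurableSet_iUnion_core]
    refine integral_congr_ae ?_
    filter_upwards [M.restrictCore_ae_eq u] with x hx
    rw [hx]
  rw [hnorm]
  refine integral_le_re_inner (𝕜 := ℂ) (((Lp.memLp u).norm.integrable_sq.const_mul _).indicator
    M.measurableSet_iUnion_core) ?_
  filter_upwards [M.mulζ_ae_eq u, M.ζ_re_nonneg, M.cζ_le] with x hx hnonneg hcore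
  rw [hx]
  change _ ≤ (inner ℂ (u x) (M.ζ x * u x)).re
  rw [re_inner_mul_self]
  by_cases hmem : x ∈ ⋃ j, M.core j
  · rw [indicator_of_mem hmem]
    exact mul_le_mul_of_nonneg_right (hcore hmem) (sq_nonneg _)
  · rw [indicator_of_notMem hmem]
    positivity

namespace ElectrodeModel

variable {Ω : LipschitzDomain d} {m : ℕ} (M : ElectrodeModel Ω m) [NeZero m]

/-! ### The energy space and the operator of the form -/

lemma exists_antilipschitzWith_energyMap : ∃ K, AntilipschitzWith K M.energyMap := by
  obtain ⟨C, hC, h⟩ := M.exists_norm_le_energyMap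
  exact ⟨⟨C, hC.le⟩, M.energyMap.antilipschitz_of_bound h⟩

lemma injective_energyMap : Function.Injective M.energyMap :=
  M.exists_antilipschitzWith_energyMap.choose_spec.injective

lemma isClosed_range_energyMap : IsClosed (range M.energyMap) :=
  M.exists_antilipschitzWith_energyMap.choose_spec.isClosed_range M.energyMap.uniformContinuous

/-- `𝓗` with the energy norm as a Hilbert space, encoded as the range of `energyMap`. -/
def EnergySpace : Type := M.energyMap.range

instance : NormedAddCommGroup M.EnergySpace :=
  inferInstanceAs (NormedAddCommGroup M.energyMap.range)

instance : InnerProductSpace ℂ M.EnergySpace :=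
  inferInstanceAs (InnerProductSpace ℂ M.energyMap.range)

instance : CompleteSpace M.EnergySpace :=
  M.isClosed_range_energyMap.completeSpace_coe

/-- The identity of `𝓗`, from the quotient norm to the energy norm. -/
def energyEquiv : HSpace Ω m ≃L[ℂ] M.EnergySpace :=
  M.energyMap.equivRange M.injective_energyMap M.isClosed_range_energyMap

/-- The gradient on the energy space. -/
def gradE : M.EnergySpace →L[ℂ] Lp (CSpace d) 2 Ω.vol :=
  (gradH Ω m).comp M.energyEquiv.symm.toContinuousLinearMap

/-- The jump `T̃v - V` on the energy space, in the normalisation of `jumpH`. -/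
def jumpE : M.EnergySpace →L[ℂ] Lp ℂ 2 Ω.surface :=
  M.jumpH.comp M.energyEquiv.symm.toContinuousLinearMap

lemma norm_sq_energySpace (r : M.EnergySpace) :
    ‖r‖ ^ 2 = ‖M.gradE r‖ ^ 2 + ‖M.restrictCore (M.jumpE r)‖ ^ 2 := by
  obtain ⟨x, rfl⟩ := M.energyEquiv.surjective r
  have hnorm : ‖M.energyEquiv x‖ = ‖M.energyMap x‖ := rfl
  simp [hnorm, norm_energyMap_sq, gradE, jumpE]

lemma norm_gradE_le (r : M.EnergySpace) : ‖M.gradE r‖ ≤ ‖r‖ :=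
  le_of_sq_le_sq
    ((le_add_of_nonneg_right (sq_nonneg _)).trans_eq (M.norm_sq_energySpace r).symm) (norm_nonneg r)

/-- The operator on the energy space that represents the form `⟨·, ·⟩_B`. -/
def gradOp : LInf Ω →L[ℂ] M.EnergySpace →L[ℂ] M.EnergySpace :=
  (ContinuousLinearMap.adjoint M.gradE).postcomp M.EnergySpace ∘L
    M.gradE.precomp (Lp (CSpace d) 2 Ω.vol) ∘L mulMat Ω

lemma inner_gradOp (B : LInf Ω) (r s : M.EnergySpace) :
    inner ℂ s (M.gradOp B r) = inner ℂ (M.gradE s) (mulMat Ω B (M.gradE r)) :=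
  ContinuousLinearMap.adjoint_inner_right M.gradE s (mulMat Ω B (M.gradE r))

lemma norm_gradOp_le (B : LInf Ω) (r : M.EnergySpace) : ‖M.gradOp B r‖ ≤ ‖B‖ * ‖r‖ :=
  calc ‖M.gradOp B r‖ ≤ ‖mulMat Ω B (M.gradE r)‖ :=
        norm_adjoint_apply_le_of_contraction M.norm_gradE_le _
    _ ≤ ‖B‖ * ‖M.gradE r‖ := norm_mulMat_le B _
    _ ≤ ‖B‖ * ‖r‖ := by gcongr; exact M.norm_gradE_le r

/-- The operator on the energy space that represents the form `a_A`. -/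
def formOp (A : LInf Ω) : M.EnergySpace →L[ℂ] M.EnergySpace :=
  M.gradOp A + ContinuousLinearMap.adjoint M.jumpE ∘L M.mulζ ∘L M.jumpE

lemma formOp_add (A B : LInf Ω) : M.formOp (A + B) = M.formOp A + M.gradOp B := by
  rw [formOp, formOp, map_add, add_right_comm]

lemma inner_formOp (A : LInf Ω) (r s : M.EnergySpace) : inner ℂ s (M.formOp A r) =
    inner ℂ (M.gradE s) (mulMat Ω A (M.gradE r))
      + inner ℂ (M.jumpE s) (M.mulζ (M.jumpE r)) := by
  rw [formOp, add_apply, inner_add_right, inner_gradOp, ContinuousLinearMap.comp_apply,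
    ContinuousLinearMap.comp_apply, ContinuousLinearMap.adjoint_inner_right]

lemma form_eq_inner_formOp (A : LInf Ω) (w v : Pair Ω m) : M.form A w v =
    inner ℂ (M.energyEquiv (toH v)) (M.formOp A (M.energyEquiv (toH w))) := by
  rw [form_eq_inner_toH, inner_formOp]
  simp [gradE, jumpE]

lemma gradForm_eq_inner_gradOp (B : LInf Ω) (w v : Pair Ω m) : gradForm B w.fst v.fst =
    inner ℂ (M.energyEquiv (toH v)) (M.gradOp B (M.energyEquiv (toH w))) := by
  rw [gradForm_eq_inner, inner_gradOp, ← gradH_toH, ← gradH_toH]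
  simp [gradE]

lemma formOp_coercive {A : LInf Ω} {c : ℝ} (h : IsEllipticConst Ω A c) (r : M.EnergySpace) :
    min c M.cζ * ‖r‖ ^ 2 ≤ (inner ℂ r (M.formOp A r)).re :=
  calc min c M.cζ * ‖r‖ ^ 2
      = min c M.cζ * ‖M.gradE r‖ ^ 2 + min c M.cζ * ‖M.restrictCore (M.jumpE r)‖ ^ 2 := by
        rw [norm_sq_energySpace, mul_add]
    _ ≤ c * ‖M.gradE r‖ ^ 2 + M.cζ * ‖M.restrictCore (M.jumpE r)‖ ^ 2 := by
        gcongr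
        exacts [min_le_left _ _, min_le_right _ _]
    _ ≤ (inner ℂ (M.gradE r) (mulMat Ω A (M.gradE r))).re
          + (inner ℂ (M.jumpE r) (M.mulζ (M.jumpE r))).re :=
        add_le_add (mul_norm_sq_le_re_inner_mulMat h _) (M.mul_norm_sq_le_re_inner_mulζ _)
    _ = (inner ℂ r (M.formOp A r)).re := by rw [inner_formOp, Complex.add_re]

lemma isUnit_formOp {A : LInf Ω} (hA : A ∈ LInfPos Ω) : IsUnit (M.formOp A) := by
  obtain ⟨c, hc⟩ := hA
  exact isUnit_of_coercive (lt_min hc.1 M.cζ_pos) (M.formOp_coercive hc)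

lemma injective_formOp {A : LInf Ω} (hA : A ∈ LInfPos Ω) : Function.Injective (M.formOp A) :=
  (ContinuousLinearMap.isUnit_iff_bijective.1 (M.isUnit_formOp hA)).1

lemma formOp_inverse_apply {A : LInf Ω} (hA : A ∈ LInfPos Ω) (r : M.EnergySpace) :
    M.formOp A (Ring.inverse (M.formOp A) r) = r :=
  DFunLike.congr_fun (Ring.mul_inverse_cancel _ (M.isUnit_formOp hA)) r

/-! ### The solution operators -/

/-- The operator that represents the functional `(v, V) ↦ I · conj V` on the energy space. -/
def load : CDiamond m →L[ℂ] M.EnergySpace :=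
  ContinuousLinearMap.adjoint (𝕜 := ℂ) (E := M.EnergySpace) (F := CDiamond m)
    ((T2 Ω m).comp M.energyEquiv.symm.toContinuousLinearMap)

lemma sum_mul_conj_eq_inner_T2 (I : CDiamond m) (v : Pair Ω m) :
    ∑ j, (I : CSpace m) j * (starRingEnd ℂ) (v.snd j) = inner ℂ (T2 Ω m (toH v)) I := by
  have hT2 : (T2 Ω m (toH v) : CSpace m) = v.snd - mean m v.snd • allOnes m := rfl
  have horth : inner ℂ (allOnes m) (I : CSpace m) = 0 := by
    have hsum : ∑ j, (I : CSpace m) j = 0 := I.2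
    simp [PiLp.inner_apply, allOnes, hsum]
  rw [Submodule.coe_inner, hT2, inner_sub_left, inner_smul_left, horth, mul_zero, sub_zero,
    PiLp.inner_apply]
  rfl

lemma sum_mul_conj_eq_inner_load (I : CDiamond m) (v : Pair Ω m) :
    ∑ j, (I : CSpace m) j * (starRingEnd ℂ) (v.snd j)
      = inner ℂ (M.energyEquiv (toH v)) (M.load I) := by
  rw [sum_mul_conj_eq_inner_T2, load, ContinuousLinearMap.adjoint_inner_right]
  simp

lemma isSolution_iff (A : LInf Ω) (I : CDiamond m) (x : HSpace Ω m) :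
    M.IsSolution A I x ↔ M.formOp A (M.energyEquiv x) = M.load I := by
  constructor
  · intro h
    refine ext_inner_left ℂ fun s => ?_
    obtain ⟨y, rfl⟩ := M.energyEquiv.surjective s
    have hxy := h (sectionL Ω m x) (toH_sectionL x) (sectionL Ω m y)
    rwa [form_eq_inner_formOp, sum_mul_conj_eq_inner_load, toH_sectionL, toH_sectionL] at hxy
  · rintro h w rfl v
    rw [form_eq_inner_formOp, sum_mul_conj_eq_inner_load, h]

lemma isPerturbation_iff (A B : LInf Ω) (y x : HSpace Ω m) : M.IsPerturbation A B y x ↔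
    M.formOp A (M.energyEquiv x) = -M.gradOp B (M.energyEquiv y) := by
  constructor
  · intro h
    refine ext_inner_left ℂ fun s => ?_
    obtain ⟨v, rfl⟩ := M.energyEquiv.surjective s
    have hxy := h (sectionL Ω m x) (sectionL Ω m y) (toH_sectionL x) (toH_sectionL y)
      (sectionL Ω m v)
    rwa [form_eq_inner_formOp, gradForm_eq_inner_gradOp, toH_sectionL, toH_sectionL, toH_sectionL,
      ← inner_neg_right] at hxy
  · rintro h w z rfl rfl v
    rw [form_eq_inner_formOp, gradForm_eq_inner_gradOp, h, inner_neg_right]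

variable {A : LInf Ω}

lemma isSolution_N (hA : A ∈ LInfPos Ω) (I : CDiamond m) : M.IsSolution A I (M.N A I) := by
  have hexists : ∃ S : CDiamond m →L[ℂ] HSpace Ω m, ∀ I, M.IsSolution A I (S I) := by
    refine ⟨M.energyEquiv.symm.toContinuousLinearMap ∘L Ring.inverse (M.formOp A) ∘L M.load,
      fun I => (M.isSolution_iff A I _).2 ?_⟩
    simp [M.formOp_inverse_apply hA]
  rw [N, dif_pos hexists]
  exact hexists.choose_spec I

lemma isPerturbation_P (hA : A ∈ LInfPos Ω) (B : LInf Ω) (y : HSpace Ω m) :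
    M.IsPerturbation A B y (M.P A B y) := by
  have hexists : ∃ S : LInf Ω →L[ℂ] (HSpace Ω m →L[ℂ] HSpace Ω m),
      ∀ B y, M.IsPerturbation A B y (S B y) := by
    refine ⟨-((M.energyEquiv.symm.toContinuousLinearMap ∘L Ring.inverse (M.formOp A)).postcomp
        (HSpace Ω m) ∘L M.energyEquiv.toContinuousLinearMap.precomp M.EnergySpace ∘L M.gradOp),
      fun B y => (M.isPerturbation_iff A B y _).2 ?_⟩
    simp [M.formOp_inverse_apply hA]
  rw [P, dif_pos hexists]
  exact hexists.choose_spec B y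

theorem isSolution_iff_eq_N (hA : A ∈ LInfPos Ω) (I : CDiamond m) (x : HSpace Ω m) :
    M.IsSolution A I x ↔ x = M.N A I := by
  rw [isSolution_iff, ← (M.isSolution_iff A I _).1 (M.isSolution_N hA I),
    (M.injective_formOp hA).eq_iff, M.energyEquiv.injective.eq_iff]

theorem isPerturbation_iff_eq_P (hA : A ∈ LInfPos Ω) (B : LInf Ω) (y x : HSpace Ω m) :
    M.IsPerturbation A B y x ↔ x = M.P A B y := by
  rw [isPerturbation_iff, ← (M.isPerturbation_iff A B y _).1 (M.isPerturbation_P hA B y),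
    (M.injective_formOp hA).eq_iff, M.energyEquiv.injective.eq_iff]

lemma N_add_eq {B : LInf Ω} (hA : A ∈ LInfPos Ω) (hAB : A + B ∈ LInfPos Ω) :
    M.N (A + B) = M.N A + (M.P A B).comp (M.N (A + B)) := by
  ext1 I
  have hN := (M.isSolution_iff A I _).1 (M.isSolution_N hA I)
  have hN' := (M.isSolution_iff (A + B) I _).1 (M.isSolution_N hAB I)
  have hdiff : M.IsPerturbation A B (M.N (A + B) I) (M.N (A + B) I - M.N A I) := by
    rw [isPerturbation_iff, map_sub, map_sub, hN, ← hN', formOp_add, add_apply]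
    abel
  rw [add_apply, ContinuousLinearMap.comp_apply, ← (M.isPerturbation_iff_eq_P hA B _ _).1 hdiff,
    add_sub_cancel]

lemma norm_energyEquiv_P_le {c : ℝ} (h : IsEllipticConst Ω A c) (B : LInf Ω) (y : HSpace Ω m) :
    ‖M.energyEquiv (M.P A B y)‖ ≤ ‖B‖ / min c M.cζ * ‖M.energyEquiv y‖ := by
  rw [div_mul_eq_mul_div, le_div_iff₀ (lt_min h.1 M.cζ_pos), mul_comm]
  calc min c M.cζ * ‖M.energyEquiv (M.P A B y)‖
      ≤ ‖M.formOp A (M.energyEquiv (M.P A B y))‖ :=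
        mul_norm_le_norm_of_coercive (M.formOp_coercive h) _
    _ = ‖M.gradOp B (M.energyEquiv y)‖ := by
        rw [(M.isPerturbation_iff A B y _).1 (M.isPerturbation_P ⟨c, h⟩ B y), norm_neg]
    _ ≤ ‖B‖ * ‖M.energyEquiv y‖ := M.norm_gradOp_le B _

/-! ### Analyticity and Taylor series of the solution operators -/

lemma eventually_N_eq (hA : A ∈ LInfPos Ω) :
    ∀ᶠ A' in 𝓝 A, M.N A' = M.N A + (M.P A (A' - A)).comp (M.N A') := by
  filter_upwards [(isOpen_LInfPos Ω).mem_nhds hA] with A' hA'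
  have hN := M.N_add_eq (B := A' - A) hA (by rwa [add_sub_cancel])
  rwa [add_sub_cancel] at hN

theorem analyticOnNhd_N : AnalyticOnNhd ℂ M.N (LInfPos Ω) :=
  fun _ hA => (hasFPowerSeriesAt_of_resolvent_identity (X := HSpace Ω m)
    (M.eventually_N_eq hA)).analyticAt

theorem iteratedFDeriv_N (hA : A ∈ LInfPos Ω) (k : ℕ) (B : Fin k → LInf Ω) :
    iteratedFDeriv ℂ k M.N A B =
      (∑ α : Equiv.Perm (Fin k), (List.ofFn fun i => M.P A (B (α i))).prod).comp (M.N A) :=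
  iteratedFDeriv_of_resolvent_identity (X := HSpace Ω m) (M.eventually_N_eq hA) k B

lemma summable_P_pow {c : ℝ} (h : IsEllipticConst Ω A c) {B : LInf Ω} (hB : ‖B‖ < min c M.cζ) :
    Summable fun k : ℕ => M.P A B ^ k :=
  have hpos : 0 < min c M.cζ := lt_min h.1 M.cζ_pos
  summable_pow_of_conj_contraction M.energyEquiv (by positivity) ((div_lt_one hpos).2 hB)
    (M.norm_energyEquiv_P_le h B)

theorem hasSum_P_pow {c : ℝ} (h : IsEllipticConst Ω A c) {B : LInf Ω} (hB : ‖B‖ < min c M.cζ) :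
    HasSum (fun k : ℕ => (M.P A B ^ k).comp (M.N A)) (M.N (A + B)) :=
  hasSum_pow_comp_of_resolvent_identity (X := HSpace Ω m)
    (M.N_add_eq ⟨c, h⟩ ⟨_, h.add (hB.trans_le (min_le_left _ _))⟩) (M.summable_P_pow h hB)

theorem N_add_eq_tsum {c : ℝ} (h : IsEllipticConst Ω A c) {B : LInf Ω} (hB : ‖B‖ < min c M.cζ) :
    M.N (A + B) = ∑' k : ℕ, (M.P A B ^ k).comp (M.N A) :=
  eq_tsum_pow_comp_of_resolvent_identity (X := HSpace Ω m)
    (M.N_add_eq ⟨c, h⟩ ⟨_, h.add (hB.trans_le (min_le_left _ _))⟩) (M.summable_P_pow h hB)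

theorem hasSum_taylor_N {c : ℝ} (h : IsEllipticConst Ω A c) {B : LInf Ω}
    (hB : ‖B‖ < min c M.cζ) :
    HasSum (fun k : ℕ => (k.factorial : ℂ)⁻¹ • iteratedFDeriv ℂ k M.N A fun _ => B)
      (M.N (A + B)) := by
  simpa only [inv_factorial_smul_iteratedFDeriv_of_resolvent_identity (X := HSpace Ω m)
    (M.eventually_N_eq ⟨c, h⟩)] using M.hasSum_P_pow h hB

variable {R : Type*} [NormedAddCommGroup R] [NormedSpace ℂ R] (T : HSpace Ω m →L[ℂ] R)

theorem analyticOnNhd_comp_N : AnalyticOnNhd ℂ (fun A => T.comp (M.N A)) (LInfPos Ω) :=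
  fun A hA => analyticAt_clm_comp (X := HSpace Ω m) T (M.analyticOnNhd_N A hA)

theorem iteratedFDeriv_comp_N (hA : A ∈ LInfPos Ω) (k : ℕ) (B : Fin k → LInf Ω) :
    iteratedFDeriv ℂ k (fun A => T.comp (M.N A)) A B = T.comp (iteratedFDeriv ℂ k M.N A B) :=
  iteratedFDeriv_clm_comp (X := HSpace Ω m) T (M.analyticOnNhd_N A hA) k B

theorem hasSum_taylor_comp_N {c : ℝ} (h : IsEllipticConst Ω A c) {B : LInf Ω}
    (hB : ‖B‖ < min c M.cζ) :
    HasSum (fun k : ℕ => (k.factorial : ℂ)⁻¹ •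
      iteratedFDeriv ℂ k (fun A => T.comp (M.N A)) A fun _ => B) (T.comp (M.N (A + B))) :=
  hasSum_taylor_clm_comp (X := HSpace Ω m) T (M.analyticOnNhd_N A ⟨c, h⟩) (M.hasSum_taylor_N h hB)

end ElectrodeModel

end

end SCEM

theorem mainTheorem2 {d m : ℕ} (hd : 2 ≤ d) [NeZero m] (Ω : SCEM.LipschitzDomain d)
    (M : SCEM.ElectrodeModel Ω m) :
    -- the objects are well defined
    (∃! T, SCEM.IsTraceOp Ω T) ∧
    (∃ C : ℝ, 0 < C ∧ ∀ w : SCEM.Pair Ω m,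
      M.energyNorm w ≤ C * ‖SCEM.toH w‖ ∧ ‖SCEM.toH w‖ ≤ C * M.energyNorm w) ∧
    (∀ A ∈ SCEM.LInfPos Ω, ∀ I x, M.IsSolution A I x ↔ x = M.N A I) ∧
    (∀ A ∈ SCEM.LInfPos Ω, ∀ B y x, M.IsPerturbation A B y x ↔ x = M.P A B y) ∧
    -- smoothness and analyticity on the open set of admissible coefficients
    IsOpen (SCEM.LInfPos Ω) ∧
    ContDiffOn ℂ ∞ M.N (SCEM.LInfPos Ω) ∧
    ContDiffOn ℂ ∞ M.F (SCEM.LInfPos Ω) ∧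
    ContDiffOn ℂ ∞ M.Lam (SCEM.LInfPos Ω) ∧
    AnalyticOnNhd ℂ M.N (SCEM.LInfPos Ω) ∧
    AnalyticOnNhd ℂ M.F (SCEM.LInfPos Ω) ∧
    AnalyticOnNhd ℂ M.Lam (SCEM.LInfPos Ω) ∧
    -- formulas for the derivatives
    (∀ A ∈ SCEM.LInfPos Ω, ∀ (k : ℕ) (B : Fin k → SCEM.LInf Ω),
      iteratedFDeriv ℂ k M.N A B =
        (∑ α : Equiv.Perm (Fin k), (List.ofFn fun i => M.P A (B (α i))).prod).comp (M.N A) ∧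
      iteratedFDeriv ℂ k M.F A B = (SCEM.T1 Ω m).comp (iteratedFDeriv ℂ k M.N A B) ∧
      iteratedFDeriv ℂ k M.Lam A B = (SCEM.T2 Ω m).comp (iteratedFDeriv ℂ k M.N A B)) ∧
    -- Taylor series
    (∀ (A : SCEM.LInf Ω) (cA : ℝ), SCEM.IsEllipticConst Ω A cA →
      ∀ B : SCEM.LInf Ω, ‖B‖ < min cA M.cζ →
        A + B ∈ SCEM.LInfPos Ω ∧
        HasSum (fun k : ℕ => (k.factorial : ℂ)⁻¹ • iteratedFDeriv ℂ k M.N A fun _ => B)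
          (M.N (A + B)) ∧
        HasSum (fun k : ℕ => (M.P A B ^ k).comp (M.N A)) (M.N (A + B)) ∧
        HasSum (fun k : ℕ => (k.factorial : ℂ)⁻¹ • iteratedFDeriv ℂ k M.F A fun _ => B)
          (M.F (A + B)) ∧
        M.F (A + B) = (SCEM.T1 Ω m).comp (∑' k : ℕ, (M.P A B ^ k).comp (M.N A)) ∧
        HasSum (fun k : ℕ => (k.factorial : ℂ)⁻¹ • iteratedFDeriv ℂ k M.Lam A fun _ => B)
          (M.Lam (A + B)) ∧
        M.Lam (A + B) = (SCEM.T2 Ω m).comp (∑' k : ℕ, (M.P A B ^ k).comp (M.N A))) := by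
  have hopen := SCEM.isOpen_LInfPos Ω
  have hN : AnalyticOnNhd ℂ M.N (SCEM.LInfPos Ω) := M.analyticOnNhd_N
  have hF : AnalyticOnNhd ℂ M.F (SCEM.LInfPos Ω) := M.analyticOnNhd_comp_N (SCEM.T1 Ω m)
  have hLam : AnalyticOnNhd ℂ M.Lam (SCEM.LInfPos Ω) := M.analyticOnNhd_comp_N (SCEM.T2 Ω m)
  exact ⟨SCEM.existsUnique_isTraceOp Ω, M.energyNorm_equiv,
    fun _ hA => M.isSolution_iff_eq_N hA, fun _ hA => M.isPerturbation_iff_eq_P hA, hopen,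
    hN.contDiffOn hopen.uniqueDiffOn, hF.contDiffOn hopen.uniqueDiffOn,
    hLam.contDiffOn hopen.uniqueDiffOn, hN, hF, hLam,
    fun A hA k B => ⟨M.iteratedFDeriv_N hA k B, M.iteratedFDeriv_comp_N (SCEM.T1 Ω m) hA k B,
      M.iteratedFDeriv_comp_N (SCEM.T2 Ω m) hA k B⟩,
    fun A cA hA B hB => ⟨⟨_, hA.add (hB.trans_le (min_le_left _ _))⟩, M.hasSum_taylor_N hA hB,
      M.hasSum_P_pow hA hB, M.hasSum_taylor_comp_N (SCEM.T1 Ω m) hA hB,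
      congrArg (SCEM.T1 Ω m).comp (M.N_add_eq_tsum hA hB),
      M.hasSum_taylor_comp_N (SCEM.T2 Ω m) hA hB,
      congrArg (SCEM.T2 Ω m).comp (M.N_add_eq_tsum hA hB)⟩⟩
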